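/- Let $V=\mathbb R^7$ (or any seven-dimensional real vector space) with a basis $e_1,\dots,e_7$ and dual basis $e^1,\dots,e^7$, let $\Lambda^k=\Lambda^kV^*$, $e^{ijk}=e^i\wedge e^j\wedge e^k$, and $$\varphi = e^{123}+e^{145}+e^{167}+e^{246}-e^{257}-e^{347}-e^{356}\in\Lambda^3 .$$ Let $\mathrm G_2=\{A\in\mathrm{Aut}(V): A\varphi=\varphi\}$, where $A$ acts on forms by $(A\alpha)(v_1,\dots,v_k)=\alpha(A^{-1}v_1,\dots,A^{-1}v_k)$. Let $\mathfrak g_2=\{X\in\mathrm{End}(V):\exp(tX)\in\mathrm G_2 \text{ for all } t\in\mathbb R\}$ be its Lie algebra with the adjoint action $X\mapsto AXA^{-1}$. Let $g(x,y)=\sum_i x^iy^i$, let $\star$ be the Hodge star operator of $g$ and of the volume form $e^{12\dots7}$, and let $S_0^2V^*$ be the space of symmetric bilinear forms $b$ on $V$ with $\sum_i b(e_i,e_i)=0$. For $X\in\mathrm{End}(V)$ set $X^\flat=g(X\,\cdot\,,\,\cdot\,)$, and $\mathfrak g_2^\flat=\{X^\flat: X\in\mathfrak g_2\}$. Then $\mathfrak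 g_2$ and $S_0^2V^*$ are $\mathrm G_2$-invariant subspaces of $\mathrm{End}(V)$ and of the bilinear forms on $V$ respectively, and there are decompositions into irreducible $\mathrm G_2$-invariant subspaces $$\Lambda^2=\Lambda^2_7\oplus\Lambda^2_{14},\qquad \Lambda^3=\Lambda^3_1\oplus\Lambda^3_7\oplus\Lambda^3_{27},$$ with $\dim\Lambda^k_h=h$, where $$\Lambda^2_7=\{\alpha\in\Lambda^2:\star(\varphi\wedge\alpha)=2\alpha\}=\{\varphi(X,\cdot,\cdot):X\in V\},$$ $$\Lambda^2_{14}=\{\alpha\in\Lambda^2:\star(\varphi\wedge\alpha)=-\alpha\}=\mathfrak g_2^\flat,$$ $$\Lambda^3_1=\mathbb R\varphi,\qquad \Lambda^3_7=\{\star(\varphi\wedge\alpha):\alpha\in V^*\},$$ $$\Lambda^3_{27}=\{\alpha\in\Lambda^3:\alpha\wedge\varphi=0,\ \alpha\wedge\star\varphi=0\}.$$ Moreover, as $\mathrm G_2$-modules, $\Lambda^2_7\cong V^*\cong\Lambda^3_7$, $\Lambda^2_{14}\cong\mathfrak g_2$ and $\Lambda^3_{27}\cong S_0^2V^*$. -/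

import Mathlib

noncomputable section

namespace G2Forms

variable {V : Type*} [AddCommGroup V] [Module ℝ V]

/-- `Λ^k V*`: alternating `k`-linear forms on `V`. -/
abbrev Form (V : Type*) [AddCommGroup V] [Module ℝ V] (k : ℕ) : Type _ := V [⋀^Fin k]→ₗ[ℝ] ℝ

/-- The wedge product of alternating forms (the sum over shuffles, so that
`α ∧ β = α ⊗ β - β ⊗ α` for covectors). -/
def wedge {p q : ℕ} (α : Form V p) (β : Form V q) : Form V (p + q) :=
  ((LinearMap.mul' ℝ ℝ).compAlternatingMap (α.domCoprod β)).domDomCongr finSumFinEquiv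

/-- The form `e^{i_1 ... i_k} = e^{i_1} ∧ ... ∧ e^{i_k}` built from the dual basis of `e`; its value
at `(v_1, ..., v_k)` is the determinant of the matrix `(e^{i_b}(v_a))`. -/
def coframe (e : Module.Basis (Fin 7) ℝ V) {k : ℕ} (i : Fin k → Fin 7) : Form V k :=
  Matrix.detRowAlternating.compLinearMap (LinearMap.pi fun b => e.coord (i b))

/-- The three-form `φ = e^{123} + e^{145} + e^{167} + e^{246} - e^{257} - e^{347} - e^{356}`.
Indices in the code start from `0`. -/
def phi (e : Module.Basis (Fin 7) ℝ V) : Form V 3 :=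
  coframe e ![0, 1, 2] + coframe e ![0, 3, 4] + coframe e ![0, 5, 6] + coframe e ![1, 3, 5]
    - coframe e ![1, 4, 6] - coframe e ![2, 3, 6] - coframe e ![2, 4, 5]

/-- The scalar product `g(x, y) = ∑ x^i y^i`, for which `e` is orthonormal. -/
def metric (e : Module.Basis (Fin 7) ℝ V) (x y : V) : ℝ := ∑ i, e.coord i x * e.coord i y

/-- The volume form `e^{12...7}`. -/
def vol (e : Module.Basis (Fin 7) ℝ V) : Form V 7 := coframe e id

/-- Insertion of the vectors `x_1, ..., x_p` into the first `p` slots of a form of degree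
`n = p + q`. -/
def insertFirst {p q n : ℕ} (h : p + q = n) (ω : Form V n) (x : Fin p → V) : Form V q where
  toFun v := ω.domDomCongr (finSumFinEquiv.trans (finCongr h)).symm (Sum.elim x v)
  map_update_add' v i a b := by
    classical
    simp only [← Sum.update_elim_inr]
    convert AlternatingMap.map_update_add _ _ _ _ _
  map_update_smul' v i c a := by
    classical
    simp only [← Sum.update_elim_inr]
    convert AlternatingMap.map_update_smul _ _ _ _ _
  map_eq_zero_of_eq' v i j hv hij :=
    AlternatingMap.map_eq_zero_of_eq _ _ (i := Sum.inr i) (j := Sum.inr j) (by simpa using hv)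
      (by simpa using hij)

/-- The Hodge star operator of the metric and the volume form that make `e` an oriented orthonormal
basis: `⋆α = ∑_{i_1 < ... < i_p} α(e_{i_1}, ..., e_{i_p}) vol(e_{i_1}, ..., e_{i_p}, ·, ..., ·)`,
that is, the linear map with `⋆e^I = ± e^J`, where `J` is the complement of `I` and the sign is the
one with `e^I ∧ ⋆e^I = vol`. (In dimension seven `α ∧ ⋆β = ⋆β ∧ α` whenever `α`, `β` have the same
degree.) -/
def hodgeStar (e : Module.Basis (Fin 7) ℝ V) {p q : ℕ} (h : p + q = 7) (α : Form V p) : Form V q :=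
  ∑ i : Fin p ↪o Fin 7, α (e ∘ i) • insertFirst h (vol e) (e ∘ i)

/-- The action of `Aut(V)` on forms, `(Aα)(v_1, ..., v_k) = α(A⁻¹v_1, ..., A⁻¹v_k)`. -/
def formAction (V : Type*) [AddCommGroup V] [Module ℝ V] (k : ℕ) :
    Representation ℝ (V ≃ₗ[ℝ] V) (Form V k) where
  toFun A :=
    { toFun := fun α => α.compLinearMap ((A⁻¹ : V ≃ₗ[ℝ] V) : V →ₗ[ℝ] V)
      map_add' := fun _ _ => rfl
      map_smul' := fun _ _ => rfl }
  map_one' := rfl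
  map_mul' A B := by
    ext α v
    simp only [mul_inv_rev]
    rfl

/-- The group `G₂ = {A ∈ Aut(V) : Aφ = φ}`. -/
def G2 (e : Module.Basis (Fin 7) ℝ V) : Subgroup (V ≃ₗ[ℝ] V) where
  carrier := {A | formAction V 3 A (phi e) = phi e}
  mul_mem' {A B} hA hB := by
    simp only [Set.mem_ofPred_eq] at hA hB ⊢
    rw [map_mul, Module.End.mul_apply, hB, hA]
  one_mem' := by simp
  inv_mem' {A} hA := by
    simp only [Set.mem_ofPred_eq] at hA ⊢
    conv_lhs => rw [← hA]
    rw [← Module.End.mul_apply, ← map_mul, inv_mul_cancel, map_one, Module.End.one_apply]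

/-- The `G₂`-module `V`. -/
def stdRep (e : Module.Basis (Fin 7) ℝ V) : Representation ℝ (G2 e) V :=
  LinearEquiv.automorphismGroup.toLinearMapMonoidHom.comp (G2 e).subtype

/-- The `G₂`-module `Λ^k V*`. -/
def formRep (e : Module.Basis (Fin 7) ℝ V) (k : ℕ) : Representation ℝ (G2 e) (Form V k) :=
  (formAction V k).comp (G2 e).subtype

/-- The `G₂`-module `End(V)`, with the action by conjugation `X ↦ A X A⁻¹`. -/
def endRep (e : Module.Basis (Fin 7) ℝ V) : Representation ℝ (G2 e) (V →ₗ[ℝ] V) :=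
  (stdRep e).linHom (stdRep e)

/-- The `G₂`-module of bilinear forms on `V`, with the action `(Ab)(x, y) = b(A⁻¹x, A⁻¹y)`. -/
def bilinRep (e : Module.Basis (Fin 7) ℝ V) :
    Representation ℝ (G2 e) (V →ₗ[ℝ] Module.Dual ℝ V) :=
  (stdRep e).linHom (stdRep e).dual

/-- The underlying set of the Lie algebra `𝔤₂` of `G₂`: the endomorphisms `X` of `V` such that
`exp(tX) ∈ G₂` for all real `t`. The exponential is computed in matrices with respect to `e`. -/
def lieG2 (e : Module.Basis (Fin 7) ℝ V) : Set (V →ₗ[ℝ] V) :=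
  {X | ∀ t : ℝ, ∃ A ∈ G2 e,
    LinearMap.toMatrix e e (A : V →ₗ[ℝ] V) = NormedSpace.exp (t • LinearMap.toMatrix e e X)}

/-- The underlying set of `S₀²V*`: the symmetric bilinear forms on `V` that are traceless with
respect to the metric. -/
def tracelessSymm (e : Module.Basis (Fin 7) ℝ V) : Set (V →ₗ[ℝ] Module.Dual ℝ V) :=
  {b | (∀ x y, b x y = b y x) ∧ ∑ i, b (e i) (e i) = 0}

/-- The restriction of a `G₂`-module to the invariant subspace `W` is irreducible. -/
abbrev Irred {e : Module.Basis (Fin 7) ℝ V} {W : Type*} [AddCommGroup W] [Module ℝ W]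
    {ρ : Representation ℝ (G2 e) W} (U : Subrepresentation ρ) : Prop :=
  Representation.IsIrreducible (k := ℝ) (G := G2 e) (V := U.toSubmodule) U.toRepresentation

end G2Forms

end

noncomputable section

namespace G2Forms

variable {V : Type*} [AddCommGroup V] [Module ℝ V]

/-! The argument rests on two maps: `formDeriv (phi e)`, which lets an endomorphism `B` act on `φ`
as a derivation, and `contr`, the contraction of a bilinear form with `φ`. In the given frame the
components `c` of `φ` and `p` of `⋆φ` are integers, so the contraction identities of the octonion
product are finite checks. They imply `hcontr_derivComp`: contracting `B·φ` with `φ` over two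
indices recovers the symmetric part, the trace and the contraction of `B`. With the adjointness
relation `sum_mul_derivComp`, the kernel of `B ↦ B·φ` is therefore the space of skew endomorphisms
with zero contraction, and differentiating `exp(tX)` identifies it with `𝔤₂` (`lieG2_eq`).

That `G₂` preserves `g` is derived from the Lie algebra. Conjugation by `A ∈ G₂` preserves the
kernel, hence sends rotation generators in it to skew maps, so `A` is conformal; invariance of `|φ|²
= 42` forces the factor to be one (`metric_invariant`).

Since `⋆` inserts vectors into the volume form, `⋆(φ ∧ α)` is a contraction of `α` with `⋆φ`. On
two-forms this gives `2⋆(φ ∧ α) = ι(contr α) - 2α`, where `ι` inserts a vector into `φ` and `contr ∘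
ι = 6`. So the image of `ι` is the eigenspace for `2`, and the kernel of `contr`, which is `𝔤₂^♭`,
is the eigenspace for `-1`, of dimension `21 - 7 = 14`.

For three-forms, `49 - 14 = 35` makes `B ↦ B·φ` surjective. Bilinear forms split into multiples of
`g`, traceless symmetric forms, the forms `φ(x, ·, ·)` and `𝔤₂^♭`. The last part is killed and the
others map injectively to the summands of dimensions `1`, `27` and `7`; pairing with `φ` and `⋆φ`
separates them.

For irreducibility there is one criterion (`irreducible_of_common_vector`): with an invariant scalar
product it suffices that one nonzero vector lies in every nonzero invariant subspace. Signed
permutations in `G₂` and averaging over sign changes produce that vector; only `S₀²V*` needs an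
element of `G₂` that is not a signed permutation. -/

/-! ### Coframes, wedge products and the star of basis forms -/

theorem coframe_apply (e : Module.Basis (Fin 7) ℝ V) {k : ℕ} (i : Fin k → Fin 7) (v : Fin k → V) :
    coframe e i v = (Matrix.of fun a b => e.coord (i b) (v a)).det := rfl

/-- The tensor product of coordinate functions underlying a coframe form. -/
def coordTensor (e : Module.Basis (Fin 7) ℝ V) {k : ℕ} (i : Fin k → Fin 7) :
    MultilinearMap ℝ (fun _ : Fin k => V) ℝ :=
  (MultilinearMap.mkPiAlgebra ℝ (Fin k) ℝ).compLinearMap fun b => e.coord (i b)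

theorem coframe_eq_alternatization (e : Module.Basis (Fin 7) ℝ V) {k : ℕ} (i : Fin k → Fin 7) :
    coframe e i = MultilinearMap.alternatization (coordTensor e i) := by
  ext v
  rw [coframe_apply, Matrix.det_apply]
  rw [MultilinearMap.alternatization_apply]
  rfl

/-- Alternatization turns tensor products of multilinear maps into wedge products; no shuffles need
to be counted. -/
theorem wedge_coframe (e : Module.Basis (Fin 7) ℝ V) {p q : ℕ} (i : Fin p → Fin 7)
    (j : Fin q → Fin 7) :
    wedge (coframe e i) (coframe e j) = coframe e (Fin.append i j) := by
  rw [wedge, coframe_eq_alternatization, coframe_eq_alternatization,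
    ← MultilinearMap.domCoprod_alternization]
  ext v
  rw [coframe_apply, ← Matrix.det_reindex_self finSumFinEquiv.symm, Matrix.det_apply]
  simp [MultilinearMap.alternatization_apply, map_sum, coordTensor]

theorem coframe_perm (e : Module.Basis (Fin 7) ℝ V) {k : ℕ} (i : Fin k → Fin 7)
    (σ : Equiv.Perm (Fin k)) :
    coframe e (i ∘ σ) = (Equiv.Perm.sign σ : ℤ) • coframe e i := by
  ext v
  rw [AlternatingMap.smul_apply, coframe_apply, coframe_apply, zsmul_eq_mul,
    ← Matrix.det_permute' σ]
  rfl

/-- Expand `α` in coordinate tensors and alternatize: this multiplies an alternating map by `p!`.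
Summing over all tuples instead of increasing ones avoids any ordering, at the price of that factor.
-/
theorem form_eq_sum (e : Module.Basis (Fin 7) ℝ V) {p : ℕ} (α : Form V p) :
    (p.factorial : ℝ) • α = ∑ j : Fin p → Fin 7, α (e ∘ j) • coframe e j := by
  have h : (α : MultilinearMap ℝ (fun _ : Fin p => V) ℝ) =
      ∑ j : Fin p → Fin 7, α (e ∘ j) • coordTensor e j := by
    refine Module.Basis.ext_multilinear (fun _ => e) fun j => ?_
    rw [sum_apply, Finset.sum_eq_single j]
    · simp [coordTensor]
      rfl
    · intro k _ hk
      obtain ⟨a, ha⟩ := Function.ne_iff.mp hk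
      have : ∏ b, e.coord (k b) (e (j b)) = 0 :=
        Finset.prod_eq_zero (Finset.mem_univ a) (by simp [ha.symm])
      simp only [smul_apply, coordTensor, MultilinearMap.compLinearMap_apply,
        MultilinearMap.mkPiAlgebra_apply, this, smul_zero]
    · simp
  have h2 := congrArg (MultilinearMap.alternatization (R := ℝ)) h
  rw [AlternatingMap.coe_alternatization, map_sum, Fintype.card_fin] at h2
  rw [Nat.cast_smul_eq_nsmul, h2]
  refine Finset.sum_congr rfl fun j _ => ?_
  rw [coframe_eq_alternatization]
  ext v
  simp [MultilinearMap.alternatization_apply, Finset.mul_sum, mul_smul_comm]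

theorem finrank_form (e : Module.Basis (Fin 7) ℝ V) (p : ℕ) :
    Module.finrank ℝ (Form V p) = Nat.choose 7 p := by
  have := Module.Finite.of_basis e
  have := Module.Free.of_basis e
  rw [(exteriorPower.alternatingMapLinearEquiv (R := ℝ) (M := V) (N := ℝ) (n := p)).finrank_eq]
  rw [show Module.finrank ℝ (⋀[ℝ]^p V →ₗ[ℝ] ℝ) = Module.finrank ℝ (⋀[ℝ]^p V) from Subspace.dual_finrank_eq]
  rw [exteriorPower.finrank_eq, Module.finrank_eq_card_basis e, Fintype.card_fin]

theorem finite_form (e : Module.Basis (Fin 7) ℝ V) (p : ℕ) : FiniteDimensional ℝ (Form V p) := by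
  have := Module.Finite.of_basis e
  have := Module.Free.of_basis e
  exact Module.Finite.equiv (exteriorPower.alternatingMapLinearEquiv (R := ℝ) (M := V) (N := ℝ) (n := p)).symm

theorem insertFirst_apply {p q n : ℕ} (h : p + q = n) (ω : Form V n) (x : Fin p → V)
    (v : Fin q → V) : insertFirst h ω x v = ω (Fin.append x v ∘ Fin.cast h.symm) := by
  subst h
  change ω _ = ω _
  congr 1
  ext a
  refine Fin.addCases (fun b => ?_) (fun b => ?_) a <;> simp

theorem coframe_eq_zero_of_not_injective (e : Module.Basis (Fin 7) ℝ V) {k : ℕ} {i : Fin k → Fin 7}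
    (h : ¬ Function.Injective i) : coframe e i = 0 := by
  ext v
  simp only [Function.Injective, not_forall] at h
  obtain ⟨a, b, hab, hne⟩ := h
  rw [coframe_apply]
  exact Matrix.det_zero_of_column_eq hne fun c => by simp [hab]

theorem orderEmb_eq_of_forall_mem {k : ℕ} {i j : Fin k ↪o Fin 7} (hc : ∀ a, ∃ b, j a = i b) :
    i = j := by
  have h1 : Finset.univ.image j ⊆ Finset.univ.image i := by
    intro x hx
    obtain ⟨a, -, rfl⟩ := Finset.mem_image.mp hx
    obtain ⟨b, hb⟩ := hc a
    exact Finset.mem_image.mpr ⟨b, Finset.mem_univ _, hb.symm⟩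
  have h2 : Finset.univ.image j = Finset.univ.image i := Finset.eq_of_subset_of_card_le h1 (by
    rw [Finset.card_image_of_injective _ i.injective, Finset.card_image_of_injective _ j.injective])
  have h3 : Set.range i = Set.range j := by
    have := congrArg (fun s : Finset (Fin 7) => (s : Set (Fin 7))) h2
    simpa using this.symm
  exact DFunLike.coe_injective (((OrderEmbedding.strictMono i).range_inj
    (OrderEmbedding.strictMono j)).mp h3)

theorem coframe_orderEmb (e : Module.Basis (Fin 7) ℝ V) {k : ℕ} (i j : Fin k ↪o Fin 7) :
    coframe e i (e ∘ j) = if i = j then 1 else 0 := by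
  rw [coframe_apply]
  split_ifs with h
  · subst h
    convert Matrix.det_one (R := ℝ) (n := Fin k) using 2
    ext a b
    simp [Matrix.one_apply, Finsupp.single_apply]
  · have : ∃ a, ∀ b, j a ≠ i b := by
      by_contra! hc
      exact h (orderEmb_eq_of_forall_mem hc)
    obtain ⟨a, ha⟩ := this
    exact Matrix.det_eq_zero_of_row_eq_zero a fun b => by
      simp [Finsupp.single_apply, ha b]

/-- An injective tuple is an increasing one up to a permutation, and both sides change by its sign;
for a tuple with a repetition both sides vanish. -/
theorem sum_coframe_smul (e : Module.Basis (Fin 7) ℝ V) {p : ℕ} {W : Type*} [AddCommGroup W]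
    [Module ℝ W] (F : V [⋀^Fin p]→ₗ[ℝ] W) (j : Fin p → Fin 7) :
    ∑ i : Fin p ↪o Fin 7, coframe e j (e ∘ i) • F (e ∘ i) = F (e ∘ j) := by
  by_cases hj : Function.Injective j
  · have hc : (Finset.univ.image j).card = p := by
      rw [Finset.card_image_of_injective _ hj, Finset.card_univ, Fintype.card_fin]
    let I := (Finset.univ.image j).orderEmbOfFin hc
    have hI : ∀ a, ∃ b, I b = j a := fun a => by
      have : j a ∈ Set.range I := by
        rw [Finset.range_orderEmbOfFin]; simp
      exact this
    choose σ hσ using hI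
    have hσi : Function.Injective σ := fun a b hab => hj (by rw [← hσ a, ← hσ b, hab])
    let τ : Equiv.Perm (Fin p) := Equiv.ofBijective σ (Finite.injective_iff_bijective.mp hσi)
    have hjτ : j = I ∘ τ := funext fun a => (hσ a).symm
    rw [hjτ, coframe_perm, Finset.sum_eq_single I]
    · rw [AlternatingMap.smul_apply, coframe_orderEmb, if_pos rfl, ← Function.comp_assoc,
        F.map_perm]
      simp [Units.smul_def, ← Int.cast_smul_eq_zsmul ℝ]
    · intro i _ hi
      rw [AlternatingMap.smul_apply, coframe_orderEmb, if_neg (Ne.symm hi)]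
      simp
    · simp
  · rw [coframe_eq_zero_of_not_injective e hj]
    simp only [Function.Injective, not_forall] at hj
    obtain ⟨a, b, hab, hne⟩ := hj
    rw [F.map_eq_zero_of_eq _ (i := a) (j := b) (by simp [hab]) hne]
    simp

theorem form_sum_apply {ι : Type*} {p : ℕ} (s : Finset ι) (f : ι → Form V p) (v : Fin p → V) :
    (∑ i ∈ s, f i) v = ∑ i ∈ s, f i v := by
  classical
  induction s using Finset.induction_on with
  | empty => simp
  | insert a s ha ih => rw [Finset.sum_insert ha, Finset.sum_insert ha, AlternatingMap.add_apply, ih]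

/-- Fixing the last arguments of an alternating map. -/
def fixLast {p q : ℕ} (ω : V [⋀^Fin p ⊕ Fin q]→ₗ[ℝ] ℝ) (v : Fin q → V) : Form V p where
  toFun x := ω (Sum.elim x v)
  map_update_add' x i a b := by
    classical
    simp only [← Sum.update_elim_inl]
    convert AlternatingMap.map_update_add _ _ _ _ _
  map_update_smul' x i c a := by
    classical
    simp only [← Sum.update_elim_inl]
    convert AlternatingMap.map_update_smul _ _ _ _ _
  map_eq_zero_of_eq' x i j hx hij :=
    AlternatingMap.map_eq_zero_of_eq _ _ (i := Sum.inl i) (j := Sum.inl j) (by simpa using hx)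
      (by simpa using hij)

theorem insertFirst_eq_fixLast {p q n : ℕ} (h : p + q = n) (ω : Form V n) (x : Fin p → V)
    (v : Fin q → V) :
    insertFirst h ω x v =
      fixLast (ω.domDomCongr (finSumFinEquiv.trans (finCongr h)).symm) v x := rfl

/-- The indices need not be increasing, because insertion into the volume form is alternating in the
inserted vectors (`fixLast`), so that `sum_coframe_smul` applies. -/
theorem hodgeStar_coframe (e : Module.Basis (Fin 7) ℝ V) {p q : ℕ} (h : p + q = 7)
    (j : Fin p → Fin 7) : hodgeStar e h (coframe e j) = insertFirst h (vol e) (e ∘ j) := by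
  ext v
  rw [hodgeStar, form_sum_apply]
  simp only [AlternatingMap.smul_apply, insertFirst_eq_fixLast]
  exact sum_coframe_smul e _ j

theorem hodgeStar_add (e : Module.Basis (Fin 7) ℝ V) {p q : ℕ} (h : p + q = 7) (α β : Form V p) :
    hodgeStar e h (α + β) = hodgeStar e h α + hodgeStar e h β := by
  simp [hodgeStar, add_smul, Finset.sum_add_distrib]

theorem hodgeStar_smul (e : Module.Basis (Fin 7) ℝ V) {p q : ℕ} (h : p + q = 7) (c : ℝ)
    (α : Form V p) : hodgeStar e h (c • α) = c • hodgeStar e h α := by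
  simp [hodgeStar, mul_smul, Finset.smul_sum]

/-- The Hodge star as a linear map. -/
def starLin (e : Module.Basis (Fin 7) ℝ V) {p q : ℕ} (h : p + q = 7) : Form V p →ₗ[ℝ] Form V q where
  toFun := hodgeStar e h
  map_add' := hodgeStar_add e h
  map_smul' := hodgeStar_smul e h

/-- The wedge product as a bilinear map. -/
def wedgeLin (V : Type*) [AddCommGroup V] [Module ℝ V] (p q : ℕ) :
    Form V p →ₗ[ℝ] Form V q →ₗ[ℝ] Form V (p + q) :=
  LinearMap.mk₂ ℝ wedge
    (fun a b c => by
      ext v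
      simp [wedge, ← AlternatingMap.domCoprod'_apply, TensorProduct.add_tmul])
    (fun a b c => by
      ext v
      simp [wedge, ← AlternatingMap.domCoprod'_apply, ← TensorProduct.smul_tmul'])
    (fun a b c => by
      ext v
      simp [wedge, ← AlternatingMap.domCoprod'_apply, TensorProduct.tmul_add])
    (fun a b c => by
      ext v
      simp [wedge, ← AlternatingMap.domCoprod'_apply])

/-- If `j` and `k` together form a permutation of all indices, then
`⋆ e^j` is `± e^k`. -/
theorem insertFirst_vol (e : Module.Basis (Fin 7) ℝ V) {p q : ℕ} (h : p + q = 7)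
    (j : Fin p → Fin 7) (k : Fin q → Fin 7) (σ : Equiv.Perm (Fin 7))
    (hσ : ∀ a, Fin.append j k (Fin.cast h.symm a) = σ a) :
    insertFirst h (vol e) (e ∘ j) = (Equiv.Perm.sign σ : ℤ) • coframe e k := by
  have h1 : vol e = (Equiv.Perm.sign σ : ℤ) • coframe e σ := by
    have := coframe_perm e (id : Fin 7 → Fin 7) σ
    rw [Function.id_comp] at this
    rw [this, vol, smul_smul, ← Units.val_mul]
    simp
  have hjk : ∀ a b, j a ≠ k b := by
    intro a b hab
    have := σ.injective ((hσ (Fin.cast h (Fin.castAdd q a))).symm.trans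
      ((by simp [hab] : _ = Fin.append j k (Fin.cast h.symm (Fin.cast h (Fin.natAdd p b)))).trans (hσ _)))
    have := congrArg Fin.val this
    simp at this
    omega
  have hj : Function.Injective j := by
    intro a b hab
    have := σ.injective ((hσ (Fin.cast h (Fin.castAdd q a))).symm.trans
      ((by simp [hab] : _ = Fin.append j k (Fin.cast h.symm (Fin.cast h (Fin.castAdd q b)))).trans (hσ _)))
    have := congrArg Fin.val this
    simp at this
    exact Fin.ext this
  ext v
  rw [h1, insertFirst_apply, AlternatingMap.smul_apply, AlternatingMap.smul_apply, coframe_apply,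
    coframe_apply]
  congr 1
  rw [← Matrix.det_submatrix_equiv_self (finSumFinEquiv.trans (finCongr h))]
  -- The inserted vectors pair with the covectors of `j` to the identity and with those of `k` to
  -- zero, so the matrix is block triangular.
  trans (Matrix.fromBlocks (1 : Matrix (Fin p) (Fin p) ℝ) 0
    (Matrix.of fun a b => e.coord (j b) (v a)) (Matrix.of fun a b => e.coord (k b) (v a))).det
  · congr 1
    ext a b
    rcases a with a | a <;> rcases b with b | b <;>
      simp [← hσ, Matrix.one_apply, Finsupp.single_apply, hj.eq_iff, hjk]
  · rw [Matrix.det_fromBlocks_zero₁₂, Matrix.det_one, one_mul]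

/-! ### Integer components of `φ` and `⋆φ` -/

/-- The product of the imaginary octonion units `i` and `j`, up to sign. -/
def octIndex : Fin 7 → Fin 7 → Fin 7 :=
  ![![0, 2, 1, 4, 3, 6, 5], ![2, 1, 0, 5, 6, 3, 4], ![1, 0, 2, 6, 5, 4, 3], ![4, 5, 6, 3, 0, 1, 2],
    ![3, 6, 5, 0, 4, 2, 1], ![6, 3, 4, 1, 2, 5, 0], ![5, 4, 3, 2, 1, 0, 6]]

/-- The sign of the product of the imaginary octonion units `i` and `j`. -/
def octSign : Fin 7 → Fin 7 → ℤ :=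
  ![![0, 1, -1, 1, -1, 1, -1], ![-1, 0, 1, 1, -1, -1, 1], ![1, -1, 0, -1, -1, 1, 1],
    ![-1, -1, 1, 0, 1, 1, -1], ![1, 1, 1, -1, 0, -1, -1], ![-1, 1, -1, -1, 1, 0, 1],
    ![1, -1, -1, 1, 1, -1, 0]]

/-- The components of `φ`. -/
def c (i j k : Fin 7) : ℤ := if k = octIndex i j then octSign i j else 0

/-- The components of `⋆φ`. -/
def p (i j k l : Fin 7) : ℤ :=
  (∑ m, c m i j * c m k l) - ((if i = k ∧ j = l then 1 else 0) - if i = l ∧ j = k then 1 else 0)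

/-- The Kronecker delta. -/
def delta (a i : Fin 7) : ℤ := if a = i then 1 else 0

/-- The `2 × 2` minors of the identity matrix. -/
def delta2 (a b i j : Fin 7) : ℤ := delta a i * delta b j - delta a j * delta b i

/-- The `3 × 3` minors of the identity matrix. -/
def delta3 (a b d i j k : Fin 7) : ℤ :=
  delta a i * delta2 b d j k - delta a j * delta2 b d i k + delta a k * delta2 b d i j

/-- The `4 × 4` minors of the identity matrix. -/
def delta4 (a b d f i j k l : Fin 7) : ℤ :=
  delta a i * delta3 b d f j k l - delta a j * delta3 b d f i k l + delta a k * delta3 b d f i j l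
   - delta a l * delta3 b d f i j k

/-- The multiplication table is quick to evaluate in the later finite checks; the seven minors are
what the definition of `φ` produces. This identifies the two. -/
theorem c_eq : ∀ i j k, c i j k = delta3 0 1 2 i j k + delta3 0 3 4 i j k + delta3 0 5 6 i j k
    + delta3 1 3 5 i j k - delta3 1 4 6 i j k - delta3 2 3 6 i j k - delta3 2 4 5 i j k := by
  decide +kernel
theorem p_eq : ∀ i j k l, p i j k l = delta4 3 4 5 6 i j k l + delta4 1 2 5 6 i j k l + delta4 1 2 3 4 i j k l
    + delta4 0 2 4 6 i j k l - delta4 0 2 3 5 i j k l - delta4 0 1 4 5 i j k l - delta4 0 1 3 6 i j k l := by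
  decide +kernel

theorem vec2_comp {W : Type*} (f : Fin 7 → W) (i j : Fin 7) : f ∘ ![i, j] = ![f i, f j] := by
  ext a; fin_cases a <;> rfl

theorem vec3_comp {W : Type*} (f : Fin 7 → W) (i j k : Fin 7) :
    f ∘ ![i, j, k] = ![f i, f j, f k] := by
  ext a; fin_cases a <;> rfl

theorem coord_basis (e : Module.Basis (Fin 7) ℝ V) (a i : Fin 7) :
    e.coord a (e i) = (delta a i : ℝ) := by
  simp [delta, Finsupp.single_apply, eq_comm]

theorem coframe3_basis (e : Module.Basis (Fin 7) ℝ V) (a b d i j k : Fin 7) :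
    coframe e ![a, b, d] ![e i, e j, e k] = (delta3 a b d i j k : ℝ) := by
  rw [coframe_apply, Matrix.det_fin_three]
  simp only [Matrix.of_apply, Matrix.cons_val, coord_basis, delta3, delta2]
  push_cast
  ring

theorem det_fin_four (M : Matrix (Fin 4) (Fin 4) ℝ) :
    M.det = M 0 0 * (M 1 1 * (M 2 2 * M 3 3 - M 3 2 * M 2 3) - M 2 1 * (M 1 2 * M 3 3 - M 3 2 * M 1 3)
        + M 3 1 * (M 1 2 * M 2 3 - M 2 2 * M 1 3))
      - M 1 0 * (M 0 1 * (M 2 2 * M 3 3 - M 3 2 * M 2 3) - M 2 1 * (M 0 2 * M 3 3 - M 3 2 * M 0 3)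
        + M 3 1 * (M 0 2 * M 2 3 - M 2 2 * M 0 3))
      + M 2 0 * (M 0 1 * (M 1 2 * M 3 3 - M 3 2 * M 1 3) - M 1 1 * (M 0 2 * M 3 3 - M 3 2 * M 0 3)
        + M 3 1 * (M 0 2 * M 1 3 - M 1 2 * M 0 3))
      - M 3 0 * (M 0 1 * (M 1 2 * M 2 3 - M 2 2 * M 1 3) - M 1 1 * (M 0 2 * M 2 3 - M 2 2 * M 0 3)
        + M 2 1 * (M 0 2 * M 1 3 - M 1 2 * M 0 3)) := by
  rw [Matrix.det_succ_column_zero]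
  simp [Fin.sum_univ_succ, Matrix.det_fin_three, Fin.succAbove]
  ring!

theorem coframe4_basis (e : Module.Basis (Fin 7) ℝ V) (a b d f i j k l : Fin 7) :
    coframe e ![a, b, d, f] ![e i, e j, e k, e l] = (delta4 a b d f i j k l : ℝ) := by
  rw [coframe_apply, det_fin_four]
  simp only [Matrix.of_apply, Matrix.cons_val, coord_basis, delta4, delta3, delta2]
  push_cast
  ring

theorem phi_basis (e : Module.Basis (Fin 7) ℝ V) (i j k : Fin 7) :
    phi e ![e i, e j, e k] = (c i j k : ℝ) := by
  rw [c_eq]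
  simp only [phi, AlternatingMap.add_apply, AlternatingMap.sub_apply, coframe3_basis]
  push_cast
  ring

/-- The four-form `⋆φ`. -/
def psi (e : Module.Basis (Fin 7) ℝ V) : Form V 4 :=
  coframe e ![3, 4, 5, 6] + coframe e ![1, 2, 5, 6] + coframe e ![1, 2, 3, 4]
    + coframe e ![0, 2, 4, 6] - coframe e ![0, 2, 3, 5] - coframe e ![0, 1, 4, 5]
    - coframe e ![0, 1, 3, 6]

theorem psi_basis (e : Module.Basis (Fin 7) ℝ V) (i j k l : Fin 7) :
    psi e ![e i, e j, e k, e l] = (p i j k l : ℝ) := by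
  rw [p_eq]
  simp only [psi, AlternatingMap.add_apply, AlternatingMap.sub_apply, coframe4_basis]
  push_cast
  ring

/-- A permutation of the indices from a list of values and a list of values of the inverse. -/
abbrev permOf (f g : Fin 7 → Fin 7) (h : ∀ a, g (f a) = a) (h' : ∀ a, f (g a) = a) :
    Equiv.Perm (Fin 7) := ⟨f, g, h, h'⟩

theorem star_coframe3 (e : Module.Basis (Fin 7) ℝ V) (j : Fin 3 → Fin 7) (k : Fin 4 → Fin 7)
    (g : Fin 7 → Fin 7)
    (h : ∀ a, g (Fin.append j k a) = a) (h' : ∀ a, Fin.append j k (g a) = a)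
    (hs : Equiv.Perm.sign (permOf (Fin.append j k) g h h') = 1) :
    starLin e (p := 3) (q := 4) rfl (coframe e j) = coframe e k := by
  change hodgeStar e _ _ = _
  rw [hodgeStar_coframe, insertFirst_vol e rfl j k (permOf (Fin.append j k) g h h') fun _ => rfl,
    hs]
  simp

theorem star_coframe4 (e : Module.Basis (Fin 7) ℝ V) (j : Fin 4 → Fin 7) (k : Fin 3 → Fin 7)
    (g : Fin 7 → Fin 7)
    (h : ∀ a, g (Fin.append j k a) = a) (h' : ∀ a, Fin.append j k (g a) = a)
    (hs : Equiv.Perm.sign (permOf (Fin.append j k) g h h') = 1) :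
    starLin e (p := 4) (q := 3) rfl (coframe e j) = coframe e k := by
  change hodgeStar e _ _ = _
  rw [hodgeStar_coframe, insertFirst_vol e rfl j k (permOf (Fin.append j k) g h h') fun _ => rfl,
    hs]
  simp

theorem star_phi (e : Module.Basis (Fin 7) ℝ V) : hodgeStar e (p := 3) (q := 4) rfl (phi e) = psi e := by
  change starLin e _ _ = _
  simp only [phi, psi, map_add, map_sub]
  rw [star_coframe3 e ![0, 1, 2] ![3, 4, 5, 6] ![0, 1, 2, 3, 4, 5, 6] (by decide) (by decide) (by decide +kernel),
    star_coframe3 e ![0, 3, 4] ![1, 2, 5, 6] ![0, 3, 4, 1, 2, 5, 6] (by decide) (by decide) (by decide +kernel),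
    star_coframe3 e ![0, 5, 6] ![1, 2, 3, 4] ![0, 3, 4, 5, 6, 1, 2] (by decide) (by decide) (by decide +kernel),
    star_coframe3 e ![1, 3, 5] ![0, 2, 4, 6] ![3, 0, 4, 1, 5, 2, 6] (by decide) (by decide) (by decide +kernel),
    star_coframe3 e ![1, 4, 6] ![0, 2, 3, 5] ![3, 0, 4, 5, 1, 6, 2] (by decide) (by decide) (by decide +kernel),
    star_coframe3 e ![2, 3, 6] ![0, 1, 4, 5] ![3, 4, 0, 1, 5, 6, 2] (by decide) (by decide) (by decide +kernel),
    star_coframe3 e ![2, 4, 5] ![0, 1, 3, 6] ![3, 4, 0, 5, 1, 2, 6] (by decide) (by decide) (by decide +kernel)]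

theorem star_psi (e : Module.Basis (Fin 7) ℝ V) : hodgeStar e (p := 4) (q := 3) rfl (psi e) = phi e := by
  change starLin e _ _ = _
  simp only [phi, psi, map_add, map_sub]
  rw [star_coframe4 e ![3, 4, 5, 6] ![0, 1, 2] ![4, 5, 6, 0, 1, 2, 3] (by decide) (by decide) (by decide +kernel),
    star_coframe4 e ![1, 2, 5, 6] ![0, 3, 4] ![4, 0, 1, 5, 6, 2, 3] (by decide) (by decide) (by decide +kernel),
    star_coframe4 e ![1, 2, 3, 4] ![0, 5, 6] ![4, 0, 1, 2, 3, 5, 6] (by decide) (by decide) (by decide +kernel),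
    star_coframe4 e ![0, 2, 4, 6] ![1, 3, 5] ![0, 4, 1, 5, 2, 6, 3] (by decide) (by decide) (by decide +kernel),
    star_coframe4 e ![0, 2, 3, 5] ![1, 4, 6] ![0, 4, 1, 2, 5, 3, 6] (by decide) (by decide) (by decide +kernel),
    star_coframe4 e ![0, 1, 4, 5] ![2, 3, 6] ![0, 1, 4, 5, 2, 3, 6] (by decide) (by decide) (by decide +kernel),
    star_coframe4 e ![0, 1, 3, 6] ![2, 4, 5] ![0, 1, 4, 2, 5, 6, 3] (by decide) (by decide) (by decide +kernel)]

/-! ### The star of a wedge product as a contraction -/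

theorem form_smul_cancel {k : ℕ} {W : Type*} [AddCommGroup W] [Module ℝ W] {x y : W}
    (h : (k.factorial : ℝ) • x = (k.factorial : ℝ) • y) : x = y :=
  smul_right_injective W (by positivity) h

/-- The span of the coframe forms is everything. -/
theorem form_linear_ext (e : Module.Basis (Fin 7) ℝ V) {k : ℕ} {W : Type*} [AddCommGroup W]
    [Module ℝ W] {f g : Form V k →ₗ[ℝ] W} (h : ∀ i, f (coframe e i) = g (coframe e i)) : f = g := by
  ext α
  apply form_smul_cancel (k := k)
  rw [← map_smul, ← map_smul, form_eq_sum e α]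
  simp [h]

/-- Insertion of vectors as a linear map. -/
def insertLin {p q n : ℕ} (h : p + q = n) (x : Fin p → V) : Form V n →ₗ[ℝ] Form V q where
  toFun ω := insertFirst h ω x
  map_add' _ _ := rfl
  map_smul' _ _ := rfl

theorem insertFirst_insertFirst {p q r n m : ℕ} (h : p + q + r = n) (h' : p + m = n)
    (h'' : q + r = m) (ω : Form V n) (x : Fin p → V) (y : Fin q → V) :
    insertFirst h ω (Fin.append x y) = insertFirst h'' (insertFirst h' ω x) y := by
  subst h h''
  ext v
  rw [insertFirst_apply, insertFirst_apply, insertFirst_apply]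
  congr 1
  rw [Fin.append_assoc]
  ext a
  simp [Fin.append]

/-- On basis forms both sides insert the same vectors into the volume form, once together and once
in two stages. Hence `⋆(φ ∧ α)` needs only `⋆φ` and contractions. -/
theorem hodgeStar_wedge_coframe (e : Module.Basis (Fin 7) ℝ V) {p q r m : ℕ} (h : p + q + r = 7)
    (h' : p + m = 7) (h'' : q + r = m) (β : Form V p) (i : Fin q → Fin 7) :
    hodgeStar e h (wedge β (coframe e i)) = insertFirst h'' (hodgeStar e h' β) (e ∘ i) := by
  have : starLin e h ∘ₗ (wedgeLin V p q).flip (coframe e i) =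
      insertLin h'' (e ∘ i) ∘ₗ starLin e h' := by
    refine form_linear_ext e fun j => ?_
    change hodgeStar e h (wedge (coframe e j) (coframe e i)) =
      insertFirst h'' (hodgeStar e h' (coframe e j)) (e ∘ i)
    rw [wedge_coframe, hodgeStar_coframe, hodgeStar_coframe,
      ← insertFirst_insertFirst h h' h'']
    congr 1
    ext a
    refine Fin.addCases (fun b => ?_) (fun b => ?_) a <;> simp
  exact LinearMap.congr_fun this β

theorem sum_fun_succ {ι M : Type*} [Fintype ι] [AddCommMonoid M] {n : ℕ}
    (F : (Fin (n + 1) → ι) → M) : ∑ f, F f = ∑ a, ∑ f : Fin n → ι, F (Matrix.vecCons a f) := by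
  rw [← (Fin.consEquiv fun _ => ι).sum_comp, Fintype.sum_prod_type]
  rfl

theorem sum_fun_zero {ι M : Type*} [Fintype ι] [AddCommMonoid M]
    (F : (Fin 0 → ι) → M) : ∑ f, F f = F ![] := by
  rw [Fintype.sum_unique]
  rfl

theorem form1_eq_sum (e : Module.Basis (Fin 7) ℝ V) (α : Form V 1) :
    α = ∑ i, α ![e i] • coframe e ![i] := by
  have := form_eq_sum e α
  simp only [Nat.factorial, sum_fun_succ, sum_fun_zero] at this
  conv_lhs => rw [← one_smul ℝ α]
  convert this using 1
  · simp
  · refine Finset.sum_congr rfl fun i _ => ?_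
    congr 2
    ext a; fin_cases a; rfl

theorem form2_eq_sum (e : Module.Basis (Fin 7) ℝ V) (α : Form V 2) :
    (2 : ℝ) • α = ∑ i, ∑ j, α ![e i, e j] • coframe e ![i, j] := by
  have := form_eq_sum e α
  simp only [sum_fun_succ, sum_fun_zero, vec2_comp] at this
  exact_mod_cast this

theorem form3_eq_sum (e : Module.Basis (Fin 7) ℝ V) (α : Form V 3) :
    (6 : ℝ) • α = ∑ i, ∑ j, ∑ k, α ![e i, e j, e k] • coframe e ![i, j, k] := by
  have := form_eq_sum e α
  simp only [sum_fun_succ, sum_fun_zero, vec3_comp] at this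
  exact_mod_cast this

theorem hodgeStar_wedge (e : Module.Basis (Fin 7) ℝ V) {p q r m : ℕ} (h : p + q + r = 7)
    (h' : p + m = 7) (h'' : q + r = m) (β : Form V p) (α : Form V q) (v : Fin r → V) :
    (q.factorial : ℝ) * hodgeStar e h (wedge β α) v =
      ∑ i : Fin q → Fin 7, α (e ∘ i) *
        hodgeStar e h' β (Fin.append (e ∘ i) v ∘ Fin.cast h''.symm) := by
  have h1 := congrArg (starLin e h ∘ₗ wedgeLin V p q β) (form_eq_sum e α)
  simp only [map_sum, map_smul] at h1
  have h2 := congrArg (fun ω : Form V r => ω v) h1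
  simp only [form_sum_apply, AlternatingMap.smul_apply, smul_eq_mul] at h2
  refine h2.trans (Finset.sum_congr rfl fun i _ => ?_)
  rw [← insertFirst_apply h'', ← hodgeStar_wedge_coframe e h h' h'' β i]
  rfl

theorem star_phi_wedge_one (e : Module.Basis (Fin 7) ℝ V) (α : Form V 1) (x y z : V) :
    hodgeStar e (p := 4) (q := 3) rfl (wedge (phi e) α) ![x, y, z] =
      ∑ i, α ![e i] * psi e ![e i, x, y, z] := by
  have h := hodgeStar_wedge e (p := 3) (q := 1) (r := 3) (m := 4) rfl rfl rfl (phi e) α ![x, y, z]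
  rw [sum_fun_succ, star_phi, Nat.factorial_one, Nat.cast_one, one_mul] at h
  refine h.trans (Finset.sum_congr rfl fun i _ => ?_)
  rw [sum_fun_zero]
  congr 2 <;> ext a <;> fin_cases a <;> rfl

theorem star_phi_wedge_two (e : Module.Basis (Fin 7) ℝ V) (α : Form V 2) (x y : V) :
    2 * hodgeStar e (p := 5) (q := 2) rfl (wedge (phi e) α) ![x, y] =
      ∑ i, ∑ j, α ![e i, e j] * psi e ![e i, e j, x, y] := by
  have h := hodgeStar_wedge e (p := 3) (q := 2) (r := 2) (m := 4) rfl rfl rfl (phi e) α ![x, y]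
  rw [sum_fun_succ, star_phi, Nat.factorial_two, Nat.cast_two] at h
  refine h.trans (Finset.sum_congr rfl fun i _ => ?_)
  rw [sum_fun_succ]
  refine Finset.sum_congr rfl fun j _ => ?_
  rw [sum_fun_zero]
  congr 2 <;> ext a <;> fin_cases a <;> rfl

theorem star_phi_wedge_three (e : Module.Basis (Fin 7) ℝ V) (α : Form V 3) (x : V) :
    6 * hodgeStar e (p := 6) (q := 1) rfl (wedge (phi e) α) ![x] =
      ∑ i, ∑ j, ∑ k, α ![e i, e j, e k] * psi e ![e i, e j, e k, x] := by
  have h := hodgeStar_wedge e (p := 3) (q := 3) (r := 1) (m := 4) rfl rfl rfl (phi e) α ![x]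
  rw [sum_fun_succ, star_phi, show ((Nat.factorial 3 : ℕ) : ℝ) = 6 by norm_num [Nat.factorial]] at h
  refine h.trans (Finset.sum_congr rfl fun i _ => ?_)
  rw [sum_fun_succ]
  refine Finset.sum_congr rfl fun j _ => ?_
  rw [sum_fun_succ]
  refine Finset.sum_congr rfl fun k _ => ?_
  rw [sum_fun_zero]
  congr 2 <;> ext a <;> fin_cases a <;> rfl

theorem star_psi_wedge_three (e : Module.Basis (Fin 7) ℝ V) (α : Form V 3) :
    6 * hodgeStar e (p := 7) (q := 0) rfl (wedge (psi e) α) ![] =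
      ∑ i, ∑ j, ∑ k, α ![e i, e j, e k] * phi e ![e i, e j, e k] := by
  have h := hodgeStar_wedge e (p := 4) (q := 3) (r := 0) (m := 3) rfl rfl rfl (psi e) α ![]
  rw [sum_fun_succ, star_psi, show ((Nat.factorial 3 : ℕ) : ℝ) = 6 by norm_num [Nat.factorial]] at h
  refine h.trans (Finset.sum_congr rfl fun i _ => ?_)
  rw [sum_fun_succ]
  refine Finset.sum_congr rfl fun j _ => ?_
  rw [sum_fun_succ]
  refine Finset.sum_congr rfl fun k _ => ?_
  rw [sum_fun_zero]
  congr 2 <;> ext a <;> fin_cases a <;> rfl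

/-- On coframes the two products differ by a block permutation of the columns. Only the consequence
for vanishing is needed: `Λ³₂₇` is defined with `φ` and `⋆φ` on the right, while the contraction
formulas have them on the left. -/
theorem wedge_comm (e : Module.Basis (Fin 7) ℝ V) {p q : ℕ} (α : Form V p) (β : Form V q) :
    wedge α β = (wedge β α).domDomCongr finAddFlip := by
  let F := (AlternatingMap.domDomCongrₗ (M := V) (N := ℝ) (R := ℝ) ℝ
    (finAddFlip : Fin (q + p) ≃ Fin (p + q))).toLinearMap
  have h : ∀ i : Fin p → Fin 7, wedgeLin V p q (coframe e i) =
      F ∘ₗ (wedgeLin V q p).flip (coframe e i) := by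
    intro i
    refine form_linear_ext e fun j => ?_
    change wedge (coframe e i) (coframe e j) = (wedge (coframe e j) (coframe e i)).domDomCongr _
    rw [wedge_coframe, wedge_coframe]
    ext v
    rw [AlternatingMap.domDomCongr_apply, coframe_apply, coframe_apply,
      ← Matrix.det_submatrix_equiv_self (finAddFlip : Fin (q + p) ≃ Fin (p + q))]
    congr 1
    ext a b
    refine Fin.addCases (fun b => ?_) (fun b => ?_) b <;> simp
  have h2 : (wedgeLin V p q).flip β = F ∘ₗ wedgeLin V q p β := by
    refine form_linear_ext e fun i => ?_
    exact LinearMap.congr_fun (h i) β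
  exact LinearMap.congr_fun h2 α

theorem wedge_eq_zero_comm (e : Module.Basis (Fin 7) ℝ V) {p q : ℕ} (α : Form V p) (β : Form V q) :
    wedge α β = 0 ↔ wedge β α = 0 := by
  constructor <;> intro h <;> rw [wedge_comm e, h] <;> rfl

theorem vol_comp_ne_zero (e : Module.Basis (Fin 7) ℝ V) {f : Fin 7 → Fin 7}
    (hf : Function.Injective f) : vol e (e ∘ f) ≠ 0 := by
  obtain ⟨σ, rfl⟩ : ∃ σ : Equiv.Perm (Fin 7), f = σ :=
    ⟨Equiv.ofBijective f (Finite.injective_iff_bijective.mp hf), rfl⟩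
  rw [(vol e).map_perm e σ]
  have h3 : vol e e = 1 := by
    rw [vol, coframe_apply]
    convert Matrix.det_one (R := ℝ) (n := Fin 7) using 2
    ext a b
    simp [Matrix.one_apply, Finsupp.single_apply]
  rw [h3]
  rcases Int.units_eq_one_or (Equiv.Perm.sign σ) with h | h <;> rw [h] <;> simp [Units.smul_def]

theorem hodgeStar_eq_zero (e : Module.Basis (Fin 7) ℝ V) {p q : ℕ} (h : p + q = 7) {α : Form V p} :
    hodgeStar e h α = 0 ↔ α = 0 := by
  refine ⟨fun hα => ?_, fun hα => by rw [hα]; exact map_zero (starLin e h)⟩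
  have key : ∀ I : Fin p ↪o Fin 7, α (e ∘ I) = 0 := by
    intro I
    have hc : (Finset.univ.image I)ᶜ.card = q := by
      rw [Finset.card_compl, Finset.card_image_of_injective _ I.injective, Finset.card_univ,
        Fintype.card_fin, Fintype.card_fin]
      omega
    -- Evaluated on the complementary indices `K`, every term of `⋆α` except that of `I` has a
    -- repeated vector.
    let K := (Finset.univ.image I)ᶜ.orderEmbOfFin hc
    have hK : ∀ b a, K b ≠ I a := by
      intro b a hba
      have := Finset.orderEmbOfFin_mem _ hc b
      rw [Finset.mem_compl] at this
      exact this (Finset.mem_image.mpr ⟨a, Finset.mem_univ _, hba.symm⟩)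
    have hv : ∀ J : Fin p ↪o Fin 7, insertFirst h (vol e) (e ∘ J) (e ∘ K) =
        vol e (e ∘ (Fin.append J K ∘ Fin.cast h.symm)) := by
      intro J
      rw [insertFirst_apply]
      congr 1
      ext a
      simp only [Function.comp_apply]
      generalize Fin.cast h.symm a = a
      refine Fin.addCases (fun b => ?_) (fun b => ?_) a <;> simp
    have h1 := congrArg (fun ω : Form V q => ω (e ∘ K)) hα
    simp only [hodgeStar, form_sum_apply, AlternatingMap.smul_apply, smul_eq_mul,
      AlternatingMap.zero_apply] at h1
    rw [Finset.sum_eq_single I] at h1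
    · refine (mul_eq_zero.mp h1).resolve_right ?_
      rw [hv]
      have hi : Function.Injective (Fin.append I K ∘ Fin.cast h.symm) := by
        refine Function.Injective.comp ?_ (Fin.cast_injective _)
        rw [Fin.append_injective_iff]
        exact ⟨I.injective, K.injective, fun a b => (hK b a).symm⟩
      exact vol_comp_ne_zero e hi
    · intro J _ hJ
      have : ∃ a, ∀ b, J a ≠ I b := by
        by_contra! hc
        exact hJ (orderEmb_eq_of_forall_mem hc).symm
      obtain ⟨a, ha⟩ := this
      have hm : J a ∈ Set.range K := by
        rw [Finset.range_orderEmbOfFin]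
        simpa using fun b => (ha b).symm
      obtain ⟨b, hb⟩ := hm
      rw [hv, (vol e).map_eq_zero_of_eq _ (i := Fin.cast h (Fin.castAdd q a))
        (j := Fin.cast h (Fin.natAdd p b)), mul_zero]
      · simp [hb]
      · intro hab
        have := congrArg Fin.val hab
        simp at this
        omega
    · simp
  have h2 : (p.factorial : ℝ) • α = (p.factorial : ℝ) • 0 := by
    rw [form_eq_sum e α, smul_zero]
    refine Finset.sum_eq_zero fun j _ => ?_
    rw [← sum_coframe_smul e α j, Finset.sum_eq_zero fun I _ => by rw [key, smul_zero], zero_smul]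
  exact form_smul_cancel h2

theorem form1_eq_zero {e : Module.Basis (Fin 7) ℝ V} {α : Form V 1} (h : ∀ i, α ![e i] = 0) : α = 0 := by
  rw [form1_eq_sum e α]
  simp [h]

theorem form2_ext {e : Module.Basis (Fin 7) ℝ V} {α β : Form V 2}
    (h : ∀ i j, α ![e i, e j] = β ![e i, e j]) : α = β := by
  apply form_smul_cancel (k := 2)
  have h1 := form2_eq_sum e α
  have h2 := form2_eq_sum e β
  simp only [h] at h1
  exact_mod_cast h1.trans h2.symm

theorem form3_ext {e : Module.Basis (Fin 7) ℝ V} {α β : Form V 3}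
    (h : ∀ i j k, α ![e i, e j, e k] = β ![e i, e j, e k]) : α = β := by
  apply form_smul_cancel (k := 3)
  have h1 := form3_eq_sum e α
  have h2 := form3_eq_sum e β
  simp only [h] at h1
  exact_mod_cast h1.trans h2.symm

theorem wedge_phi_eq_zero_iff (e : Module.Basis (Fin 7) ℝ V) (α : Form V 3) :
    wedge α (phi e) = 0 ↔ ∀ l, ∑ i, ∑ j, ∑ k, α ![e i, e j, e k] * p i j k l = 0 := by
  rw [wedge_eq_zero_comm e, ← hodgeStar_eq_zero e (p := 6) (q := 1) rfl]
  have := star_phi_wedge_three e α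
  constructor
  · intro h l
    have h2 := this (e l)
    rw [h] at h2
    simpa [psi_basis, eq_comm] using h2
  · intro h
    refine form1_eq_zero (e := e) fun l => ?_
    have h2 := this (e l)
    simp only [psi_basis, h l] at h2
    simpa using h2

/-- The star of `⋆φ ∧ α` is a number, the contraction of `α` with `⋆⋆φ = φ`. -/
theorem wedge_psi_eq_zero_iff (e : Module.Basis (Fin 7) ℝ V) (α : Form V 3) :
    wedge α (psi e) = 0 ↔ ∑ i, ∑ j, ∑ k, α ![e i, e j, e k] * c i j k = 0 := by
  rw [wedge_eq_zero_comm e, ← hodgeStar_eq_zero e (p := 7) (q := 0) rfl]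
  have := star_psi_wedge_three e α
  simp only [phi_basis] at this
  rw [← this]
  constructor
  · intro h
    rw [h]
    simp
  · intro h
    ext v
    rw [Subsingleton.elim v ![]]
    simpa using h

/-! ### The infinitesimal action on `φ` and its kernel -/

/-- A two-form as a bilinear map. -/
def formBilin (α : Form V 2) : V →ₗ[ℝ] V →ₗ[ℝ] ℝ :=
  LinearMap.mk₂ ℝ (fun y z => α ![y, z])
    (fun y y' z => α.toMultilinearMap.cons_add ![z] y y')
    (fun a y z => α.toMultilinearMap.cons_smul ![z] a y)
    (fun y z z' => (α.curryLeft y).toMultilinearMap.cons_add ![] z z')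
    (fun a y z => (α.curryLeft y).toMultilinearMap.cons_smul ![] a z)

/-- A three-form as a trilinear map. -/
def formTri (α : Form V 3) : V →ₗ[ℝ] V →ₗ[ℝ] V →ₗ[ℝ] ℝ where
  toFun x := formBilin (α.curryLeft x)
  map_add' x x' := by
    ext y z
    exact α.toMultilinearMap.cons_add ![y, z] x x'
  map_smul' a x := by
    ext y z
    exact α.toMultilinearMap.cons_smul ![y, z] a x

theorem formTri_apply (α : Form V 3) (x y z : V) : formTri α x y z = α ![x, y, z] := rfl

theorem formBilin_self (α : Form V 2) (x : V) : formBilin α x x = 0 :=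
  α.map_eq_zero_of_eq _ (i := 0) (j := 1) rfl (by decide)

theorem formBilin_swap (α : Form V 2) (x y : V) : formBilin α y x = -formBilin α x y := by
  have := formBilin_self α (x + y)
  simp only [map_add, LinearMap.add_apply, formBilin_self] at this
  linarith

theorem formTri_self_left (α : Form V 3) (x y : V) : formTri α x x y = 0 :=
  α.map_eq_zero_of_eq _ (i := 0) (j := 1) rfl (by decide)

theorem formTri_self_right (α : Form V 3) (x y : V) : formTri α x y y = 0 :=
  α.map_eq_zero_of_eq _ (i := 1) (j := 2) rfl (by decide)

theorem formTri_swap_left (α : Form V 3) (x y z : V) : formTri α y x z = -formTri α x y z := by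
  have := formTri_self_left α (x + y) z
  simp only [map_add, LinearMap.add_apply, formTri_self_left] at this
  linarith

theorem formTri_swap_right (α : Form V 3) (x y z : V) : formTri α x z y = -formTri α x y z := by
  have := formTri_self_right α x (y + z)
  simp only [map_add, LinearMap.add_apply, formTri_self_right] at this
  linarith

/-- The two-form determined by an alternating bilinear map. -/
def mkForm2 (T : V →ₗ[ℝ] V →ₗ[ℝ] ℝ) (h : ∀ x, T x x = 0) : Form V 2 where
  toFun v := T (v 0) (v 1)
  map_update_add' := by
    intro _ v i x y
    fin_cases i <;> simp
  map_update_smul' := by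
    intro _ v i a x
    fin_cases i <;> simp
  map_eq_zero_of_eq' := by
    intro v i j hv hij
    fin_cases i <;> fin_cases j <;> simp_all

/-- The three-form determined by an alternating trilinear map. -/
def mkForm3 (T : V →ₗ[ℝ] V →ₗ[ℝ] V →ₗ[ℝ] ℝ) (h : ∀ x y, T x x y = 0) (h' : ∀ x y, T x y y = 0)
    (h'' : ∀ x y, T x y x = 0) : Form V 3 where
  toFun v := T (v 0) (v 1) (v 2)
  map_update_add' := by
    intro inst v i x y
    cases Subsingleton.elim inst (instDecidableEqFin 3)
    obtain rfl | rfl | rfl : i = 0 ∨ i = 1 ∨ i = 2 := by omega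
    all_goals simp
  map_update_smul' := by
    intro inst v i a x
    cases Subsingleton.elim inst (instDecidableEqFin 3)
    obtain rfl | rfl | rfl : i = 0 ∨ i = 1 ∨ i = 2 := by omega
    all_goals simp
  map_eq_zero_of_eq' := by
    intro v i j hv hij
    obtain rfl | rfl | rfl : i = 0 ∨ i = 1 ∨ i = 2 := by omega
    all_goals obtain rfl | rfl | rfl : j = 0 ∨ j = 1 ∨ j = 2 := by omega
    all_goals first | exact absurd rfl hij | simp only [hv, h, h', h'']

/-- The trilinear map `(x, y, z) ↦ T(Bx, y, z) + T(x, By, z) + T(x, y, Bz)`. -/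
def derivTri (T : V →ₗ[ℝ] V →ₗ[ℝ] V →ₗ[ℝ] ℝ) (B : V →ₗ[ℝ] V) : V →ₗ[ℝ] V →ₗ[ℝ] V →ₗ[ℝ] ℝ where
  toFun x := T (B x) + T x ∘ₗ B + LinearMap.mk₂ ℝ (fun y z => T x y (B z)) (by simp) (by simp)
    (by simp) (by simp)
  map_add' x y := by
    ext z w
    simp
    abel
  map_smul' a x := by
    ext z w
    simp

theorem derivTri_apply (T : V →ₗ[ℝ] V →ₗ[ℝ] V →ₗ[ℝ] ℝ) (B : V →ₗ[ℝ] V) (x y z : V) :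
    derivTri T B x y z = T (B x) y z + T x (B y) z + T x y (B z) := rfl

/-- The infinitesimal action (up to sign) of endomorphisms on a three-form. -/
def formDeriv (α : Form V 3) : (V →ₗ[ℝ] V) →ₗ[ℝ] Form V 3 where
  toFun B := mkForm3 (derivTri (formTri α) B)
    (fun x y => by
      rw [derivTri_apply, formTri_swap_left α x (B x), formTri_self_left]; ring)
    (fun x y => by
      rw [derivTri_apply, formTri_swap_right α x (B y) y, formTri_self_right]; ring)
    (fun x y => by
      rw [derivTri_apply, formTri_swap_right α (B x) x y, formTri_swap_left α x (B x),
        formTri_swap_right α x x (B y), formTri_self_left, formTri_swap_right α x (B x) y]; ring)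
  map_add' B B' := by
    ext v
    simp [mkForm3, derivTri_apply]
    ring
  map_smul' a B := by
    ext v
    simp [mkForm3, derivTri_apply]
    ring

theorem formDeriv_apply (α : Form V 3) (B : V →ₗ[ℝ] V) (x y z : V) :
    formDeriv α B ![x, y, z] = formTri α (B x) y z + formTri α x (B y) z + formTri α x y (B z) :=
  rfl

theorem sum_coord_mul (e : Module.Basis (Fin 7) ℝ V) (f : V →ₗ[ℝ] ℝ) (x : V) :
    f x = ∑ l, e.coord l x * f (e l) := by
  conv_lhs => rw [← e.sum_repr x]
  simp only [map_sum, map_smul, smul_eq_mul, Module.Basis.coord_apply]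

/-- The matrix of an endomorphism. -/
def mat (e : Module.Basis (Fin 7) ℝ V) (B : V →ₗ[ℝ] V) (i j : Fin 7) : ℝ := e.coord i (B (e j))

theorem formDeriv_phi_basis (e : Module.Basis (Fin 7) ℝ V) (B : V →ₗ[ℝ] V) (i j k : Fin 7) :
    formDeriv (phi e) B ![e i, e j, e k] =
      ∑ l, (mat e B l i * c l j k + mat e B l j * c i l k + mat e B l k * c i j l) := by
  rw [formDeriv_apply, sum_coord_mul e (formTri (phi e) (e i) (e j)),
    ← LinearMap.flip_apply (formTri (phi e) (e i)) (B (e j)) (e k),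
    sum_coord_mul e ((formTri (phi e) (e i)).flip (e k)),
    ← LinearMap.flip_apply (formTri (phi e)) (B (e i)) (e j),
    ← LinearMap.flip_apply ((formTri (phi e)).flip (e j)) (B (e i)) (e k),
    sum_coord_mul e ((formTri (phi e)).flip (e j) |>.flip (e k)), ← Finset.sum_add_distrib,
    ← Finset.sum_add_distrib]
  refine Finset.sum_congr rfl fun l _ => ?_
  simp only [LinearMap.flip_apply, formTri_apply, phi_basis, mat]

theorem c_swap_left : ∀ i j k, c j i k = -c i j k := by decide +kernel

theorem c_swap_right : ∀ i j k, c i k j = -c i j k := by decide +kernel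

theorem c_contract : ∀ i j, ∑ k, ∑ l, c i k l * c j k l = 6 * delta i j := by decide +kernel

/-- The usual identity for one contracted index involves `⋆φ`. Eliminating it by the same identity
with other indices leaves only `c`, arranged so that summation against `b l j` produces `contr b`.
-/
theorem c_contract_two : ∀ i l m j, ∑ k, c i l k * c m j k =
    delta i m * delta l j + delta l i * delta j m - 2 * (delta i j * delta l m)
      - ∑ n, c n l j * c n i m := by decide +kernel

theorem p_eq_sum : ∀ m i j k, 3 * p m i j k =
    ∑ l, (c m i l * c l j k + c m j l * c i l k + c m k l * c i j l) := by decide +kernel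

theorem p_eq' : ∀ i j k l, p i j k l = ∑ m, c m i j * c m k l - (delta i k * delta j l - delta i l * delta j k) := by
  decide +kernel

theorem c_contract_real (i j : Fin 7) :
    ∑ k, ∑ l, (c i k l : ℝ) * c j k l = 6 * delta i j := by
  exact_mod_cast congrArg (Int.cast : ℤ → ℝ) (c_contract i j)

theorem c_contract_two_real (i l m j : Fin 7) : ∑ k, (c i l k : ℝ) * c m j k =
    delta i m * delta l j + delta l i * delta j m - 2 * (delta i j * delta l m)
      - ∑ n, (c n l j : ℝ) * c n i m := by
  exact_mod_cast congrArg (Int.cast : ℤ → ℝ) (c_contract_two i l m j)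

theorem sum_delta_mul (i : Fin 7) (f : Fin 7 → ℝ) : ∑ j, (delta i j : ℝ) * f j = f i := by
  simp [delta]

theorem sum_delta_mul' (i : Fin 7) (f : Fin 7 → ℝ) : ∑ j, (delta j i : ℝ) * f j = f i := by
  simp [delta]

/-- The contraction of a matrix with `φ`. -/
def contr (b : Fin 7 → Fin 7 → ℝ) (n : Fin 7) : ℝ := ∑ l, ∑ j, c n l j * b l j

/-- The contraction of two arguments of a three-form with `φ`. -/
def hcontr (a : Fin 7 → Fin 7 → Fin 7 → ℝ) (i m : Fin 7) : ℝ := ∑ j, ∑ k, a i j k * c m j k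

/-- The components of `formDeriv (phi e) B` in terms of the matrix of `B`. -/
def derivComp (b : Fin 7 → Fin 7 → ℝ) (i j k : Fin 7) : ℝ :=
  ∑ l, (b l i * c l j k + b l j * c i l k + b l k * c i j l)

/-- The first of the three terms of `B·φ` contributes `6 b m i` by `c_contract`. The other two are
equal by skew symmetry and are evaluated by `c_contract_two`. -/
theorem hcontr_derivComp (b : Fin 7 → Fin 7 → ℝ) (i m : Fin 7) :
    hcontr (derivComp b) i m = 2 * (b m i + b i m) + 2 * (∑ l, b l l) * delta i m
      - 2 * ∑ n, contr b n * c n i m := by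
  have h1 : ∑ j, ∑ k, (∑ l, b l i * (c l j k : ℝ)) * c m j k = 6 * b m i := by
    trans ∑ l, b l i * ∑ j, ∑ k, (c l j k : ℝ) * c m j k
    · simp only [Finset.sum_mul, Finset.mul_sum, mul_assoc]
      rw [Finset.sum_comm_cycle]
    · simp only [c_contract_real]
      trans 6 * ∑ l, (delta l m : ℝ) * b l i
      · rw [Finset.mul_sum]
        exact Finset.sum_congr rfl fun l _ => by ring
      · rw [sum_delta_mul']
  have h2 : ∑ j, ∑ k, (∑ l, b l j * (c i l k : ℝ)) * c m j k =
      ∑ l, ∑ j, b l j * ∑ k, (c i l k : ℝ) * c m j k := by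
    simp only [Finset.sum_mul, Finset.mul_sum, mul_assoc]
    rw [Finset.sum_comm_cycle]
  have h3 : ∑ j, ∑ k, (∑ l, b l k * (c i j l : ℝ)) * c m j k =
      ∑ l, ∑ j, b l j * ∑ k, (c i l k : ℝ) * c m j k := by
    rw [← h2, Finset.sum_comm]
    refine Finset.sum_congr rfl fun j _ => Finset.sum_congr rfl fun k _ => ?_
    rw [Finset.sum_mul, Finset.sum_mul]
    refine Finset.sum_congr rfl fun l _ => ?_
    rw [c_swap_right i l k, c_swap_right m j k]
    push_cast
    ring
  have h4 : ∑ l, ∑ j, b l j * ∑ k, (c i l k : ℝ) * c m j k =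
      (∑ l, b l l) * delta i m + b i m - 2 * b m i - ∑ n, contr b n * c n i m := by
    simp only [c_contract_two_real]
    have e1 : ∑ l, ∑ j, b l j * ((delta i m : ℝ) * delta l j) = (∑ l, b l l) * delta i m := by
      rw [Finset.sum_mul]
      refine Finset.sum_congr rfl fun l _ => ?_
      trans ∑ j, (delta l j : ℝ) * (b l j * delta i m)
      · exact Finset.sum_congr rfl fun j _ => by ring
      · rw [sum_delta_mul]
    have e2 : ∑ l, ∑ j, b l j * ((delta l i : ℝ) * delta j m) = b i m := by
      trans ∑ l, (delta l i : ℝ) * ∑ j, (delta j m : ℝ) * b l j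
      · simp only [Finset.mul_sum]
        exact Finset.sum_congr rfl fun l _ => Finset.sum_congr rfl fun j _ => by ring
      · rw [sum_delta_mul', sum_delta_mul']
    have e3 : ∑ l, ∑ j, b l j * (2 * ((delta i j : ℝ) * delta l m)) = 2 * b m i := by
      trans 2 * ∑ l, (delta l m : ℝ) * ∑ j, (delta i j : ℝ) * b l j
      · simp only [Finset.mul_sum]
        exact Finset.sum_congr rfl fun l _ => Finset.sum_congr rfl fun j _ => by ring
      · rw [sum_delta_mul', sum_delta_mul]
    have e4 : ∑ l, ∑ j, b l j * (∑ n, (c n l j : ℝ) * c n i m) = ∑ n, contr b n * c n i m := by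
      simp only [contr, Finset.sum_mul, Finset.mul_sum]
      rw [Finset.sum_comm_cycle]
      exact Finset.sum_congr rfl fun n _ => Finset.sum_congr rfl fun l _ =>
        Finset.sum_congr rfl fun j _ => by ring
    simp only [mul_sub, mul_add, Finset.sum_sub_distrib, Finset.sum_add_distrib, e1, e2, e3, e4]
  have h5 : hcontr (derivComp b) i m = (∑ j, ∑ k, (∑ l, b l i * (c l j k : ℝ)) * c m j k) +
      (∑ j, ∑ k, (∑ l, b l j * (c i l k : ℝ)) * c m j k) +
      ∑ j, ∑ k, (∑ l, b l k * (c i j l : ℝ)) * c m j k := by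
    simp only [hcontr, derivComp, Finset.sum_add_distrib, add_mul]
  rw [h5, h1, h3, h2, h4]
  ring

/-- Up to a factor, `hcontr` is the adjoint of `B ↦ B·φ`: for an alternating `a` the three terms of
the derivation give equal pairings. -/
theorem sum_mul_derivComp {a : Fin 7 → Fin 7 → Fin 7 → ℝ} (h : ∀ i j k, a j i k = -a i j k)
    (h' : ∀ i j k, a i k j = -a i j k) (b : Fin 7 → Fin 7 → ℝ) :
    ∑ i, ∑ j, ∑ k, a i j k * derivComp b i j k = 3 * ∑ i, ∑ l, b l i * hcontr a i l := by
  have h1 : ∑ i, ∑ j, ∑ k, a i j k * ∑ l, b l i * (c l j k : ℝ) = ∑ i, ∑ l, b l i * hcontr a i l := by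
    refine Finset.sum_congr rfl fun i _ => ?_
    simp only [hcontr, Finset.mul_sum]
    rw [Finset.sum_comm_cycle]
    exact Finset.sum_congr rfl fun n _ => Finset.sum_congr rfl fun l _ =>
        Finset.sum_congr rfl fun j _ => by ring
  have h2 : ∑ i, ∑ j, ∑ k, a i j k * ∑ l, b l j * (c i l k : ℝ) = ∑ i, ∑ l, b l i * hcontr a i l := by
    rw [← h1, Finset.sum_comm]
    refine Finset.sum_congr rfl fun i _ => Finset.sum_congr rfl fun j _ =>
      Finset.sum_congr rfl fun k _ => ?_
    rw [h i j k, Finset.mul_sum, Finset.mul_sum]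
    refine Finset.sum_congr rfl fun l _ => ?_
    rw [c_swap_left l j k]
    push_cast
    ring
  have h3 : ∑ i, ∑ j, ∑ k, a i j k * ∑ l, b l k * (c i j l : ℝ) = ∑ i, ∑ l, b l i * hcontr a i l := by
    rw [← h2]
    refine Finset.sum_congr rfl fun i _ => ?_
    rw [Finset.sum_comm]
    refine Finset.sum_congr rfl fun j _ => Finset.sum_congr rfl fun k _ => ?_
    rw [h' i j k, Finset.mul_sum, Finset.mul_sum]
    refine Finset.sum_congr rfl fun l _ => ?_
    rw [c_swap_right i l k]
    push_cast
    ring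
  simp only [derivComp, Finset.sum_add_distrib, mul_add, h1, h2, h3]
  ring

theorem formDeriv_components (e : Module.Basis (Fin 7) ℝ V) (B : V →ₗ[ℝ] V) :
    (fun i j k => formDeriv (phi e) B ![e i, e j, e k]) = derivComp (mat e B) := by
  funext i j k
  exact formDeriv_phi_basis e B i j k

theorem hcontr_of_skew {b : Fin 7 → Fin 7 → ℝ} (h : ∀ i j, b i j + b j i = 0) (i m : Fin 7) :
    hcontr (derivComp b) i m = - 2 * ∑ n, contr b n * c n i m := by
  have h0 : ∑ l, b l l = 0 := Finset.sum_eq_zero fun l _ => by linarith [h l l]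
  rw [hcontr_derivComp, h0, h]
  ring

theorem contr_c (x : Fin 7 → ℝ) (m : Fin 7) :
    contr (fun i j => ∑ n, x n * (c n i j : ℝ)) m = 6 * x m := by
  trans ∑ n, x n * ∑ i, ∑ j, (c m i j : ℝ) * c n i j
  · simp only [contr, Finset.mul_sum]
    rw [Finset.sum_comm_cycle]
    exact Finset.sum_congr rfl fun n _ => Finset.sum_congr rfl fun l _ =>
        Finset.sum_congr rfl fun j _ => by ring
  · simp only [c_contract_real]
    trans 6 * ∑ n, (delta m n : ℝ) * x n
    · rw [Finset.mul_sum]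
      exact Finset.sum_congr rfl fun n _ => by ring
    · rw [sum_delta_mul]

/-- The part of `hcontr_derivComp` symmetric in `i, m` contains only `b + bᵀ` and the trace. Once
`b` is skew, the remaining part is `contr b` inserted into `φ`, and contracting once more recovers
`6 contr b`. -/
theorem skew_contr_of_hcontr_eq_zero {b : Fin 7 → Fin 7 → ℝ}
    (h : ∀ i m, hcontr (derivComp b) i m = 0) :
    (∀ i j, b i j + b j i = 0) ∧ ∀ n, contr b n = 0 := by
  have hs : ∀ i m, b m i + b i m = - (∑ l, b l l) * delta i m := by
    intro i m
    have h1 := h i m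
    have h2 := h m i
    rw [hcontr_derivComp] at h1 h2
    have h3 : ∑ n, contr b n * (c n m i : ℝ) = - ∑ n, contr b n * (c n i m : ℝ) := by
      rw [← Finset.sum_neg_distrib]
      refine Finset.sum_congr rfl fun n _ => ?_
      rw [c_swap_right n i m]
      push_cast
      ring
    have h4 : (delta m i : ℝ) = delta i m := by simp [delta, eq_comm]
    rw [h3, h4] at h2
    linarith
  -- The trace of `b + bᵀ = -(tr b) 1` reads `2 tr b = -7 tr b`.
  have ht : ∑ l, b l l = 0 := by
    have : ∑ l, (b l l + b l l) = ∑ l : Fin 7, - (∑ l, b l l) * delta l l :=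
      Finset.sum_congr rfl fun l _ => hs l l
    simp [delta, Finset.sum_add_distrib] at this
    linarith
  have hsk : ∀ i j, b i j + b j i = 0 := fun i j => by rw [hs, ht]; simp
  refine ⟨hsk, fun n => ?_⟩
  have h1 : ∀ i m, ∑ n, contr b n * (c n i m : ℝ) = 0 := fun i m => by
    have := h i m
    rw [hcontr_of_skew hsk] at this
    linarith
  have h2 := contr_c (contr b) n
  simp only [h1] at h2
  simp [contr] at h2 ⊢
  linarith

theorem derivComp_eq_zero_iff {b : Fin 7 → Fin 7 → ℝ}
    (ha : ∀ i j k, derivComp b j i k = - derivComp b i j k)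
    (ha' : ∀ i j k, derivComp b i k j = - derivComp b i j k) :
    (∀ i j k, derivComp b i j k = 0) ↔ (∀ i j, b i j + b j i = 0) ∧ ∀ n, contr b n = 0 := by
  constructor
  · intro h
    exact skew_contr_of_hcontr_eq_zero fun i m => by simp [hcontr, h]
  · rintro ⟨h, h'⟩
    -- By adjointness the squared norm of `B·φ` is a pairing of `b` with `hcontr (derivComp b)`,
    -- which vanishes here.
    have h1 := sum_mul_derivComp ha ha' b
    simp only [hcontr_of_skew h, h'] at h1
    simp only [zero_mul, Finset.sum_const_zero, mul_zero] at h1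
    intro i j k
    have h2 : ∀ i j k, 0 ≤ derivComp b i j k * derivComp b i j k := fun i j k => mul_self_nonneg _
    rw [Finset.sum_eq_zero_iff_of_nonneg fun i _ => Finset.sum_nonneg fun j _ =>
      Finset.sum_nonneg fun k _ => h2 i j k] at h1
    have h3 := h1 i (Finset.mem_univ _)
    rw [Finset.sum_eq_zero_iff_of_nonneg fun j _ => Finset.sum_nonneg fun k _ => h2 i j k] at h3
    have h4 := h3 j (Finset.mem_univ _)
    rw [Finset.sum_eq_zero_iff_of_nonneg fun k _ => h2 i j k] at h4
    exact mul_self_eq_zero.mp (h4 k (Finset.mem_univ _))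

theorem derivComp_swap_left (e : Module.Basis (Fin 7) ℝ V) (B : V →ₗ[ℝ] V) (i j k : Fin 7) :
    derivComp (mat e B) j i k = - derivComp (mat e B) i j k := by
  rw [← formDeriv_components]
  exact formTri_swap_left (formDeriv (phi e) B) _ _ _

theorem derivComp_swap_right (e : Module.Basis (Fin 7) ℝ V) (B : V →ₗ[ℝ] V) (i j k : Fin 7) :
    derivComp (mat e B) i k j = - derivComp (mat e B) i j k := by
  rw [← formDeriv_components]
  exact formTri_swap_right (formDeriv (phi e) B) _ _ _

theorem formDeriv_eq_zero_iff (e : Module.Basis (Fin 7) ℝ V) (B : V →ₗ[ℝ] V) :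
    formDeriv (phi e) B = 0 ↔
      (∀ i j, mat e B i j + mat e B j i = 0) ∧ ∀ n, contr (mat e B) n = 0 := by
  rw [← derivComp_eq_zero_iff (derivComp_swap_left e B) (derivComp_swap_right e B),
    ← formDeriv_components]
  constructor
  · intro h i j k
    simp [h]
  · intro h
    exact form3_ext (e := e) (by simpa using h)

/-- An endomorphism with a given matrix. -/
def ofMat (e : Module.Basis (Fin 7) ℝ V) (b : Fin 7 → Fin 7 → ℝ) : V →ₗ[ℝ] V :=
  e.constr ℝ fun j => ∑ i, b i j • e i

theorem mat_ofMat (e : Module.Basis (Fin 7) ℝ V) (b : Fin 7 → Fin 7 → ℝ) : mat e (ofMat e b) = b := by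
  funext i j
  simp [mat, ofMat, Finsupp.single_apply]

/-! ### Elements of `G₂` are isometries -/

theorem mem_G2_iff (e : Module.Basis (Fin 7) ℝ V) (A : V ≃ₗ[ℝ] V) :
    A ∈ G2 e ↔ ∀ x y z, formTri (phi e) (A x) (A y) (A z) = formTri (phi e) x y z := by
  have h0 : A ∈ G2 e ↔ formAction V 3 A (phi e) = phi e := Iff.rfl
  have h1 : ∀ x y z, formAction V 3 A (phi e) ![x, y, z] =
      formTri (phi e) (A.symm x) (A.symm y) (A.symm z) := by
    intro x y z
    change phi e _ = phi e _
    congr 1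
    ext a; fin_cases a <;> rfl
  rw [h0]
  constructor
  · intro h x y z
    have := h1 (A x) (A y) (A z)
    rw [h] at this
    simpa [formTri_apply] using this
  · intro h
    refine form3_ext (e := e) fun i j k => ?_
    rw [h1, ← h]
    simp [formTri_apply]

/-- Conjugation by an element of `G₂` preserves the annihilator of `φ`. -/
theorem formDeriv_conj {e : Module.Basis (Fin 7) ℝ V} {A : V ≃ₗ[ℝ] V} (hA : A ∈ G2 e)
    (B : V →ₗ[ℝ] V) (x y z : V) :
    formDeriv (phi e) (A.toLinearMap ∘ₗ B ∘ₗ A.symm.toLinearMap) ![x, y, z] =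
      formDeriv (phi e) B ![A.symm x, A.symm y, A.symm z] := by
  have h := (mem_G2_iff e A).mp hA
  simp only [formDeriv_apply, LinearMap.comp_apply, LinearEquiv.coe_coe]
  rw [← h (B (A.symm x)), ← h (A.symm x) (B (A.symm y)), ← h (A.symm x) (A.symm y) (B (A.symm z))]
  simp

/-- An element of the annihilator of `φ` that rotates the `(i, j)`-plane and the plane of `k` and
`ij · k`. -/
def kmat (i j k l m : Fin 7) : ℤ :=
  c (octIndex i j) i j * delta2 i j l m
    - c (octIndex i j) k (octIndex (octIndex i j) k) * delta2 k (octIndex (octIndex i j) k) l m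

/-- Each coordinate plane is rotated by some element of the annihilator of `φ`; the compensating
rotation takes place in a disjoint plane. These elements are enough to recover the metric from `φ`
up to scale. -/
theorem exists_kmat : ∀ i j, i ≠ j → ∃ k, (∀ l, kmat i j k l i = - delta j l * kmat i j k i j) ∧
    (∀ l, kmat i j k l j = delta i l * kmat i j k i j) ∧
    kmat i j k i j * kmat i j k i j = 1 ∧ (∀ l m, kmat i j k l m + kmat i j k m l = 0) ∧
    ∀ n, ∑ l, ∑ m, c n l m * kmat i j k l m = 0 := by
  decide +kernel

/-- The metric as a bilinear form. -/
def metricBilin (e : Module.Basis (Fin 7) ℝ V) : V →ₗ[ℝ] V →ₗ[ℝ] ℝ :=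
  ∑ i, (e.coord i).smulRight (e.coord i)

theorem metricBilin_apply (e : Module.Basis (Fin 7) ℝ V) (x y : V) :
    metricBilin e x y = metric e x y := by
  simp [metricBilin, metric]

theorem metricBilin_comm (e : Module.Basis (Fin 7) ℝ V) (x y : V) :
    metricBilin e x y = metricBilin e y x := by
  simp [metricBilin, mul_comm]

theorem metricBilin_basis_left (e : Module.Basis (Fin 7) ℝ V) (i : Fin 7) (x : V) :
    metricBilin e (e i) x = e.coord i x := by
  simp [metricBilin, Finsupp.single_apply]

theorem metricBilin_self_eq_zero (e : Module.Basis (Fin 7) ℝ V) {x : V}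
    (h : metricBilin e x x = 0) : x = 0 := by
  rw [metricBilin_apply, metric,
    Finset.sum_eq_zero_iff_of_nonneg fun i _ => mul_self_nonneg _] at h
  exact e.ext_elem fun i => by simpa using h i (Finset.mem_univ _)

theorem skew_of_formDeriv_eq_zero {e : Module.Basis (Fin 7) ℝ V} {B : V →ₗ[ℝ] V}
    (h : formDeriv (phi e) B = 0) (x y : V) : metricBilin e (B x) y = - metricBilin e x (B y) := by
  have h1 := ((formDeriv_eq_zero_iff e B).mp h).1
  have : metricBilin e ∘ₗ B = - (metricBilin e).compl₂ B := by
    refine e.ext fun i => e.ext fun j => ?_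
    simp only [LinearMap.comp_apply, LinearMap.neg_apply, LinearMap.compl₂_apply]
    rw [metricBilin_comm, metricBilin_basis_left, metricBilin_basis_left]
    have := h1 i j
    simp only [mat] at this
    linarith
  exact LinearMap.congr_fun (LinearMap.congr_fun this x) y

/-- The conjugate of the rotation generator `K` by `A` again annihilates `φ`, hence is skew for `g`.
So `K` is skew for the pulled-back metric, which must then be round on the plane of `e i` and `e j`.
-/
theorem metric_conformal {e : Module.Basis (Fin 7) ℝ V} {A : V ≃ₗ[ℝ] V} (hA : A ∈ G2 e) (i j : Fin 7)
    (hij : i ≠ j) : metricBilin e (A (e i)) (A (e j)) = 0 ∧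
      metricBilin e (A (e i)) (A (e i)) = metricBilin e (A (e j)) (A (e j)) := by
  obtain ⟨k, hi, hj, h1, hs, hc⟩ := exists_kmat i j hij
  generalize kmat i j k = κ at hi hj h1 hs hc
  let K := ofMat e fun l m => (κ l m : ℝ)
  have hK : formDeriv (phi e) K = 0 := by
    rw [formDeriv_eq_zero_iff, mat_ofMat]
    exact ⟨fun l m => by exact_mod_cast hs l m, fun n => by
      rw [contr]; exact_mod_cast hc n⟩
  have hKA : formDeriv (phi e) (A.toLinearMap ∘ₗ K ∘ₗ A.symm.toLinearMap) = 0 := by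
    refine form3_ext (e := e) fun i j k => ?_
    rw [formDeriv_conj hA, hK]
    rfl
  have key : ∀ x y, metricBilin e (A (K x)) (A y) = - metricBilin e (A x) (A (K y)) := by
    intro x y
    simpa using skew_of_formDeriv_eq_zero hKA (A x) (A y)
  obtain ⟨s, hs⟩ : ∃ s : ℝ, s = κ i j := ⟨_, rfl⟩
  have hs1 : s * s = 1 := by rw [hs]; exact_mod_cast h1
  have hs0 : s ≠ 0 := fun h => by simp [h] at hs1
  have hKi : K (e i) = - s • e j := by
    have hi' : ∀ l, (κ l i : ℝ) = -(if j = l then 1 else 0) * s := fun l => by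
      rw [hi, hs, delta]; push_cast; rfl
    simp only [K, ofMat, Module.Basis.constr_basis, hi']
    rw [Finset.sum_eq_single j]
    · rw [if_pos rfl, neg_one_mul]
    · intro l _ hl
      rw [if_neg hl.symm, neg_zero, zero_mul, zero_smul]
    · simp
  have hKj : K (e j) = s • e i := by
    have hj' : ∀ l, (κ l j : ℝ) = (if i = l then 1 else 0) * s := fun l => by
      rw [hj, hs, delta]; push_cast; rfl
    simp only [K, ofMat, Module.Basis.constr_basis, hj']
    rw [Finset.sum_eq_single i]
    · rw [if_pos rfl, one_mul]
    · intro l _ hl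
      rw [if_neg hl.symm, zero_mul, zero_smul]
    · simp
  -- With `K e_i = -s e_j` and `K e_j = s e_i`, the first relation gives orthogonality of the images
  -- and the second gives equality of their norms.
  have e1 := key (e i) (e i)
  have e2 := key (e i) (e j)
  rw [hKi] at e1 e2
  rw [hKj] at e2
  simp only [map_smul, LinearMap.smul_apply, smul_eq_mul] at e1 e2
  rw [metricBilin_comm e (A (e j))] at e1
  constructor
  · have : s * metricBilin e (A (e i)) (A (e j)) = 0 := by linarith
    exact (mul_eq_zero.mp this).resolve_left hs0
  · have : s * (metricBilin e (A (e i)) (A (e i)) - metricBilin e (A (e j)) (A (e j))) = 0 := by linarith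
    linarith [(mul_eq_zero.mp this).resolve_left hs0]

theorem metricBilin_basis (e : Module.Basis (Fin 7) ℝ V) (i j : Fin 7) :
    metricBilin e (e i) (e j) = delta i j := by
  rw [metricBilin_basis_left, coord_basis]

theorem exists_conformal_factor {e : Module.Basis (Fin 7) ℝ V} {A : V ≃ₗ[ℝ] V} (hA : A ∈ G2 e) :
    ∃ t : ℝ, 0 < t ∧ ∀ x y, metricBilin e (A x) (A y) = t * metricBilin e x y := by
  refine ⟨metricBilin e (A (e 0)) (A (e 0)), ?_, ?_⟩
  · have h0 : 0 ≤ metricBilin e (A (e 0)) (A (e 0)) := by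
      rw [metricBilin_apply, metric]
      exact Finset.sum_nonneg fun i _ => mul_self_nonneg _
    refine lt_of_le_of_ne h0 fun h => ?_
    have := metricBilin_self_eq_zero e h.symm
    exact e.ne_zero 0 (A.map_eq_zero_iff.mp this)
  · intro x y
    have : (metricBilin e).compl₁₂ A.toLinearMap A.toLinearMap =
        metricBilin e (A (e 0)) (A (e 0)) • metricBilin e := by
      refine e.ext fun i => e.ext fun j => ?_
      simp only [LinearMap.compl₁₂_apply, LinearMap.smul_apply, LinearEquiv.coe_coe,
        metricBilin_basis, smul_eq_mul]
      by_cases hij : i = j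
      · subst hij
        have h1 : metricBilin e (A (e i)) (A (e i)) = metricBilin e (A (e 0)) (A (e 0)) := by
          by_cases hi : i = 0
          · rw [hi]
          · exact (metric_conformal hA i 0 hi).2
        rw [h1]
        simp [delta]
      · rw [(metric_conformal hA i j hij).1]
        simp [delta, hij]
    exact LinearMap.congr_fun (LinearMap.congr_fun this x) y

theorem sum_metricBilin_smul (e : Module.Basis (Fin 7) ℝ V) (x : V) :
    ∑ i, metricBilin e x (e i) • e i = x := by
  conv_rhs => rw [← e.sum_repr x]
  refine Finset.sum_congr rfl fun i _ => ?_
  rw [metricBilin_comm, metricBilin_basis_left]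
  rfl

/-- The trace of a bilinear form does not depend on the orthonormal basis, up to scale. -/
theorem sum_apply_conformal {e : Module.Basis (Fin 7) ℝ V} {A : V ≃ₗ[ℝ] V} {t : ℝ}
    (hA : ∀ x y, metricBilin e (A x) (A y) = t * metricBilin e x y) (F : V →ₗ[ℝ] V →ₗ[ℝ] ℝ) :
    ∑ i, F (A (e i)) (A (e i)) = t * ∑ i, F (e i) (e i) := by
  -- The vectors `A e_i` are orthogonal of squared norm `t`, so expanding along them without
  -- normalization multiplies by `t`.
  have h1 : ∀ x, ∑ i, metricBilin e x (A (e i)) • A (e i) = t • x := by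
    intro x
    obtain ⟨y, rfl⟩ := A.surjective x
    simp only [hA, mul_smul]
    rw [← Finset.smul_sum]
    congr 1
    have := congrArg A (sum_metricBilin_smul e y)
    simpa only [map_sum, map_smul] using this
  have h2 : ∀ y, F (A y) (A y) = ∑ j, metricBilin e (e j) (A y) * F (e j) (A y) := by
    intro y
    have := congrArg (fun z => F z (A y)) (sum_metricBilin_smul e (A y)).symm
    simp only [map_sum, map_smul, LinearMap.sum_apply, LinearMap.smul_apply, smul_eq_mul] at this
    rw [this]
    exact Finset.sum_congr rfl fun j _ => by rw [metricBilin_comm]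
  simp only [h2]
  rw [Finset.sum_comm, Finset.mul_sum]
  refine Finset.sum_congr rfl fun j _ => ?_
  have := congrArg (F (e j)) (h1 (e j))
  simpa using this

/-- Taking the trace over each of the three arguments in turn contributes one factor `t`. -/
theorem sum_sq_conformal {e : Module.Basis (Fin 7) ℝ V} {A : V ≃ₗ[ℝ] V}
    {t : ℝ} (h : ∀ x y, metricBilin e (A x) (A y) = t * metricBilin e x y)
    (T : V →ₗ[ℝ] V →ₗ[ℝ] V →ₗ[ℝ] ℝ) :
    ∑ i, ∑ j, ∑ k, T (A (e i)) (A (e j)) (A (e k)) * T (A (e i)) (A (e j)) (A (e k)) =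
      t * (t * (t * ∑ i, ∑ j, ∑ k, T (e i) (e j) (e k) * T (e i) (e j) (e k))) := by
  have key : ∀ f : V →ₗ[ℝ] ℝ, ∑ i, f (A (e i)) * f (A (e i)) = t * ∑ i, f (e i) * f (e i) := by
    intro f
    exact sum_apply_conformal h (f.smulRight f)
  have s1 : ∀ x y, ∑ k, T x y (A (e k)) * T x y (A (e k)) = t * ∑ k, T x y (e k) * T x y (e k) :=
    fun x y => key (T x y)
  have s2 : ∀ x z, ∑ k, T x (A (e k)) z * T x (A (e k)) z = t * ∑ k, T x (e k) z * T x (e k) z :=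
    fun x z => key ((T x).flip z)
  have s3 : ∀ y z, ∑ k, T (A (e k)) y z * T (A (e k)) y z = t * ∑ k, T (e k) y z * T (e k) y z :=
    fun y z => key ((T.flip y).flip z)
  simp only [s1, ← Finset.mul_sum]
  congr 1
  trans ∑ i, ∑ k, t * ∑ j, T (A (e i)) (e j) (e k) * T (A (e i)) (e j) (e k)
  · refine Finset.sum_congr rfl fun i _ => ?_
    rw [Finset.sum_comm]
    simp only [s2]
  simp only [← Finset.mul_sum]
  congr 1
  trans ∑ k, ∑ j, t * ∑ i, T (e i) (e j) (e k) * T (e i) (e j) (e k)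
  · rw [Finset.sum_comm]
    refine Finset.sum_congr rfl fun k _ => ?_
    rw [Finset.sum_comm]
    simp only [s3]
  simp only [← Finset.mul_sum]
  congr 1
  rw [Finset.sum_comm_cycle]
  exact Finset.sum_congr rfl fun _ _ => Finset.sum_comm

theorem sum_sq_phi (e : Module.Basis (Fin 7) ℝ V) : ∑ i, ∑ j, ∑ k,
    formTri (phi e) (e i) (e j) (e k) * formTri (phi e) (e i) (e j) (e k) = 42 := by
  simp only [formTri_apply, phi_basis, c_contract_real]
  simp only [delta, if_true, Int.cast_one, Finset.sum_const, Finset.card_univ, Fintype.card_fin]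
  norm_num

/-- Since `A` preserves `φ` and `|φ|²` is not zero, `t³ = 1`. -/
theorem conformal_factor_eq_one {e : Module.Basis (Fin 7) ℝ V} {A : V ≃ₗ[ℝ] V} (hA : A ∈ G2 e)
    {t : ℝ} (ht : 0 < t) (h : ∀ x y, metricBilin e (A x) (A y) = t * metricBilin e x y) : t = 1 := by
  have h1 := sum_sq_conformal h (formTri (phi e))
  simp only [(mem_G2_iff e A).mp hA] at h1
  rw [sum_sq_phi] at h1
  have h4 : t ^ 3 = 1 := by linarith
  exact (pow_eq_one_iff_of_nonneg ht.le (by norm_num)).mp h4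

/-- Elements of `G₂` are isometries. -/
theorem metric_invariant {e : Module.Basis (Fin 7) ℝ V} {A : V ≃ₗ[ℝ] V} (hA : A ∈ G2 e) (x y : V) :
    metricBilin e (A x) (A y) = metricBilin e x y := by
  obtain ⟨t, ht, h⟩ := exists_conformal_factor hA
  rw [h, conformal_factor_eq_one hA ht h, one_mul]

/-! ### The Lie algebra of `G₂` -/

theorem formTri_nondegenerate (e : Module.Basis (Fin 7) ℝ V) {x : V}
    (h : ∀ y z, formTri (phi e) x y z = 0) : x = 0 := by
  refine e.ext_elem fun m => ?_
  have h1 := contr_c (fun n => e.coord n x) m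
  have h2 : ∀ i j, ∑ n, e.coord n x * (c n i j : ℝ) = 0 := by
    intro i j
    have := sum_coord_mul e ((formTri (phi e)).flip (e i) |>.flip (e j)) x
    simp only [LinearMap.flip_apply, h, formTri_apply, phi_basis] at this
    exact this.symm
  simp only [h2] at h1
  simp [contr] at h1 ⊢
  linarith

/-- An endomorphism that preserves `φ` is invertible and defines an element of `G₂`. -/
theorem exists_mem_G2 (e : Module.Basis (Fin 7) ℝ V) (B : V →ₗ[ℝ] V)
    (h : ∀ i j k, formTri (phi e) (B (e i)) (B (e j)) (B (e k)) = c i j k) :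
    ∃ A ∈ G2 e, (A : V →ₗ[ℝ] V) = B := by
  have h1 : ∀ x y z, formTri (phi e) (B x) (B y) (B z) = formTri (phi e) x y z := by
    have : (((formTri (phi e) ∘ₗ B).compl₂ B).compr₂ (LinearMap.lcomp ℝ ℝ B)) = formTri (phi e) := by
      refine e.ext fun i => e.ext fun j => e.ext fun k => ?_
      rw [formTri_apply _ (e i), phi_basis, ← h]
      rfl
    intro x y z
    conv_rhs => rw [← this]
    rfl
  have hinj : Function.Injective B := by
    rw [← LinearMap.ker_eq_bot, LinearMap.ker_eq_bot']
    intro x hx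
    refine formTri_nondegenerate e fun y z => ?_
    rw [← h1, hx]
    simp
  have := Module.Finite.of_basis e
  refine ⟨LinearEquiv.ofInjectiveEndo B hinj, ?_, ?_⟩
  · rw [mem_G2_iff]
    exact h1
  · ext x
    rfl

/-- `V` carries no topology, so derivatives along the one-parameter group are taken in coordinates
through this expansion. -/
theorem formTri_eq_sum (e : Module.Basis (Fin 7) ℝ V) (α : Form V 3) (x y z : V) :
    formTri α x y z = ∑ i, ∑ j, ∑ k, e.coord i x * (e.coord j y * (e.coord k z *
      formTri α (e i) (e j) (e k))) := by
  have h1 : ∀ x y z, formTri α x y z = ∑ i, e.coord i x * formTri α (e i) y z := fun x y z =>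
    sum_coord_mul e ((formTri α).flip y |>.flip z) x
  have h2 : ∀ x y z, formTri α x y z = ∑ i, e.coord i y * formTri α x (e i) z := fun x y z =>
    sum_coord_mul e ((formTri α x).flip z) y
  have h3 : ∀ x y z, formTri α x y z = ∑ i, e.coord i z * formTri α x y (e i) := fun x y z =>
    sum_coord_mul e (formTri α x y) z
  simp only [← Finset.mul_sum]
  simp only [← h3, ← h2, ← h1]

theorem hasDerivAt_formTri (e : Module.Basis (Fin 7) ℝ V) (α : Form V 3) {u v w : ℝ → V}
    {u' v' w' : V} {t : ℝ} (hu : ∀ i, HasDerivAt (fun t => e.coord i (u t)) (e.coord i u') t)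
    (hv : ∀ i, HasDerivAt (fun t => e.coord i (v t)) (e.coord i v') t)
    (hw : ∀ i, HasDerivAt (fun t => e.coord i (w t)) (e.coord i w') t) :
    HasDerivAt (fun t => formTri α (u t) (v t) (w t))
      (formTri α u' (v t) (w t) + formTri α (u t) v' (w t) + formTri α (u t) (v t) w') t := by
  simp only [formTri_eq_sum e α (u _), formTri_eq_sum e α u', ← Finset.sum_add_distrib]
  refine HasDerivAt.fun_sum fun i _ => HasDerivAt.fun_sum fun j _ => HasDerivAt.fun_sum fun k _ => ?_
  refine ((hu i).mul ((hv j).mul ((hw k).mul_const (formTri α (e i) (e j) (e k))))).congr_deriv ?_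
  simp only [Pi.mul_apply]
  ring

/-- The one-parameter group generated by an endomorphism. -/
def expEnd (e : Module.Basis (Fin 7) ℝ V) (X : V →ₗ[ℝ] V) (t : ℝ) : V →ₗ[ℝ] V :=
  Matrix.toLin e e (NormedSpace.exp (t • LinearMap.toMatrix e e X))

theorem toMatrix_expEnd (e : Module.Basis (Fin 7) ℝ V) (X : V →ₗ[ℝ] V) (t : ℝ) :
    LinearMap.toMatrix e e (expEnd e X t) = NormedSpace.exp (t • LinearMap.toMatrix e e X) := by
  simp [expEnd]

theorem expEnd_zero (e : Module.Basis (Fin 7) ℝ V) (X : V →ₗ[ℝ] V) : expEnd e X 0 = LinearMap.id := by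
  simp [expEnd, NormedSpace.exp_zero]

open scoped Matrix.Norms.Operator in
theorem hasDerivAt_exp_entry (M : Matrix (Fin 7) (Fin 7) ℝ) (t : ℝ) (i j : Fin 7) :
    HasDerivAt (fun t : ℝ => NormedSpace.exp (t • M) i j) ((M * NormedSpace.exp (t • M)) i j) t := by
  have h := hasDerivAt_exp_smul_const' (𝕂 := ℝ) M t
  exact hasDerivAt_pi.mp (hasDerivAt_pi.mp h i) j

theorem hasDerivAt_expEnd (e : Module.Basis (Fin 7) ℝ V) (X : V →ₗ[ℝ] V) (t : ℝ) (j i : Fin 7) :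
    HasDerivAt (fun t => e.coord i (expEnd e X t (e j))) (e.coord i (X (expEnd e X t (e j)))) t := by
  have h := hasDerivAt_exp_entry (LinearMap.toMatrix e e X) t i j
  rw [← toMatrix_expEnd, ← LinearMap.toMatrix_comp] at h
  simp only [← toMatrix_expEnd, LinearMap.toMatrix_apply] at h
  exact h

/-- The derivative of `t ↦ φ(exp(tX)·, exp(tX)·, exp(tX)·)` is `X·φ` evaluated on the moved vectors.
If the function is constant, its derivative at `0` gives `X·φ = 0`; if `X·φ = 0`, it vanishes at all
times. -/
theorem lieG2_eq (e : Module.Basis (Fin 7) ℝ V) : lieG2 e = {X | formDeriv (phi e) X = 0} := by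
  ext X
  have hd : ∀ t i j k, HasDerivAt (fun t => formTri (phi e) (expEnd e X t (e i))
      (expEnd e X t (e j)) (expEnd e X t (e k))) (formDeriv (phi e) X
      ![expEnd e X t (e i), expEnd e X t (e j), expEnd e X t (e k)]) t := by
    intro t i j k
    exact hasDerivAt_formTri e (phi e) (hasDerivAt_expEnd e X t i) (hasDerivAt_expEnd e X t j)
      (hasDerivAt_expEnd e X t k)
  constructor
  · intro hX
    refine form3_ext (e := e) fun i j k => ?_
    have h1 := hd 0 i j k
    have h2 : (fun t => formTri (phi e) (expEnd e X t (e i))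
        (expEnd e X t (e j)) (expEnd e X t (e k))) = fun _ => formTri (phi e) (e i) (e j) (e k) := by
      funext t
      obtain ⟨A, hA, hAX⟩ := hX t
      have h3 : (A : V →ₗ[ℝ] V) = expEnd e X t := by
        apply (LinearMap.toMatrix e e).injective
        rw [hAX, toMatrix_expEnd]
      rw [← h3]
      exact (mem_G2_iff e A).mp hA _ _ _
    rw [h2, expEnd_zero] at h1
    exact h1.unique (hasDerivAt_const _ _)
  · intro hX t
    simp only [Set.mem_ofPred_eq] at hX
    obtain ⟨A, hA, hAX⟩ := exists_mem_G2 e (expEnd e X t) (by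
      intro i j k
      have h1 := is_const_of_deriv_eq_zero (fun t => (hd t i j k).differentiableAt) (fun t => by
        rw [(hd t i j k).deriv, hX]; rfl) t 0
      rw [h1, expEnd_zero]
      exact phi_basis e i j k)
    exact ⟨A, hA, by rw [hAX, toMatrix_expEnd]⟩

/-! ### Equivariant maps and irreducibility -/

section Rep
variable {G W W' : Type*} [Group G] [AddCommMonoid W] [Module ℝ W] [AddCommMonoid W'] [Module ℝ W']

/-- The range of an equivariant linear map. -/
def rangeRep {ρ : Representation ℝ G W} {ρ' : Representation ℝ G W'} (f : W →ₗ[ℝ] W')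
    (h : ∀ g x, f (ρ g x) = ρ' g (f x)) : Subrepresentation ρ' where
  toSubmodule := LinearMap.range f
  apply_mem_toSubmodule g := by
    rintro _ ⟨x, rfl⟩
    exact ⟨ρ g x, h g x⟩

/-- An injective equivariant map is an equivalence onto its range. -/
def rangeEquiv {ρ : Representation ℝ G W} {ρ' : Representation ℝ G W'} (f : W →ₗ[ℝ] W')
    (h : ∀ g x, f (ρ g x) = ρ' g (f x)) (hf : Function.Injective f) :
    (rangeRep f h).toRepresentation.Equiv ρ :=
  (Representation.Equiv.mk (ρ := ρ) (σ := (rangeRep f h).toRepresentation)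
    (LinearEquiv.ofInjective f hf) (fun g => by
      ext x
      exact h g x)).symm

end Rep

section Irreducible
variable {G W W' : Type*} [Group G] [AddCommGroup W] [Module ℝ W] [AddCommGroup W'] [Module ℝ W']

/-- A representation on a nonzero module in which every nonzero invariant subspace is everything. -/
theorem isIrreducible_of_forall {ρ : Representation ℝ G W} [Nontrivial W]
    (h : ∀ U : Subrepresentation ρ, ∀ x ∈ U, x ≠ 0 → U = ⊤) : ρ.IsIrreducible := by
  have : Nontrivial (Subrepresentation ρ) := by
    obtain ⟨x, hx⟩ := exists_ne (0 : W)
    refine ⟨⊥, ⊤, fun hb => hx ?_⟩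
    have : x ∈ (⊤ : Subrepresentation ρ) := Submodule.mem_top (R := ℝ)
    rw [← hb] at this
    exact (Submodule.mem_bot ℝ).mp this
  refine ⟨fun U => ?_⟩
  by_cases hU : ∃ x ∈ U, x ≠ 0
  · obtain ⟨x, hx, hx0⟩ := hU
    exact Or.inr (h U x hx hx0)
  · push Not at hU
    left
    apply Subrepresentation.toSubmodule_injective
    exact (Submodule.eq_bot_iff _).mpr hU

theorem isIrreducible_of_equiv {ρ : Representation ℝ G W} {ρ' : Representation ℝ G W'}
    (f : ρ.Equiv ρ') (h : ρ.IsIrreducible) : ρ'.IsIrreducible := by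
  have hn : Nontrivial W := by
    by_contra hc
    rw [not_nontrivial_iff_subsingleton] at hc
    obtain ⟨U, U', hU⟩ := h.toNontrivial
    exact hU (Subrepresentation.toSubmodule_injective (Subsingleton.elim _ _))
  have : Nontrivial W' := f.toLinearEquiv.toEquiv.nontrivial_congr.mp hn
  refine isIrreducible_of_forall fun U x hx hx0 => ?_
  let U' : Subrepresentation ρ :=
    { toSubmodule := U.toSubmodule.comap f.toLinearEquiv.toLinearMap
      apply_mem_toSubmodule := fun g v hv => by
        have := U.apply_mem_toSubmodule g hv
        rw [Submodule.mem_comap]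
        convert this using 1
        exact LinearMap.congr_fun (f.isIntertwining' g) v }
  have hU' : U' ≠ ⊥ := by
    intro hb
    have hm : f.toLinearEquiv.symm x ∈ U' := by
      change f.toLinearEquiv (f.toLinearEquiv.symm x) ∈ U
      rwa [LinearEquiv.apply_symm_apply]
    rw [hb] at hm
    have h0 : f.toLinearEquiv.symm x = 0 := (Submodule.mem_bot ℝ).mp hm
    exact hx0 (f.toLinearEquiv.symm.map_eq_zero_iff.mp h0)
  have ht := (h.eq_bot_or_eq_top U').resolve_left hU'
  apply Subrepresentation.toSubmodule_injective
  refine (Submodule.eq_top_iff'.mpr fun y => ?_)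
  have hm : f.toLinearEquiv.symm y ∈ U' := by
    rw [ht]; exact Submodule.mem_top (R := ℝ)
  have : f.toLinearEquiv (f.toLinearEquiv.symm y) ∈ U := hm
  rwa [LinearEquiv.apply_symm_apply] at this

end Irreducible

/-! ### Explicit elements of `G₂` and an irreducibility criterion -/

/-- `σ` and `s` define a signed permutation that preserves `φ`. -/
def IsAut (σ : Fin 7 → Fin 7) (s : Fin 7 → ℤ) : Prop :=
  ∀ i j k, s i * s j * s k * c (σ i) (σ j) (σ k) = c i j k

instance (σ : Fin 7 → Fin 7) (s : Fin 7 → ℤ) : Decidable (IsAut σ s) := by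
  unfold IsAut; infer_instance

theorem IsAut.exists_mem {σ : Fin 7 → Fin 7} {s : Fin 7 → ℤ} (h : IsAut σ s)
    (e : Module.Basis (Fin 7) ℝ V) : ∃ A : G2 e, ∀ i, A.1 (e i) = (s i : ℝ) • e (σ i) := by
  obtain ⟨A, hA, hAB⟩ := exists_mem_G2 e (e.constr ℝ fun i => (s i : ℝ) • e (σ i)) (by
    intro i j k
    simp only [Module.Basis.constr_basis, map_smul, LinearMap.smul_apply, smul_eq_mul,
      formTri_apply, phi_basis]
    rw [← h i j k]
    push_cast
    ring)
  refine ⟨⟨A, hA⟩, fun i => ?_⟩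
  have := LinearMap.congr_fun hAB (e i)
  rw [Module.Basis.constr_basis] at this
  exact this

/-- A simultaneous rotation of the planes of `e 0, e 1` and of `e 3, e 6`. The 3-4-5 angle keeps the
verification rational. -/
theorem exists_rotation (e : Module.Basis (Fin 7) ℝ V) :
    ∃ A : G2 e, A.1 (e 0) = (3 / 5 : ℝ) • e 0 + (4 / 5 : ℝ) • e 1 := by
  let τ : Fin 7 → Fin 7 := ![1, 0, 2, 6, 4, 5, 3]
  let x : Fin 7 → ℤ := ![3, 3, 5, 3, 5, 5, 3]
  let y : Fin 7 → ℤ := ![4, -4, 0, 4, 0, 0, -4]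
  -- The factor `125 = 5³` clears the denominators of the three arguments.
  have h : ∀ i j k, x i * x j * x k * c i j k + x i * x j * y k * c i j (τ k) +
      x i * y j * x k * c i (τ j) k + x i * y j * y k * c i (τ j) (τ k) +
      y i * x j * x k * c (τ i) j k + y i * x j * y k * c (τ i) j (τ k) +
      y i * y j * x k * c (τ i) (τ j) k + y i * y j * y k * c (τ i) (τ j) (τ k) =
        125 * c i j k := by decide +kernel
  obtain ⟨A, hA, hAB⟩ := exists_mem_G2 e
    (e.constr ℝ fun i => (x i / 5 : ℝ) • e i + (y i / 5 : ℝ) • e (τ i)) (by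
    intro i j k
    simp only [Module.Basis.constr_basis, map_smul, map_add, LinearMap.add_apply,
      LinearMap.smul_apply, smul_eq_mul, formTri_apply, phi_basis]
    have := congrArg (Int.cast : ℤ → ℝ) (h i j k)
    push_cast at this
    linarith)
  refine ⟨⟨A, hA⟩, ?_⟩
  have := LinearMap.congr_fun hAB (e 0)
  rw [Module.Basis.constr_basis] at this
  refine Eq.trans this ?_
  simp [x, y, τ]

/-- If `U` were a proper nonzero invariant subspace of `L`, its orthogonal complement in `L` would
be nonzero and invariant too. Both would contain `w`, making `w` orthogonal to itself. -/
theorem irreducible_of_common_vector {G W : Type*} [Group G] [AddCommGroup W] [Module ℝ W]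
    [FiniteDimensional ℝ W] {ρ : Representation ℝ G W} (L : Subrepresentation ρ)
    (Q : LinearMap.BilinForm ℝ W) (hsymm : ∀ x y, Q x y = Q y x) (hpos : ∀ x, Q x x = 0 → x = 0)
    (hinv : ∀ g x y, Q (ρ g x) (ρ g y) = Q x y) (w : W) (hw : w ≠ 0) (hwL : w ∈ L)
    (h : ∀ U : Subrepresentation ρ, U.toSubmodule ≤ L.toSubmodule → ∀ x ∈ U, x ≠ 0 → w ∈ U) :
    Representation.IsIrreducible L.toRepresentation := by
  have : Nontrivial L.toSubmodule := ⟨⟨w, hwL⟩, 0, fun hc => hw (congrArg Subtype.val hc)⟩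
  refine isIrreducible_of_forall fun U x hx hx0 => ?_
  let U' : Subrepresentation ρ :=
    { toSubmodule := U.toSubmodule.map L.toSubmodule.subtype
      apply_mem_toSubmodule := by
        rintro g _ ⟨y, hy, rfl⟩
        exact ⟨_, U.apply_mem_toSubmodule g hy, rfl⟩ }
  have hU'L : U'.toSubmodule ≤ L.toSubmodule := Submodule.map_subtype_le _ _
  let P : Subrepresentation ρ :=
    { toSubmodule := Q.orthogonal U'.toSubmodule ⊓ L.toSubmodule
      apply_mem_toSubmodule := by
        rintro g y ⟨hy, hyL⟩
        refine ⟨fun z hz => ?_, L.apply_mem_toSubmodule g hyL⟩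
        have h1 := hy (ρ g⁻¹ z) (U'.apply_mem_toSubmodule g⁻¹ hz)
        have h2 := hinv g (ρ g⁻¹ z) y
        rw [← Module.End.mul_apply, ← map_mul, mul_inv_cancel, map_one, Module.End.one_apply] at h2
        change Q z (ρ g y) = 0
        rw [h2]
        exact h1 }
  have hwU : w ∈ U' := h U' hU'L x ⟨x, hx, rfl⟩ fun hc => hx0 (Subtype.ext hc)
  have hP : ∀ y ∈ P, y = 0 := by
    intro y hy
    by_contra hy0
    have hwP : w ∈ P := h P inf_le_right y hy hy0
    exact hw (hpos w (hwP.1 w hwU))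
  have hc : IsCompl U'.toSubmodule (Q.orthogonal U'.toSubmodule) := by
    apply LinearMap.BilinForm.isCompl_orthogonal_of_restrict_nondegenerate
    · intro x y hxy
      rw [hsymm, hxy]
    · exact ⟨fun x hx => Subtype.ext (hpos _ (hx x)), fun x hx => Subtype.ext (hpos _ (hx x))⟩
  apply Subrepresentation.toSubmodule_injective
  refine Submodule.eq_top_iff'.mpr fun y => ?_
  obtain ⟨u, hu, v, hv, huv⟩ := Submodule.mem_sup.mp
    ((hc.sup_eq_top ▸ Submodule.mem_top : (y : W) ∈ U'.toSubmodule ⊔ Q.orthogonal U'.toSubmodule))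
  have hvL : v ∈ L.toSubmodule := by
    have : v = y - u := by rw [← huv]; abel
    rw [this]
    exact sub_mem y.2 (hU'L hu)
  have hv0 : v = 0 := hP v ⟨hv, hvL⟩
  rw [hv0, add_zero] at huv
  obtain ⟨z, hz, hzu⟩ := hu
  have : z = y := Subtype.ext (hzu.trans huv)
  exact this ▸ hz

theorem sum_apply_G2 {e : Module.Basis (Fin 7) ℝ V} (A : G2 e) (F : V →ₗ[ℝ] V →ₗ[ℝ] ℝ) :
    ∑ i, F (A.1 (e i)) (A.1 (e i)) = ∑ i, F (e i) (e i) := by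
  have := sum_apply_conformal (t := 1) (A := A.1) (by simpa using metric_invariant A.2) F
  rwa [one_mul] at this

theorem sum_sum_apply_G2 {e : Module.Basis (Fin 7) ℝ V} (A : G2 e) (F F' : V →ₗ[ℝ] V →ₗ[ℝ] ℝ) :
    ∑ i, ∑ j, F (A.1 (e i)) (A.1 (e j)) * F' (A.1 (e i)) (A.1 (e j)) =
      ∑ i, ∑ j, F (e i) (e j) * F' (e i) (e j) := by
  have h1 : ∀ x, ∑ j, F x (A.1 (e j)) * F' x (A.1 (e j)) = ∑ j, F x (e j) * F' x (e j) :=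
    fun x => sum_apply_G2 A ((LinearMap.mul ℝ ℝ).compl₁₂ (F x) (F' x))
  have h2 : ∀ y, ∑ j, F (A.1 (e j)) y * F' (A.1 (e j)) y = ∑ j, F (e j) y * F' (e j) y :=
    fun y => sum_apply_G2 A ((LinearMap.mul ℝ ℝ).compl₁₂ (F.flip y) (F'.flip y))
  simp only [h1]
  rw [Finset.sum_comm]
  simp only [h2]
  exact Finset.sum_comm

/-- The action of `A⁻¹` is pullback along `A`. Writing a general group element as `A⁻¹` removes all
inverses from the equivariance arguments. -/
theorem dual_apply_inv {e : Module.Basis (Fin 7) ℝ V} (A : G2 e) (f : Module.Dual ℝ V) (x : V) :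
    (stdRep e).dual A⁻¹ f x = f (A.1 x) := by
  simp [stdRep]
  rfl

theorem formRep_two_apply_inv {e : Module.Basis (Fin 7) ℝ V} (A : G2 e) (α : Form V 2) (x y : V) :
    formRep e 2 A⁻¹ α ![x, y] = α ![A.1 x, A.1 y] := by
  change α _ = α _
  congr 1
  ext a; fin_cases a <;> rfl

theorem formRep_three_apply_inv {e : Module.Basis (Fin 7) ℝ V} (A : G2 e) (α : Form V 3)
    (x y z : V) : formRep e 3 A⁻¹ α ![x, y, z] = α ![A.1 x, A.1 y, A.1 z] := by
  change α _ = α _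
  congr 1
  ext a; fin_cases a <;> rfl

theorem bilinRep_apply_inv {e : Module.Basis (Fin 7) ℝ V} (A : G2 e) (b : V →ₗ[ℝ] Module.Dual ℝ V)
    (x y : V) : bilinRep e A⁻¹ b x y = b (A.1 x) (A.1 y) := by
  simp [bilinRep, stdRep]
  rfl

/-- The permutations generated by a cyclic permutation of the units and a rotation of the three
lines through the first unit. -/
def cyc (n : Fin 7) (m : Fin 3) : Fin 7 → Fin 7 :=
  (![1, 3, 5, 2, 0, 6, 4] : Fin 7 → Fin 7)^[n] ∘ (![0, 3, 4, 5, 6, 1, 2] : Fin 7 → Fin 7)^[m]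

theorem isAut_cyc : ∀ n m, IsAut (cyc n m) fun _ => 1 := by
  decide +kernel

theorem cyc_transitive : ∀ i, ∃ n, ∃ m, cyc n m 0 = i := by decide +kernel

/-- The 21 permutations `cyc n m` hit each of the 21 unordered pairs once, so the order within a
pair cannot be prescribed. -/
theorem cyc_transitive_pair : ∀ i j, i ≠ j → ∃ n, ∃ m,
    (cyc n m 1 = i ∧ cyc n m 2 = j) ∨ (cyc n m 1 = j ∧ cyc n m 2 = i) := by decide +kernel

theorem exists_cyc (e : Module.Basis (Fin 7) ℝ V) (n : Fin 7) (m : Fin 3) :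
    ∃ A : G2 e, ∀ i, A.1 (e i) = e (cyc n m i) := by
  obtain ⟨A, hA⟩ := (isAut_cyc n m).exists_mem e
  exact ⟨A, fun i => by rw [hA]; simp⟩

/-- The restriction of `(1 + s₁)(1 + s₂)` for two sign changes in `G₂` to a weight. -/
def signSum (i j : Fin 7) : ℤ :=
  (1 + ![1, 1, 1, -1, -1, -1, -1] i * ![1, 1, 1, -1, -1, -1, -1] j) *
    (1 + ![1, -1, -1, 1, 1, -1, -1] i * ![1, -1, -1, 1, 1, -1, -1] j)

theorem isAut_sign_one : IsAut id ![1, 1, 1, -1, -1, -1, -1] := by decide +kernel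

theorem isAut_sign_two : IsAut id ![1, -1, -1, 1, 1, -1, -1] := by decide +kernel

theorem isAut_sign_three : IsAut id ![-1, 1, -1, 1, -1, 1, -1] := by decide +kernel

theorem isAut_swap : IsAut ![0, 3, 4, 1, 2, 5, 6] ![1, 1, 1, 1, 1, -1, -1] := by decide +kernel

theorem isAut_swap_one : IsAut ![0, 2, 1, 4, 3, 5, 6] ![1, 1, -1, 1, -1, -1, -1] := by decide +kernel

theorem isAut_swap_two : IsAut ![0, 1, 2, 4, 3, 6, 5] ![1, 1, 1, 1, -1, -1, 1] := by decide +kernel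

/-! ### Irreducibility of the dual, of `𝔤₂` and of `S₀²V*` -/

/-- The invariant scalar product on the dual space. -/
def dualInner (e : Module.Basis (Fin 7) ℝ V) : LinearMap.BilinForm ℝ (Module.Dual ℝ V) :=
  ∑ i, (LinearMap.mul ℝ ℝ).compl₁₂ (Module.Dual.eval ℝ V (e i)) (Module.Dual.eval ℝ V (e i))

theorem dualInner_apply (e : Module.Basis (Fin 7) ℝ V) (f f' : Module.Dual ℝ V) :
    dualInner e f f' = ∑ i, f (e i) * f' (e i) := by
  simp [dualInner]

/-- The invariant scalar product on bilinear forms. -/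
def bilinInner (e : Module.Basis (Fin 7) ℝ V) :
    LinearMap.BilinForm ℝ (V →ₗ[ℝ] Module.Dual ℝ V) :=
  ∑ i, (dualInner e).compl₁₂ (LinearMap.applyₗ (e i)) (LinearMap.applyₗ (e i))

theorem bilinInner_apply (e : Module.Basis (Fin 7) ℝ V) (b b' : V →ₗ[ℝ] Module.Dual ℝ V) :
    bilinInner e b b' = ∑ i, ∑ j, b (e i) (e j) * b' (e i) (e j) := by
  simp [bilinInner, dualInner_apply]

theorem sum_sum_sq_eq_zero {b : Fin 7 → Fin 7 → ℝ} (h : ∑ i, ∑ j, b i j * b i j = 0) (i j : Fin 7) :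
    b i j = 0 := by
  rw [Finset.sum_eq_zero_iff_of_nonneg fun i _ => Finset.sum_nonneg fun j _ =>
    mul_self_nonneg _] at h
  have h2 := h i (Finset.mem_univ _)
  rw [Finset.sum_eq_zero_iff_of_nonneg fun j _ => mul_self_nonneg _] at h2
  exact mul_self_eq_zero.mp (h2 j (Finset.mem_univ _))

/-- Two-forms as bilinear forms, linearly. -/
def formBilinLin (V : Type*) [AddCommGroup V] [Module ℝ V] :
    Form V 2 →ₗ[ℝ] V →ₗ[ℝ] Module.Dual ℝ V where
  toFun := formBilin
  map_add' _ _ := rfl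
  map_smul' _ _ := rfl

/-- The invariant scalar product on two-forms. -/
def formInner (e : Module.Basis (Fin 7) ℝ V) : LinearMap.BilinForm ℝ (Form V 2) :=
  (bilinInner e).compl₁₂ (formBilinLin V) (formBilinLin V)

theorem formInner_apply (e : Module.Basis (Fin 7) ℝ V) (α β : Form V 2) :
    formInner e α β = ∑ i, ∑ j, α ![e i, e j] * β ![e i, e j] :=
  bilinInner_apply e _ _

theorem signSum_ne_zero : ∀ i, signSum 0 i = if i = 0 then 4 else 0 := by decide

theorem isIrreducible_dual (e : Module.Basis (Fin 7) ℝ V) : (stdRep e).dual.IsIrreducible := by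
  have := Module.Finite.of_basis e
  have hn : Nontrivial (Module.Dual ℝ V) :=
    ⟨e.coord 0, 0, fun h => by simpa using LinearMap.congr_fun h (e 0)⟩
  have hmem : ∀ (U : Subrepresentation (stdRep e).dual) (A : G2 e), ∀ f ∈ U.toSubmodule,
      f ∘ₗ A.1.toLinearMap ∈ U.toSubmodule := by
    intro U A f hf
    have := U.apply_mem_toSubmodule A⁻¹ hf
    convert this using 1
    ext x
    exact (dual_apply_inv A f x).symm
  have key : ∀ U : Subrepresentation (stdRep e).dual, ∀ f ∈ U.toSubmodule, f ≠ 0 →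
      e.coord 0 ∈ U.toSubmodule := by
    intro U f hf hf0
    obtain ⟨i, hi⟩ : ∃ i, f (e i) ≠ 0 := by
      by_contra! h
      exact hf0 (e.ext fun i => by simpa using h i)
    obtain ⟨n, m, hnm⟩ := cyc_transitive i
    obtain ⟨A, hA⟩ := exists_cyc e n m
    obtain ⟨S, hS⟩ := isAut_sign_one.exists_mem e
    obtain ⟨T, hT⟩ := isAut_sign_two.exists_mem e
    -- After a nonzero component has been moved to position `0`, the sum over two commuting sign
    -- changes is `4 f(e i)` times the first coordinate, all others cancelling.
    have h1 := hmem U A f hf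
    have h2 := add_mem h1 (hmem U S _ h1)
    have h3 := U.toSubmodule.smul_mem (4 * f (e i))⁻¹ (add_mem h2 (hmem U T _ h2))
    convert h3 using 1
    refine e.ext fun j => ?_
    simp only [LinearMap.smul_apply, LinearMap.add_apply, LinearMap.comp_apply,
      LinearEquiv.coe_coe, hS, hT, map_smul, id, smul_eq_mul, hA]
    have h4 := congrArg (Int.cast : ℤ → ℝ) (signSum_ne_zero j)
    simp only [signSum, Matrix.cons_val_zero] at h4
    by_cases hj : j = 0
    · subst hj
      rw [hnm]
      simp
      field_simp
      norm_num
    · rw [if_neg hj] at h4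
      push_cast at h4
      trans (4 * f (e i))⁻¹ * (f (e (cyc n m j)) * 0)
      · simp [hj]
      · rw [← h4]
        ring
  refine isIrreducible_of_equiv (ρ := (⊤ : Subrepresentation (stdRep e).dual).toRepresentation)
    (Representation.Equiv.mk Submodule.topEquiv fun g => rfl) ?_
  refine irreducible_of_common_vector ⊤ (dualInner e) ?_ ?_ ?_ (e.coord 0) ?_ Submodule.mem_top ?_
  · intro x y
    simp [dualInner_apply, mul_comm]
  · intro f hf
    rw [dualInner_apply, Finset.sum_eq_zero_iff_of_nonneg fun j _ => mul_self_nonneg _] at hf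
    exact e.ext fun i => mul_self_eq_zero.mp (hf i (Finset.mem_univ _))
  · intro g x y
    obtain ⟨A, rfl⟩ : ∃ A, g = A⁻¹ := ⟨g⁻¹, (inv_inv g).symm⟩
    rw [dualInner_apply, dualInner_apply]
    simp only [dual_apply_inv]
    exact sum_apply_G2 A ((LinearMap.mul ℝ ℝ).compl₁₂ x y)
  · intro h
    simpa using LinearMap.congr_fun h (e 0)
  · exact fun U _ => key U

/-- The contraction of a two-form with `φ`. -/
def formContr (e : Module.Basis (Fin 7) ℝ V) : Form V 2 →ₗ[ℝ] Fin 7 → ℝ where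
  toFun α := contr fun i j => α ![e i, e j]
  map_add' α β := by
    funext n
    simp [contr, mul_add, Finset.sum_add_distrib]
  map_smul' a α := by
    funext n
    simp only [contr, AlternatingMap.smul_apply, smul_eq_mul, RingHom.id_apply, Pi.smul_apply,
      Finset.mul_sum]
    exact Finset.sum_congr rfl fun _ _ => Finset.sum_congr rfl fun _ _ => by ring

theorem contr_zero {b : Fin 7 → Fin 7 → ℝ} (h : ∀ i j, b j i = -b i j) :
    contr b 0 = 2 * (b 1 2 + b 3 4 + b 5 6) := by
  simp [contr, Fin.sum_univ_succ, c, octIndex, octSign]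
  linarith [h 1 2, h 3 4, h 5 6]

theorem mem_two (e : Module.Basis (Fin 7) ℝ V) (U : Subrepresentation (formRep e 2)) (A : G2 e)
    {α : Form V 2} (hα : α ∈ U.toSubmodule) : ∃ β ∈ U.toSubmodule, ∀ x y, β ![x, y] = α ![A.1 x, A.1 y] :=
  ⟨_, U.apply_mem_toSubmodule A⁻¹ hα, formRep_two_apply_inv A α⟩

/-- A two-form with vanishing contraction with `φ`. -/
def weightForm (e : Module.Basis (Fin 7) ℝ V) : Form V 2 := coframe e ![1, 2] - coframe e ![3, 4]

theorem coframe2_basis (e : Module.Basis (Fin 7) ℝ V) (a b i j : Fin 7) :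
    coframe e ![a, b] ![e i, e j] = (delta2 a b i j : ℝ) := by
  rw [coframe_apply, Matrix.det_fin_two]
  simp only [Matrix.of_apply, Matrix.cons_val, coord_basis, delta2]
  push_cast
  ring

/-- The two sign changes take equal values exactly on the blocks `{0}`, `{1, 2}`, `{3, 4}`, `{5,
6}`; averaging a skew matrix leaves one entry for each of the three planes. -/
theorem signSum_mul {b : Fin 7 → Fin 7 → ℝ} (h : ∀ i j, b j i = -b i j) (i j : Fin 7) :
    (signSum i j : ℝ) * b i j = 4 * (b 1 2 * delta2 1 2 i j + b 3 4 * delta2 3 4 i j +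
      b 5 6 * delta2 5 6 i j) := by
  have h0 : ∀ i, b i i = 0 := fun i => by linarith [h i i]
  have h1 := h 1 2
  have h2 := h 3 4
  have h3 := h 5 6
  fin_cases i <;> fin_cases j <;> simp [signSum, delta2, delta, h0, h1, h2, h3]

theorem swap_delta : ∀ i j,
    ![1, 1, 1, 1, 1, -1, -1] i * ![1, 1, 1, 1, 1, -1, -1] j *
      delta2 1 2 (![0, 3, 4, 1, 2, 5, 6] i) (![0, 3, 4, 1, 2, 5, 6] j) = delta2 3 4 i j ∧
    ![1, 1, 1, 1, 1, -1, -1] i * ![1, 1, 1, 1, 1, -1, -1] j *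
      delta2 3 4 (![0, 3, 4, 1, 2, 5, 6] i) (![0, 3, 4, 1, 2, 5, 6] j) = delta2 1 2 i j ∧
    ![1, 1, 1, 1, 1, -1, -1] i * ![1, 1, 1, 1, 1, -1, -1] j *
      delta2 5 6 (![0, 3, 4, 1, 2, 5, 6] i) (![0, 3, 4, 1, 2, 5, 6] j) = delta2 5 6 i j := by
  decide +kernel

theorem form2_smul_smul (α : Form V 2) (a b : ℝ) (x y : V) :
    α ![a • x, b • y] = a * b * α ![x, y] := by
  have : formBilin α (a • x) (b • y) = a * b * formBilin α x y := by
    simp [mul_assoc, mul_left_comm]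
  exact this

/-- After averaging over signs, the difference with the image under the exchange of the planes `{1,
2}` and `{3, 4}` cancels the component along `{5, 6}`. -/
theorem smul_weightForm_mem (e : Module.Basis (Fin 7) ℝ V) (U : Subrepresentation (formRep e 2))
    {α : Form V 2} (hα : α ∈ U.toSubmodule) :
    (α ![e 1, e 2] - α ![e 3, e 4]) • weightForm e ∈ U.toSubmodule := by
  obtain ⟨S, hS⟩ := isAut_sign_one.exists_mem e
  obtain ⟨T, hT⟩ := isAut_sign_two.exists_mem e
  obtain ⟨R, hR⟩ := isAut_swap.exists_mem e
  obtain ⟨β, hβ, hβ'⟩ := mem_two e U S hα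
  obtain ⟨γ, hγ, hγ'⟩ := mem_two e U T (add_mem hα hβ)
  obtain ⟨δ, hδ, hδ'⟩ := mem_two e U R (add_mem (add_mem hα hβ) hγ)
  have hsum : ∀ i j, (α + β + γ) ![e i, e j] = 4 * (α ![e 1, e 2] * delta2 1 2 i j +
      α ![e 3, e 4] * delta2 3 4 i j + α ![e 5, e 6] * delta2 5 6 i j) := by
    intro i j
    rw [← signSum_mul (b := fun i j => α ![e i, e j]) fun i j => formBilin_swap α _ _]
    simp only [AlternatingMap.add_apply, hβ', hγ', hS, hT, map_smul, form2_smul_smul, signSum, id]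
    push_cast
    ring
  have h1 := U.toSubmodule.smul_mem (1 / 4 : ℝ) (sub_mem (add_mem (add_mem hα hβ) hγ) hδ)
  convert h1 using 1
  refine form2_ext (e := e) fun i j => ?_
  obtain ⟨h2, h3, h4⟩ := swap_delta i j
  have h2' := congrArg (Int.cast : ℤ → ℝ) h2
  have h3' := congrArg (Int.cast : ℤ → ℝ) h3
  have h4' := congrArg (Int.cast : ℤ → ℝ) h4
  simp only [Int.cast_mul] at h2' h3' h4'
  rw [AlternatingMap.smul_apply, AlternatingMap.smul_apply, AlternatingMap.sub_apply, hδ', hR, hR,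
    form2_smul_smul, hsum, hsum, weightForm, AlternatingMap.sub_apply, coframe2_basis, coframe2_basis,
    smul_eq_mul, smul_eq_mul]
  linear_combination α ![e 1, e 2] * h2' + α ![e 3, e 4] * h3' + α ![e 5, e 6] * h4'

theorem weightForm_contr : ∀ n, ∑ l, ∑ j, c n l j * (delta2 1 2 l j - delta2 3 4 l j) = 0 := by
  decide +kernel

theorem formContr_weightForm (e : Module.Basis (Fin 7) ℝ V) : formContr e (weightForm e) = 0 := by
  funext n
  have := congrArg (Int.cast : ℤ → ℝ) (weightForm_contr n)
  push_cast at this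
  simpa [formContr, contr, weightForm, coframe2_basis] using this

/-- The common vector is `e^{23} - e^{45}` in one-based indices. By `smul_weightForm_mem` it is
reached from any form whose components on these two planes differ; permutations arrange this. -/
theorem irreducible_fourteen {e : Module.Basis (Fin 7) ℝ V} (L : Subrepresentation (formRep e 2))
    (hL : ∀ α, α ∈ L.toSubmodule ↔ formContr e α = 0) : Irred L := by
  have := finite_form e 2
  refine irreducible_of_common_vector L (formInner e) ?_ ?_ ?_ (weightForm e) ?_
    ((hL _).mpr (formContr_weightForm e)) ?_
  · intro x y
    simp [formInner_apply, mul_comm]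
  · intro α h
    rw [formInner_apply] at h
    exact form2_ext (e := e) fun i j =>
      sum_sum_sq_eq_zero (b := fun i j => α ![e i, e j]) h i j
  · intro g x y
    obtain ⟨A, rfl⟩ : ∃ A, g = A⁻¹ := ⟨g⁻¹, (inv_inv g).symm⟩
    rw [formInner_apply, formInner_apply]
    simp only [formRep_two_apply_inv]
    exact sum_sum_apply_G2 A (formBilin x) (formBilin y)
  · intro h
    have := congrArg (fun α : Form V 2 => α ![e 1, e 2]) h
    simp [weightForm, coframe2_basis, delta2, delta] at this
  · intro U hUL α hα hα0
    have hw : ∀ β ∈ U.toSubmodule, β ![e 1, e 2] ≠ β ![e 3, e 4] →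
        weightForm e ∈ U.toSubmodule := fun β hβ h =>
      (Submodule.smul_mem_iff _ (sub_ne_zero.mpr h)).mp (smul_weightForm_mem e U hβ)
    have hsw : ∀ β : Form V 2, ∀ x y, β ![y, x] = - β ![x, y] := fun β x y => formBilin_swap β x y
    obtain ⟨i, j, hij⟩ : ∃ i j, α ![e i, e j] ≠ 0 := by
      by_contra! h
      exact hα0 (form2_ext (e := e) (by simpa using h))
    have hne : i ≠ j := by
      rintro rfl
      exact hij (formBilin_self α (e i))
    obtain ⟨n, m, hnm⟩ := cyc_transitive_pair i j hne
    obtain ⟨A, hA⟩ := exists_cyc e n m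
    obtain ⟨β, hβ, hβ'⟩ := mem_two e U A hα
    have h12 : β ![e 1, e 2] ≠ 0 := by
      rw [hβ', hA, hA]
      rcases hnm with ⟨h1, h2⟩ | ⟨h1, h2⟩ <;> rw [h1, h2]
      · exact hij
      · rw [hsw]
        exact neg_ne_zero.mpr hij
    -- If the two components agree, vanishing contraction makes the third equal to `-2` times the
    -- first. It then differs from them, and a rotation of the three planes brings an unequal pair
    -- into place.
    by_cases h34 : β ![e 1, e 2] = β ![e 3, e 4]
    · have hc : contr (fun i j => β ![e i, e j]) 0 = 0 := congrFun ((hL β).mp (hUL hβ)) 0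
      rw [contr_zero fun i j => hsw β _ _] at hc
      obtain ⟨A', hA'⟩ := exists_cyc e 0 1
      obtain ⟨γ, hγ, hγ'⟩ := mem_two e U A' hβ
      refine hw γ hγ ?_
      rw [hγ', hγ', hA', hA', hA', hA']
      intro h56
      change β ![e 3, e 4] = β ![e 5, e 6] at h56
      apply h12
      linarith
    · exact hw β hβ h34

theorem mem_bilin (e : Module.Basis (Fin 7) ℝ V) (U : Subrepresentation (bilinRep e)) (A : G2 e)
    {b : V →ₗ[ℝ] Module.Dual ℝ V} (hb : b ∈ U.toSubmodule) :
    ∃ b' ∈ U.toSubmodule, ∀ x y, b' x y = b (A.1 x) (A.1 y) :=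
  ⟨_, U.apply_mem_toSubmodule A⁻¹ hb, bilinRep_apply_inv A b⟩

/-- A bilinear form is diagonal with the given entries. -/
def IsDiag (e : Module.Basis (Fin 7) ℝ V) (b : V →ₗ[ℝ] Module.Dual ℝ V) (d : Fin 7 → ℝ) : Prop :=
  ∀ i j, b (e i) (e j) = if i = j then d i else 0

theorem IsDiag.add_perm {e : Module.Basis (Fin 7) ℝ V} {U : Subrepresentation (bilinRep e)}
    {b : V →ₗ[ℝ] Module.Dual ℝ V} {d : Fin 7 → ℝ} (hd : IsDiag e b d) (hb : b ∈ U.toSubmodule)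
    {σ : Fin 7 → Fin 7} {s : Fin 7 → ℤ} (h : IsAut σ s) (hσ : Function.Injective σ)
    (hs : ∀ i, s i * s i = 1) :
    ∃ b' ∈ U.toSubmodule, IsDiag e b' (d ∘ σ) := by
  obtain ⟨A, hA⟩ := h.exists_mem e
  obtain ⟨b', hb', hbA⟩ := mem_bilin e U A hb
  refine ⟨b', hb', fun i j => ?_⟩
  rw [hbA, hA, hA]
  simp only [map_smul, LinearMap.smul_apply, smul_eq_mul, hd (σ i), hσ.eq_iff]
  by_cases hij : i = j
  · subst hij
    have := congrArg (Int.cast : ℤ → ℝ) (hs i)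
    push_cast at this
    simp only [if_true, Function.comp_apply]
    rw [← mul_assoc, this, one_mul]
  · simp [hij]

theorem IsDiag.add {e : Module.Basis (Fin 7) ℝ V} {b b' : V →ₗ[ℝ] Module.Dual ℝ V}
    {d d' : Fin 7 → ℝ} (h : IsDiag e b d) (h' : IsDiag e b' d') : IsDiag e (b + b') (d + d') := by
  intro i j
  rw [LinearMap.add_apply, LinearMap.add_apply, h, h']
  split_ifs <;> simp

/-- The third sign change separates the two indices of each plane, so averaging over all three
leaves only the diagonal. -/
theorem signSum_mul_three : ∀ i j, signSum i j *
    (1 + ![-1, 1, -1, 1, -1, 1, -1] i * ![-1, 1, -1, 1, -1, 1, -1] j) = if i = j then 8 else 0 := by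
  decide +kernel

/-- A traceless diagonal bilinear form that is invariant under rotations fixing the first unit. -/
def weightBilin (e : Module.Basis (Fin 7) ℝ V) : V →ₗ[ℝ] Module.Dual ℝ V :=
  (7 : ℝ) • (e.coord 0).smulRight (e.coord 0) - metricBilin e

theorem weightBilin_basis (e : Module.Basis (Fin 7) ℝ V) (i j : Fin 7) :
    weightBilin e (e i) (e j) = 7 * (delta 0 i * delta 0 j) - delta i j := by
  change 7 * (e.coord 0 (e i) * e.coord 0 (e j)) - metricBilin e (e i) (e j) = _
  rw [metricBilin_basis, coord_basis, coord_basis]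

theorem exists_diag (e : Module.Basis (Fin 7) ℝ V) (U : Subrepresentation (bilinRep e))
    {b : V →ₗ[ℝ] Module.Dual ℝ V} (hb : b ∈ U.toSubmodule) :
    ∃ b' ∈ U.toSubmodule, IsDiag e b' fun i => 8 * b (e i) (e i) := by
  obtain ⟨S, hS⟩ := isAut_sign_one.exists_mem e
  obtain ⟨T, hT⟩ := isAut_sign_two.exists_mem e
  obtain ⟨R, hR⟩ := isAut_sign_three.exists_mem e
  obtain ⟨b1, hb1, h1⟩ := mem_bilin e U S hb
  obtain ⟨b2, hb2, h2⟩ := mem_bilin e U T (add_mem hb hb1)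
  obtain ⟨b3, hb3, h3⟩ := mem_bilin e U R (add_mem (add_mem hb hb1) hb2)
  refine ⟨_, add_mem (add_mem (add_mem hb hb1) hb2) hb3, fun i j => ?_⟩
  have h := congrArg (Int.cast : ℤ → ℝ) (signSum_mul_three i j)
  trans (8 * b (e i) (e j)) * if i = j then 1 else 0
  · simp only [LinearMap.add_apply, h1, h2, h3, hS, hT, hR, map_smul, LinearMap.smul_apply,
      smul_eq_mul, id]
    simp only [signSum, Int.cast_mul, Int.cast_add, Int.cast_one, Int.cast_ite, Int.cast_zero,
      Int.cast_ofNat] at h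
    have h' : (8 : ℝ) * (if i = j then 1 else 0) = if i = j then 8 else 0 := by simp
    rw [← h'] at h
    linear_combination b (e i) (e j) * h
  · split_ifs with hij
    · rw [hij, mul_one]
    · rw [mul_zero]

/-- Make `b` diagonal, symmetrize within the three pairs of indices, then rotate the pairs. The
entry at `0` becomes `12 · 8 b₀₀`; the others become twice the sum of the remaining diagonal
entries, which is `-2 · 8 b₀₀` by tracelessness. This is `16 b₀₀` times `(6, -1, …, -1)`. -/
theorem smul_weightBilin_mem (e : Module.Basis (Fin 7) ℝ V) (U : Subrepresentation (bilinRep e))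
    {b : V →ₗ[ℝ] Module.Dual ℝ V} (hb : b ∈ U.toSubmodule) (ht : ∑ i, b (e i) (e i) = 0) :
    (16 * b (e 0) (e 0)) • weightBilin e ∈ U.toSubmodule := by
  obtain ⟨b0, hb0, h0⟩ := exists_diag e U hb
  obtain ⟨b1, hb1, h1⟩ := h0.add_perm hb0 isAut_swap_two (by decide) (by decide)
  have h01 := h0.add h1
  obtain ⟨b2, hb2, h2⟩ := h01.add_perm (add_mem hb0 hb1) isAut_swap_one (by decide) (by decide)
  have h12 := h01.add h2
  have hm := add_mem (add_mem hb0 hb1) hb2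
  obtain ⟨b3, hb3, h3⟩ := h12.add_perm hm (isAut_cyc 0 1) (by decide) (by simp)
  obtain ⟨b4, hb4, h4⟩ := h12.add_perm hm (isAut_cyc 0 2) (by decide) (by simp)
  have hfin := (h12.add h3).add h4
  have hmem := add_mem (add_mem hm hb3) hb4
  convert hmem using 1
  refine e.ext fun i => e.ext fun j => ?_
  rw [hfin, LinearMap.smul_apply, LinearMap.smul_apply, weightBilin_basis, smul_eq_mul]
  rw [Fin.sum_univ_seven] at ht
  by_cases hij : i = j
  · subst hij
    rw [if_pos rfl]
    have c1 : ∀ i, cyc 0 1 i = ![0, 3, 4, 5, 6, 1, 2] i := by decide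
    have c2 : ∀ i, cyc 0 2 i = ![0, 5, 6, 1, 2, 3, 4] i := by decide
    simp only [Pi.add_apply, Function.comp_apply, c1, c2]
    fin_cases i <;> simp [delta] <;> linarith
  · rw [if_neg hij]
    have : (delta 0 i : ℝ) * delta 0 j = 0 := by
      by_cases h0 : 0 = i
      · subst h0
        simp [delta, hij]
      · simp [delta, h0]
    rw [this]
    simp [delta, hij]

theorem cyc_transitive_pair_zero : ∀ i j, i ≠ j → ∃ n, ∃ m,
    (cyc n m 0 = i ∧ cyc n m 1 = j) ∨ (cyc n m 0 = j ∧ cyc n m 1 = i) := by decide +kernel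

theorem irreducible_traceless {e : Module.Basis (Fin 7) ℝ V} (S : Subrepresentation (bilinRep e))
    (hS : ∀ b, b ∈ S.toSubmodule ↔ b ∈ tracelessSymm e) :
    Irred (W := V →ₗ[ℝ] Module.Dual ℝ V) S := by
  have := Module.Finite.of_basis e
  refine irreducible_of_common_vector S (bilinInner e) ?_ ?_ ?_ (weightBilin e) ?_
    ((hS _).mpr ⟨?_, ?_⟩) ?_
  · intro x y
    simp [bilinInner_apply, mul_comm]
  · intro b h
    rw [bilinInner_apply] at h
    exact e.ext fun i => e.ext fun j => sum_sum_sq_eq_zero (b := fun i j => b (e i) (e j)) h i j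
  · intro g x y
    obtain ⟨A, rfl⟩ : ∃ A, g = A⁻¹ := ⟨g⁻¹, (inv_inv g).symm⟩
    rw [bilinInner_apply, bilinInner_apply]
    simp only [bilinRep_apply_inv]
    exact sum_sum_apply_G2 A x y
  · intro h
    have := weightBilin_basis e 0 0
    rw [h] at this
    simp [delta] at this
    norm_num at this
  · intro x y
    change 7 * (e.coord 0 x * e.coord 0 y) - metricBilin e x y =
      7 * (e.coord 0 y * e.coord 0 x) - metricBilin e y x
    rw [metricBilin_comm, mul_comm (e.coord 0 x)]
  · simp only [weightBilin_basis]
    simp [delta, Finset.sum_sub_distrib]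
  · intro U hUL b hb hb0
    have hw : ∀ b ∈ U.toSubmodule, b (e 0) (e 0) ≠ 0 → weightBilin e ∈ U.toSubmodule :=
      fun b hb h => (Submodule.smul_mem_iff _ (mul_ne_zero (by norm_num) h)).mp
        (smul_weightBilin_mem e U hb ((hS b).mp (hUL hb)).2)
    have hsym : ∀ x y, b x y = b y x := ((hS b).mp (hUL hb)).1
    by_cases hd : ∃ i, b (e i) (e i) ≠ 0
    · obtain ⟨i, hi⟩ := hd
      obtain ⟨n, m, hnm⟩ := cyc_transitive i
      obtain ⟨A, hA⟩ := exists_cyc e n m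
      obtain ⟨b', hb', h⟩ := mem_bilin e U A hb
      refine hw b' hb' ?_
      rw [h, hA, hnm]
      exact hi
    · push Not at hd
      obtain ⟨i, j, hij⟩ : ∃ i j, b (e i) (e j) ≠ 0 := by
        by_contra! h
        exact hb0 (e.ext fun i => e.ext fun j => h i j)
      have hne : i ≠ j := by
        rintro rfl
        exact hij (hd i)
      obtain ⟨n, m, hnm⟩ := cyc_transitive_pair_zero i j hne
      obtain ⟨A, hA⟩ := exists_cyc e n m
      obtain ⟨b', hb', h⟩ := mem_bilin e U A hb
      -- Signed permutations keep a zero diagonal zero. The rotation turns the entry at `0, 1` into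
      -- `24/25` of itself on the diagonal.
      obtain ⟨R, hR⟩ := exists_rotation e
      obtain ⟨b'', hb'', h'⟩ := mem_bilin e U R hb'
      refine hw b'' hb'' ?_
      rw [h', hR]
      simp only [map_add, map_smul, LinearMap.add_apply, LinearMap.smul_apply, smul_eq_mul, h, hA,
        hd, hsym (e (cyc n m 1)) (e (cyc n m 0))]
      have hij' : b (e (cyc n m 0)) (e (cyc n m 1)) ≠ 0 := by
        rcases hnm with ⟨h1, h2⟩ | ⟨h1, h2⟩ <;> rw [h1, h2]
        · exact hij
        · rw [hsym]
          exact hij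
      intro hc
      apply hij'
      linarith

/-! ### The splitting of `Λ²` -/

theorem metricBilin_ext (e : Module.Basis (Fin 7) ℝ V) {x x' : V}
    (h : ∀ y, metricBilin e x y = metricBilin e x' y) : x = x' := by
  rw [← sum_metricBilin_smul e x, ← sum_metricBilin_smul e x']
  simp only [h]

/-- The vector dual to a covector. -/
def sharp (e : Module.Basis (Fin 7) ℝ V) : Module.Dual ℝ V →ₗ[ℝ] V where
  toFun f := ∑ i, f (e i) • e i
  map_add' f f' := by simp [add_smul, Finset.sum_add_distrib]
  map_smul' a f := by simp [mul_smul, Finset.smul_sum]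

theorem metricBilin_sharp (e : Module.Basis (Fin 7) ℝ V) (f : Module.Dual ℝ V) (y : V) :
    metricBilin e (sharp e f) y = f y := by
  rw [sum_coord_mul e f y]
  simp only [sharp, LinearMap.coe_mk, AddHom.coe_mk, map_sum, map_smul, LinearMap.sum_apply,
    LinearMap.smul_apply, metricBilin_basis_left, smul_eq_mul]
  exact Finset.sum_congr rfl fun i _ => mul_comm _ _

theorem sharp_metricBilin (e : Module.Basis (Fin 7) ℝ V) (x : V) :
    sharp e (metricBilin e x) = x :=
  sum_metricBilin_smul e x

theorem coord_sharp (e : Module.Basis (Fin 7) ℝ V) (f : Module.Dual ℝ V) (i : Fin 7) :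
    e.coord i (sharp e f) = f (e i) := by
  rw [← metricBilin_basis_left, metricBilin_comm, metricBilin_sharp]

theorem sharp_injective (e : Module.Basis (Fin 7) ℝ V) : Function.Injective (sharp e) := by
  intro f f' h
  ext x
  rw [← metricBilin_sharp e f, ← metricBilin_sharp e f', h]

theorem eq_sharp_of_forall {e : Module.Basis (Fin 7) ℝ V} (A : G2 e) {f f' : Module.Dual ℝ V}
    (h : ∀ x, f' x = f (A.1 x)) : A.1 (sharp e f') = sharp e f := by
  refine metricBilin_ext e fun y => ?_
  obtain ⟨z, rfl⟩ := A.1.surjective y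
  rw [metric_invariant A.2, metricBilin_sharp, metricBilin_sharp, h]

/-- The map `f ↦ φ(f^♯, ·, ·)`. -/
def insertPhi (e : Module.Basis (Fin 7) ℝ V) : Module.Dual ℝ V →ₗ[ℝ] Form V 2 :=
  (phi e).curryLeft ∘ₗ sharp e

theorem insertPhi_apply (e : Module.Basis (Fin 7) ℝ V) (f : Module.Dual ℝ V) (y z : V) :
    insertPhi e f ![y, z] = formTri (phi e) (sharp e f) y z := rfl

theorem insertPhi_equivariant (e : Module.Basis (Fin 7) ℝ V) (g : G2 e) (f : Module.Dual ℝ V) :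
    insertPhi e ((stdRep e).dual g f) = formRep e 2 g (insertPhi e f) := by
  obtain ⟨A, rfl⟩ : ∃ A, g = A⁻¹ := ⟨g⁻¹, (inv_inv g).symm⟩
  refine form2_ext (e := e) fun i j => ?_
  rw [formRep_two_apply_inv, insertPhi_apply, insertPhi_apply, ← (mem_G2_iff e A.1).mp A.2,
    eq_sharp_of_forall A (dual_apply_inv A f)]

theorem insertPhi_injective (e : Module.Basis (Fin 7) ℝ V) : Function.Injective (insertPhi e) := by
  rw [← LinearMap.ker_eq_bot, LinearMap.ker_eq_bot']
  intro f hf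
  apply sharp_injective e
  rw [map_zero]
  refine formTri_nondegenerate e fun y z => ?_
  rw [← insertPhi_apply, hf]
  rfl

theorem phi_apply_basis (e : Module.Basis (Fin 7) ℝ V) (x : V) (i j : Fin 7) :
    formTri (phi e) x (e i) (e j) = ∑ n, e.coord n x * c n i j := by
  have := sum_coord_mul e ((formTri (phi e)).flip (e i) |>.flip (e j)) x
  simpa only [LinearMap.flip_apply, formTri_apply, phi_basis] using this

theorem insertPhi_basis (e : Module.Basis (Fin 7) ℝ V) (f : Module.Dual ℝ V) (i j : Fin 7) :
    insertPhi e f ![e i, e j] = ∑ n, f (e n) * c n i j := by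
  rw [insertPhi_apply, phi_apply_basis]
  simp only [coord_sharp]

theorem formContr_insertPhi (e : Module.Basis (Fin 7) ℝ V) (f : Module.Dual ℝ V) (m : Fin 7) :
    formContr e (insertPhi e f) m = 6 * f (e m) := by
  have := contr_c (fun n => f (e n)) m
  simp only [← insertPhi_basis] at this
  exact this

/-- The contraction of a two-form with `φ`, as a covector. -/
def contrDual (e : Module.Basis (Fin 7) ℝ V) (α : Form V 2) : Module.Dual ℝ V :=
  e.constr ℝ (formContr e α)

theorem contrDual_basis (e : Module.Basis (Fin 7) ℝ V) (α : Form V 2) (m : Fin 7) :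
    contrDual e α (e m) = formContr e α m := by
  simp [contrDual]

/-- Contracting `α` with `p = ∑ c c - (δδ - δδ)`: the product term inserts the contraction of `α`
into `φ`, the minors give `-2α`. Both eigenspaces of `α ↦ ⋆(φ ∧ α)` are read off from this formula.
-/
theorem star_phi_wedge_two_eq (e : Module.Basis (Fin 7) ℝ V) (α : Form V 2) :
    (2 : ℝ) • hodgeStar e (p := 5) (q := 2) rfl (wedge (phi e) α) =
      insertPhi e (contrDual e α) - (2 : ℝ) • α := by
  refine form2_ext (e := e) fun k l => ?_
  have hα : α ![e l, e k] = - α ![e k, e l] := formBilin_swap α _ _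
  simp only [AlternatingMap.smul_apply, AlternatingMap.sub_apply, smul_eq_mul,
    star_phi_wedge_two, psi_basis, insertPhi_basis, contrDual_basis]
  simp only [p_eq']
  push_cast
  have h1 : ∑ i, ∑ j, α ![e i, e j] * ∑ m, (c m i j : ℝ) * c m k l =
      ∑ n, formContr e α n * c n k l := by
    simp only [formContr, LinearMap.coe_mk, AddHom.coe_mk, contr, Finset.mul_sum, Finset.sum_mul]
    rw [Finset.sum_comm_cycle]
    exact Finset.sum_congr rfl fun n _ => Finset.sum_congr rfl fun l _ =>
        Finset.sum_congr rfl fun j _ => by ring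
  have h2 : ∀ a b, ∑ i, ∑ j, α ![e i, e j] * ((delta i a : ℝ) * delta j b) =
      α ![e a, e b] := by
    intro a b
    trans ∑ i, (delta i a : ℝ) * ∑ j, (delta j b : ℝ) * α ![e i, e j]
    · simp only [Finset.mul_sum]
      exact Finset.sum_congr rfl fun l _ => Finset.sum_congr rfl fun j _ => by ring
    · rw [sum_delta_mul', sum_delta_mul']
  simp only [mul_sub, Finset.sum_sub_distrib, h1, h2, hα]
  ring

theorem star_eq_two_smul_iff (e : Module.Basis (Fin 7) ℝ V) (α : Form V 2) :
    hodgeStar e (p := 5) (q := 2) rfl (wedge (phi e) α) = (2 : ℝ) • α ↔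
      α ∈ LinearMap.range (insertPhi e) := by
  have h := star_phi_wedge_two_eq e α
  constructor
  · intro h'
    refine ⟨(6 : ℝ)⁻¹ • contrDual e α, ?_⟩
    rw [h', smul_smul] at h
    rw [map_smul, eq_add_of_sub_eq h.symm]
    module
  · rintro ⟨f, rfl⟩
    have h1 : contrDual e (insertPhi e f) = (6 : ℝ) • f :=
      e.ext fun m => by rw [contrDual_basis, formContr_insertPhi]; rfl
    rw [h1, map_smul] at h
    refine smul_right_injective _ (two_ne_zero (α := ℝ)) ?_
    simp only [h]
    module

theorem star_eq_neg_iff (e : Module.Basis (Fin 7) ℝ V) (α : Form V 2) :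
    hodgeStar e (p := 5) (q := 2) rfl (wedge (phi e) α) = - α ↔ formContr e α = 0 := by
  have h := star_phi_wedge_two_eq e α
  have h0 : formContr e α = 0 ↔ contrDual e α = 0 := by
    rw [contrDual, map_eq_zero_iff _ (e.constr ℝ).injective]
  rw [h0]
  constructor
  · intro h'
    rw [h'] at h
    apply insertPhi_injective e
    rw [map_zero, eq_add_of_sub_eq h.symm]
    module
  · intro h'
    rw [h', map_zero] at h
    refine smul_right_injective _ (two_ne_zero (α := ℝ)) ?_
    simp only [h]
    module

/-- The adjoint representation. -/
def g2Rep (e : Module.Basis (Fin 7) ℝ V) : Subrepresentation (endRep e) where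
  toSubmodule := LinearMap.ker (formDeriv (phi e))
  apply_mem_toSubmodule g B hB := by
    rw [LinearMap.mem_ker] at hB ⊢
    refine form3_ext (e := e) fun i j k => ?_
    exact (formDeriv_conj g.2 B (e i) (e j) (e k)).trans (by rw [hB]; rfl)

/-- The map `X ↦ g(X ·, ·)` on the Lie algebra. -/
def flat (e : Module.Basis (Fin 7) ℝ V) : (g2Rep e).toSubmodule →ₗ[ℝ] Form V 2 where
  toFun B := mkForm2 (metricBilin e ∘ₗ B.1) fun x => by
    have := skew_of_formDeriv_eq_zero (LinearMap.mem_ker.mp B.2) x x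
    rw [metricBilin_comm e x] at this
    rw [LinearMap.comp_apply]
    linarith
  map_add' B B' := by
    ext v
    simp [mkForm2]
  map_smul' a B := by
    ext v
    simp [mkForm2]

theorem flat_apply (e : Module.Basis (Fin 7) ℝ V) (B : (g2Rep e).toSubmodule) (x y : V) :
    flat e B ![x, y] = metricBilin e (B.1 x) y := rfl

theorem flat_injective (e : Module.Basis (Fin 7) ℝ V) : Function.Injective (flat e) := by
  intro B B' h
  refine Subtype.ext (LinearMap.ext fun x => metricBilin_ext e fun y => ?_)
  rw [← flat_apply, h, flat_apply]

theorem flat_equivariant (e : Module.Basis (Fin 7) ℝ V) (g : G2 e) (B : (g2Rep e).toSubmodule) :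
    flat e ((g2Rep e).toRepresentation g B) = formRep e 2 g (flat e B) := by
  obtain ⟨A, rfl⟩ : ∃ A, g = A⁻¹ := ⟨g⁻¹, (inv_inv g).symm⟩
  refine form2_ext (e := e) fun i j => ?_
  rw [formRep_two_apply_inv, flat_apply, flat_apply, ← metric_invariant A.2]
  congr 2
  change A.1 (A.1.symm (B.1 (A.1 (e i)))) = _
  rw [LinearEquiv.apply_symm_apply]

/-- For skew `B` the components of the two-form are minus the matrix of `B`, so this is the
description of the kernel of `B ↦ B·φ` by skewness and zero contraction. -/
theorem mem_range_flat_iff (e : Module.Basis (Fin 7) ℝ V) (α : Form V 2) :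
    α ∈ LinearMap.range (flat e) ↔ formContr e α = 0 := by
  have key : ∀ (B : V →ₗ[ℝ] V), (∀ i j, mat e B i j = - α ![e i, e j]) →
      ∀ n, contr (mat e B) n = - formContr e α n := by
    intro B h n
    simp only [formContr, LinearMap.coe_mk, AddHom.coe_mk, contr, h, mul_neg,
      Finset.sum_neg_distrib]
  have hsw : ∀ i j, α ![e j, e i] = - α ![e i, e j] := fun i j => formBilin_swap α _ _
  constructor
  · rintro ⟨B, rfl⟩
    have hB := (formDeriv_eq_zero_iff e B.1).mp (LinearMap.mem_ker.mp B.2)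
    funext n
    have := key B.1 (fun i j => by
      rw [← hsw, flat_apply, metricBilin_comm, metricBilin_basis_left, mat]) n
    rw [hB.2] at this
    simpa using this.symm
  · intro h
    have hB : formDeriv (phi e) (ofMat e fun i j => - α ![e i, e j]) = 0 := by
      rw [formDeriv_eq_zero_iff]
      refine ⟨fun i j => ?_, fun n => ?_⟩
      · rw [mat_ofMat, hsw i j]
        ring
      · rw [key _ fun i j => by rw [mat_ofMat], h]
        simp
    refine ⟨⟨_, LinearMap.mem_ker.mpr hB⟩, form2_ext (e := e) fun i j => ?_⟩
    rw [flat_apply, metricBilin_comm, metricBilin_basis_left]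
    change mat e _ j i = _
    rw [mat_ofMat, hsw i j]
    ring

theorem isCompl_two (e : Module.Basis (Fin 7) ℝ V) :
    IsCompl (LinearMap.range (insertPhi e)) (LinearMap.range (flat e)) := by
  constructor
  · rw [Submodule.disjoint_def]
    rintro _ ⟨f, rfl⟩ h
    rw [mem_range_flat_iff] at h
    have : f = 0 := e.ext fun m => by
      have h1 := formContr_insertPhi e f m
      rw [h] at h1
      simpa using h1.symm
    rw [this, map_zero]
  · rw [codisjoint_iff, Submodule.eq_top_iff']
    intro α
    -- As `formContr ∘ insertPhi` is multiplication by `6`, a sixth of the contraction gives the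
    -- projection onto the seven-dimensional summand.
    have h : formContr e (α - insertPhi e ((6 : ℝ)⁻¹ • contrDual e α)) = 0 := by
      funext m
      rw [map_sub, Pi.sub_apply, formContr_insertPhi, LinearMap.smul_apply, contrDual_basis]
      simp
    rw [← sub_add_cancel α (insertPhi e ((6 : ℝ)⁻¹ • contrDual e α)), add_comm]
    exact Submodule.add_mem_sup (LinearMap.mem_range_self _ _) ((mem_range_flat_iff e _).mpr h)

theorem finrank_range_insertPhi (e : Module.Basis (Fin 7) ℝ V) :
    Module.finrank ℝ (LinearMap.range (insertPhi e)) = 7 := by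
  have := Module.Finite.of_basis e
  rw [LinearMap.finrank_range_of_inj (insertPhi_injective e), Subspace.dual_finrank_eq,
    Module.finrank_eq_card_basis e, Fintype.card_fin]

theorem finrank_range_flat (e : Module.Basis (Fin 7) ℝ V) :
    Module.finrank ℝ (LinearMap.range (flat e)) = 14 := by
  have := finite_form e 2
  have h := Submodule.finrank_add_eq_of_isCompl (isCompl_two e)
  rw [finrank_range_insertPhi, finrank_form e 2] at h
  have : Nat.choose 7 2 = 21 := rfl
  omega

/-! ### Internal direct sums -/

section Internal
variable {W : Type*} [AddCommGroup W] [Module ℝ W]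

theorem isInternal_three {P Q R : Submodule ℝ W}
    (h : ∀ a ∈ P, ∀ b ∈ Q, ∀ d ∈ R, a + b + d = 0 → a = 0 ∧ b = 0 ∧ d = 0)
    (h' : ∀ x, ∃ a ∈ P, ∃ b ∈ Q, ∃ d ∈ R, x = a + b + d) : DirectSum.IsInternal ![P, Q, R] := by
  refine DirectSum.isInternal_submodule_of_iSupIndep_of_iSup_eq_top ?_ ?_
  · rw [iSupIndep_fin_three]
    simp only [Submodule.disjoint_def, Submodule.mem_sup]
    refine ⟨?_, ?_, ?_⟩
    · rintro a ha ⟨b, hb, d, hd, hs⟩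
      exact (h a ha (-b) (neg_mem hb) (-d) (neg_mem hd) (by rw [← hs]; abel)).1
    · rintro b hb ⟨d, hd, a, ha, hs⟩
      exact (h (-a) (neg_mem ha) b hb (-d) (neg_mem hd) (by rw [← hs]; abel)).2.1
    · rintro d hd ⟨a, ha, b, hb, hs⟩
      exact (h (-a) (neg_mem ha) (-b) (neg_mem hb) d hd (by rw [← hs]; abel)).2.2
  · rw [iSup_fin_three, Submodule.eq_top_iff']
    intro x
    obtain ⟨a, ha, b, hb, d, hd, rfl⟩ := h' x
    exact Submodule.add_mem_sup (Submodule.add_mem_sup ha hb) hd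

theorem isInternal_two {P Q : Submodule ℝ W} (h : IsCompl P Q) : DirectSum.IsInternal ![P, Q] :=
  (DirectSum.isInternal_submodule_iff_isCompl ![P, Q] (i := 0) (j := 1) (by decide)
    (by ext a; fin_cases a <;> simp)).mpr h

theorem finrank_eq_add_of_isInternal [FiniteDimensional ℝ W] {P Q R : Submodule ℝ W}
    (h : DirectSum.IsInternal ![P, Q, R]) :
    Module.finrank ℝ W = Module.finrank ℝ P + Module.finrank ℝ Q + Module.finrank ℝ R := by
  rw [← (LinearEquiv.ofBijective (DirectSum.coeLinearMap ![P, Q, R]) h).finrank_eq]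
  have : ∀ i, Module.Finite ℝ (![P, Q, R] i) := fun i => inferInstance
  rw [Module.finrank_directSum, Fin.sum_univ_three]
  rfl

end Internal

/-! ### The splitting of `Λ³` -/

/-- The three-form obtained from a bilinear form through the infinitesimal action on `φ`. -/
def bilinDeriv (e : Module.Basis (Fin 7) ℝ V) : (V →ₗ[ℝ] Module.Dual ℝ V) →ₗ[ℝ] Form V 3 :=
  formDeriv (phi e) ∘ₗ LinearMap.compRight ℝ (sharp e)

theorem bilinDeriv_apply (e : Module.Basis (Fin 7) ℝ V) (b : V →ₗ[ℝ] Module.Dual ℝ V) (x y z : V) :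
    bilinDeriv e b ![x, y, z] = formTri (phi e) (sharp e (b x)) y z +
      formTri (phi e) x (sharp e (b y)) z + formTri (phi e) x y (sharp e (b z)) := rfl

/-- The components of a bilinear form, transposed. -/
def comps (e : Module.Basis (Fin 7) ℝ V) (b : V →ₗ[ℝ] Module.Dual ℝ V) (i j : Fin 7) : ℝ :=
  b (e j) (e i)

theorem mat_sharp_comp (e : Module.Basis (Fin 7) ℝ V) (b : V →ₗ[ℝ] Module.Dual ℝ V) :
    mat e (sharp e ∘ₗ b) = comps e b := by
  funext i j
  exact coord_sharp e _ _

theorem bilinDeriv_components (e : Module.Basis (Fin 7) ℝ V) (b : V →ₗ[ℝ] Module.Dual ℝ V)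
    (i j k : Fin 7) : bilinDeriv e b ![e i, e j, e k] = derivComp (comps e b) i j k := by
  rw [← mat_sharp_comp]
  exact formDeriv_phi_basis e _ i j k

theorem bilinDeriv_eq_zero_iff (e : Module.Basis (Fin 7) ℝ V) (b : V →ₗ[ℝ] Module.Dual ℝ V) :
    bilinDeriv e b = 0 ↔
      (∀ i j, comps e b i j + comps e b j i = 0) ∧ ∀ n, contr (comps e b) n = 0 := by
  rw [← mat_sharp_comp]
  exact formDeriv_eq_zero_iff e _

theorem bilinDeriv_equivariant (e : Module.Basis (Fin 7) ℝ V) (g : G2 e)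
    (b : V →ₗ[ℝ] Module.Dual ℝ V) :
    bilinDeriv e (bilinRep e g b) = formRep e 3 g (bilinDeriv e b) := by
  obtain ⟨A, rfl⟩ : ∃ A, g = A⁻¹ := ⟨g⁻¹, (inv_inv g).symm⟩
  have h : ∀ x, A.1 (sharp e (bilinRep e A⁻¹ b x)) = sharp e (b (A.1 x)) := fun x =>
    eq_sharp_of_forall A fun y => bilinRep_apply_inv A b x y
  refine form3_ext (e := e) fun i j k => ?_
  rw [formRep_three_apply_inv, bilinDeriv_apply, bilinDeriv_apply]
  simp only [← h, (mem_G2_iff e A.1).mp A.2]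

theorem bilinDeriv_metricBilin (e : Module.Basis (Fin 7) ℝ V) :
    bilinDeriv e (metricBilin e) = (3 : ℝ) • phi e := by
  refine form3_ext (e := e) fun i j k => ?_
  simp only [bilinDeriv_apply, sharp_metricBilin, AlternatingMap.smul_apply, formTri_apply,
    smul_eq_mul]
  ring

theorem finrank_ker_formDeriv (e : Module.Basis (Fin 7) ℝ V) :
    Module.finrank ℝ (LinearMap.ker (formDeriv (phi e))) = 14 :=
  (LinearEquiv.ofInjective (flat e) (flat_injective e)).finrank_eq.trans (finrank_range_flat e)

/-- Rank and nullity: `49 - 14 = 35 = dim Λ³`. -/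
theorem formDeriv_surjective (e : Module.Basis (Fin 7) ℝ V) :
    Function.Surjective (formDeriv (phi e)) := by
  have := Module.Finite.of_basis e
  have := Module.Free.of_basis e
  have := finite_form e 3
  rw [← LinearMap.range_eq_top]
  apply Submodule.eq_top_of_finrank_eq
  have h := (formDeriv (phi e)).finrank_range_add_finrank_ker
  rw [finrank_ker_formDeriv, Module.finrank_linearMap, Module.finrank_eq_card_basis e,
    Fintype.card_fin] at h
  have h3 : Nat.choose 7 3 = 35 := rfl
  rw [finrank_form e 3]
  omega

theorem bilinDeriv_surjective (e : Module.Basis (Fin 7) ℝ V) :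
    Function.Surjective (bilinDeriv e) := by
  intro α
  obtain ⟨B, rfl⟩ := formDeriv_surjective e α
  refine ⟨metricBilin e ∘ₗ B, congrArg (formDeriv (phi e)) ?_⟩
  ext x
  exact sharp_metricBilin e (B x)

/-- The bilinear form `φ(f^♯, ·, ·)`. -/
def crossBilin (e : Module.Basis (Fin 7) ℝ V) : Module.Dual ℝ V →ₗ[ℝ] V →ₗ[ℝ] Module.Dual ℝ V :=
  formTri (phi e) ∘ₗ sharp e

theorem crossBilin_basis (e : Module.Basis (Fin 7) ℝ V) (f : Module.Dual ℝ V) (i j : Fin 7) :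
    crossBilin e f (e i) (e j) = ∑ n, f (e n) * c n i j :=
  insertPhi_basis e f i j

theorem crossBilin_equivariant (e : Module.Basis (Fin 7) ℝ V) (g : G2 e) (f : Module.Dual ℝ V) :
    crossBilin e ((stdRep e).dual g f) = bilinRep e g (crossBilin e f) := by
  obtain ⟨A, rfl⟩ : ∃ A, g = A⁻¹ := ⟨g⁻¹, (inv_inv g).symm⟩
  ext x y
  rw [bilinRep_apply_inv]
  change formTri (phi e) (sharp e _) x y = formTri (phi e) (sharp e f) (A.1 x) (A.1 y)
  rw [← (mem_G2_iff e A.1).mp A.2, eq_sharp_of_forall A (dual_apply_inv A f)]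

theorem comps_crossBilin (e : Module.Basis (Fin 7) ℝ V) (f : Module.Dual ℝ V) (i j : Fin 7) :
    comps e (crossBilin e f) i j = - ∑ n, f (e n) * c n i j := by
  rw [comps, crossBilin_basis, ← Finset.sum_neg_distrib]
  refine Finset.sum_congr rfl fun n _ => ?_
  rw [c_swap_right n i j]
  push_cast
  ring

theorem contr_neg (b : Fin 7 → Fin 7 → ℝ) (n : Fin 7) :
    contr (fun i j => - b i j) n = - contr b n := by
  simp only [contr, mul_neg, Finset.sum_neg_distrib]

theorem contr_crossBilin (e : Module.Basis (Fin 7) ℝ V) (f : Module.Dual ℝ V) (m : Fin 7) :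
    contr (comps e (crossBilin e f)) m = - 6 * f (e m) := by
  have h : comps e (crossBilin e f) = fun i j => - ∑ n, f (e n) * c n i j := by
    funext i j
    exact comps_crossBilin e f i j
  rw [h, contr_neg, contr_c fun n => f (e n)]
  ring

/-- The components of `φ` are skew in the two contracted indices. -/
theorem contr_eq_zero_of_symm {b : Fin 7 → Fin 7 → ℝ} (h : ∀ i j, b i j = b j i) (n : Fin 7) :
    contr b n = 0 := by
  have : contr b n = - contr b n := by
    conv_lhs => rw [contr, Finset.sum_comm]
    simp only [contr, ← Finset.sum_neg_distrib]
    refine Finset.sum_congr rfl fun i _ => Finset.sum_congr rfl fun j _ => ?_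
    rw [h j i, c_swap_right n i j]
    push_cast
    ring
  linarith

theorem comps_add (e : Module.Basis (Fin 7) ℝ V) (b b' : V →ₗ[ℝ] Module.Dual ℝ V) :
    comps e (b + b') = comps e b + comps e b' := rfl

theorem contr_add (b b' : Fin 7 → Fin 7 → ℝ) (n : Fin 7) :
    contr (b + b') n = contr b n + contr b' n := by
  simp only [contr, Pi.add_apply, mul_add, Finset.sum_add_distrib]

theorem p_hcontr : ∀ l i m, ∑ j, ∑ k, p i j k l * c m j k = 4 * c l m i := by decide +kernel

theorem p_swap_left : ∀ i j k l, p j i k l = - p i j k l := by decide +kernel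

theorem p_swap_right : ∀ i j k l, p i k j l = - p i j k l := by decide +kernel

theorem sum_bilinDeriv_mul_c (e : Module.Basis (Fin 7) ℝ V) (b : V →ₗ[ℝ] Module.Dual ℝ V) :
    ∑ i, ∑ j, ∑ k, bilinDeriv e b ![e i, e j, e k] * c i j k = 18 * ∑ i, b (e i) (e i) := by
  have h := sum_mul_derivComp (a := fun i j k => (c i j k : ℝ))
    (fun i j k => by exact_mod_cast c_swap_left i j k)
    (fun i j k => by exact_mod_cast c_swap_right i j k) (comps e b)
  simp only [bilinDeriv_components]
  simp only [mul_comm (derivComp _ _ _ _), h, hcontr, c_contract_real]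
  have : ∀ i, ∑ l, comps e b l i * (6 * (delta i l : ℝ)) = 6 * b (e i) (e i) := fun i => by
    trans ∑ l, (delta i l : ℝ) * (6 * comps e b l i)
    · exact Finset.sum_congr rfl fun l _ => by ring
    · rw [sum_delta_mul]
      rfl
  simp only [this, ← Finset.mul_sum]
  ring

theorem sum_bilinDeriv_mul_p (e : Module.Basis (Fin 7) ℝ V) (b : V →ₗ[ℝ] Module.Dual ℝ V)
    (l : Fin 7) : ∑ i, ∑ j, ∑ k, bilinDeriv e b ![e i, e j, e k] * p i j k l =
      12 * contr (comps e b) l := by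
  have h := sum_mul_derivComp (a := fun i j k => (p i j k l : ℝ))
    (fun i j k => by exact_mod_cast p_swap_left i j k l)
    (fun i j k => by exact_mod_cast p_swap_right i j k l) (comps e b)
  have h' : ∀ i m, hcontr (fun i j k => (p i j k l : ℝ)) i m = 4 * c l m i := fun i m => by
    rw [hcontr]
    exact_mod_cast congrArg (Int.cast : ℤ → ℝ) (p_hcontr l i m)
  simp only [bilinDeriv_components]
  simp only [mul_comm (derivComp _ _ _ _), h, h', contr]
  rw [Finset.sum_comm, Finset.mul_sum, Finset.mul_sum]
  refine Finset.sum_congr rfl fun i _ => ?_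
  rw [Finset.mul_sum, Finset.mul_sum]
  exact Finset.sum_congr rfl fun j _ => by ring

/-- The derivation along `φ(f^♯, ·, ·)` gives `3 ⋆ (φ ∧ f)`. -/
theorem bilinDeriv_crossBilin (e : Module.Basis (Fin 7) ℝ V) (α : Form V 1) (f : Module.Dual ℝ V)
    (h : ∀ i, α ![e i] = f (e i)) : bilinDeriv e (crossBilin e f) =
      (3 : ℝ) • hodgeStar e (p := 4) (q := 3) rfl (wedge (phi e) α) := by
  refine form3_ext (e := e) fun i j k => ?_
  rw [AlternatingMap.smul_apply, star_phi_wedge_one, smul_eq_mul, Finset.mul_sum,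
    bilinDeriv_components, derivComp]
  have h1 : ∀ m, 3 * (α ![e m] * psi e ![e m, e i, e j, e k]) =
      ∑ l, f (e m) * (c m i l * c l j k + c m j l * c i l k + c m k l * c i j l) := fun m => by
    rw [psi_basis, h, ← Finset.mul_sum]
    have := congrArg (Int.cast : ℤ → ℝ) (p_eq_sum m i j k)
    push_cast at this
    rw [← this]
    ring
  simp only [h1, comps, crossBilin_basis]
  rw [Finset.sum_comm]
  refine Finset.sum_congr rfl fun l _ => ?_
  simp only [Finset.sum_mul, ← Finset.sum_add_distrib]
  exact Finset.sum_congr rfl fun m _ => by ring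

theorem sum_metricBilin (e : Module.Basis (Fin 7) ℝ V) : ∑ i, metricBilin e (e i) (e i) = 7 := by
  simp [metricBilin_basis, delta]

/-- Lift `α` to a bilinear form and split off its trace, its contraction with `φ` and its traceless
symmetric part. What remains is skew with zero contraction, hence acts trivially on `φ`. -/
theorem exists_bilinDeriv_eq (e : Module.Basis (Fin 7) ℝ V) (α : Form V 3) :
    ∃ (t : ℝ) (f : Module.Dual ℝ V), ∃ b ∈ tracelessSymm e,
      α = bilinDeriv e (t • metricBilin e) + bilinDeriv e (crossBilin e f) + bilinDeriv e b := by
  obtain ⟨b, rfl⟩ := bilinDeriv_surjective e α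
  obtain ⟨t, ht⟩ : ∃ t : ℝ, 7 * t = ∑ i, b (e i) (e i) := ⟨(∑ i, b (e i) (e i)) / 7, by ring⟩
  -- The divisor `-6` is the factor of `contr_crossBilin`; its sign comes from the transposition in
  -- `comps`.
  let f : Module.Dual ℝ V := e.constr ℝ fun n => - contr (comps e b) n / 6
  have hf : ∀ n, - 6 * f (e n) = contr (comps e b) n := fun n => by
    simp only [f, Module.Basis.constr_basis]
    ring
  let s : V →ₗ[ℝ] Module.Dual ℝ V := (2 : ℝ)⁻¹ • (b + LinearMap.flip b) - t • metricBilin e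
  have hs : ∀ x y, s x y = 2⁻¹ * (b x y + b y x) - t * metricBilin e x y := fun _ _ => rfl
  have hs' : ∀ x y, s x y = s y x := fun x y => by
    rw [hs, hs, metricBilin_comm]; ring
  refine ⟨t, f, s, ⟨hs', ?_⟩, ?_⟩
  · simp only [hs, Finset.sum_sub_distrib, ← Finset.mul_sum, Finset.sum_add_distrib,
      sum_metricBilin, ← ht]
    ring
  · rw [← sub_eq_zero, ← map_add, ← map_add, ← map_sub, bilinDeriv_eq_zero_iff]
    have hk : ∀ i j, comps e (b - (t • metricBilin e + crossBilin e f + s)) i j =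
        2⁻¹ * (comps e b i j - comps e b j i) - comps e (crossBilin e f) i j := by
      intro i j
      change b (e j) (e i) - (t * metricBilin e (e j) (e i) + crossBilin e f (e j) (e i) +
        s (e j) (e i)) = 2⁻¹ * (b (e j) (e i) - b (e i) (e j)) - crossBilin e f (e j) (e i)
      rw [hs]
      ring
    constructor
    · intro i j
      have h1 : crossBilin e f (e j) (e i) = - crossBilin e f (e i) (e j) :=
        formTri_swap_right (phi e) _ _ _
      rw [hk, hk]
      simp only [comps, h1]
      ring
    · intro n
      have h1 : contr (comps e (t • metricBilin e + s)) n = 0 := by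
        refine contr_eq_zero_of_symm (fun i j => ?_) n
        change t * metricBilin e (e j) (e i) + s (e j) (e i) =
          t * metricBilin e (e i) (e j) + s (e i) (e j)
        rw [hs', metricBilin_comm]
      have h2 : b = b - (t • metricBilin e + crossBilin e f + s) +
          (t • metricBilin e + s + crossBilin e f) := by abel
      have h3 := congrArg (fun b => contr (comps e b) n) h2
      rw [comps_add, comps_add e _ (crossBilin e f), contr_add, contr_add, contr_crossBilin, hf,
        h1] at h3
      linarith

/-- Pairing with `φ` sees only the trace (`126 = 18 · 7`) and pairing with `⋆φ` only the contraction
(`-72 = 12 · (-6)`). This gives both the independence of the summands and the equations of `Λ³₂₇`.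
-/
theorem components_of_eq_bilinDeriv {e : Module.Basis (Fin 7) ℝ V} {α : Form V 3} {t : ℝ}
    {f : Module.Dual ℝ V} {b : V →ₗ[ℝ] Module.Dual ℝ V} (hb : b ∈ tracelessSymm e)
    (h : α = bilinDeriv e (t • metricBilin e) + bilinDeriv e (crossBilin e f) + bilinDeriv e b) :
    ∑ i, ∑ j, ∑ k, α ![e i, e j, e k] * c i j k = 126 * t ∧
      ∀ l, ∑ i, ∑ j, ∑ k, α ![e i, e j, e k] * p i j k l = - 72 * f (e l) := by
  rw [← map_add, ← map_add] at h
  subst h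
  have h0 : ∀ i, crossBilin e f (e i) (e i) = 0 := fun i => formTri_self_right (phi e) _ _
  have h1 : ∀ n, contr (comps e (t • metricBilin e)) n = 0 := contr_eq_zero_of_symm fun i j => by
    change t * metricBilin e (e j) (e i) = t * metricBilin e (e i) (e j)
    rw [metricBilin_comm]
  have h2 : ∀ n, contr (comps e b) n = 0 := contr_eq_zero_of_symm fun i j => hb.1 _ _
  constructor
  · rw [sum_bilinDeriv_mul_c]
    simp only [LinearMap.add_apply, LinearMap.smul_apply, Finset.sum_add_distrib, h0, hb.2,
      smul_eq_mul, ← Finset.mul_sum, sum_metricBilin, Finset.sum_const_zero]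
    ring
  · intro l
    rw [sum_bilinDeriv_mul_p, comps_add, comps_add, contr_add, contr_add, h1, h2,
      contr_crossBilin]
    ring

theorem eq_zero_of_bilinDeriv_eq_zero {e : Module.Basis (Fin 7) ℝ V} {b : V →ₗ[ℝ] Module.Dual ℝ V}
    (hb : b ∈ tracelessSymm e) (h : bilinDeriv e b = 0) : b = 0 := by
  refine e.ext fun i => e.ext fun j => ?_
  have h1 : b (e i) (e j) + b (e j) (e i) = 0 := ((bilinDeriv_eq_zero_iff e b).mp h).1 j i
  rw [hb.1 (e j)] at h1
  change b (e i) (e j) = 0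
  linarith

theorem eq_zero_of_sum_eq_zero {e : Module.Basis (Fin 7) ℝ V} {t : ℝ} {f : Module.Dual ℝ V}
    {b : V →ₗ[ℝ] Module.Dual ℝ V} (hb : b ∈ tracelessSymm e)
    (h : bilinDeriv e (t • metricBilin e) + bilinDeriv e (crossBilin e f) + bilinDeriv e b = 0) :
    t = 0 ∧ f = 0 ∧ b = 0 := by
  obtain ⟨h1, h2⟩ := components_of_eq_bilinDeriv hb h.symm
  simp only [AlternatingMap.zero_apply, zero_mul, Finset.sum_const_zero] at h1 h2
  have ht : t = 0 := by linarith
  have hf : f = 0 := e.ext fun l => by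
    have := h2 l
    rw [LinearMap.zero_apply]
    linarith
  refine ⟨ht, hf, eq_zero_of_bilinDeriv_eq_zero hb ?_⟩
  simpa [ht, hf] using h

/-- The `G₂`-module `S₀²V*`. -/
def tracelessRep (e : Module.Basis (Fin 7) ℝ V) : Subrepresentation (bilinRep e) where
  toSubmodule :=
    { carrier := tracelessSymm e
      add_mem' := fun {b b'} hb hb' => ⟨fun x y => by
          rw [LinearMap.add_apply, LinearMap.add_apply, LinearMap.add_apply, LinearMap.add_apply,
            hb.1 x y, hb'.1 x y], by
          simp only [LinearMap.add_apply, Finset.sum_add_distrib, hb.2, hb'.2, add_zero]⟩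
      zero_mem' := ⟨fun _ _ => rfl, by simp⟩
      smul_mem' := fun t b hb => ⟨fun x y => by
          rw [LinearMap.smul_apply, LinearMap.smul_apply, LinearMap.smul_apply,
            LinearMap.smul_apply, hb.1 x y], by
          simp only [LinearMap.smul_apply, ← Finset.smul_sum, hb.2, smul_zero]⟩ }
  apply_mem_toSubmodule g b hb := by
    obtain ⟨A, rfl⟩ : ∃ A, g = A⁻¹ := ⟨g⁻¹, (inv_inv g).symm⟩
    refine ⟨fun x y => ?_, ?_⟩
    · rw [bilinRep_apply_inv, bilinRep_apply_inv]
      exact hb.1 _ _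
    · simp only [bilinRep_apply_inv]
      exact (sum_apply_G2 A b).trans hb.2

/-- The trivial submodule spanned by `φ`. -/
def phiRep (e : Module.Basis (Fin 7) ℝ V) : Subrepresentation (formRep e 3) where
  toSubmodule := Submodule.span ℝ {phi e}
  apply_mem_toSubmodule g α hα := by
    obtain ⟨t, rfl⟩ := Submodule.mem_span_singleton.mp hα
    rw [map_smul]
    refine Submodule.smul_mem _ _ ?_
    rw [show formRep e 3 g (phi e) = phi e from g.2]
    exact Submodule.mem_span_singleton_self _

theorem phi_ne_zero (e : Module.Basis (Fin 7) ℝ V) : phi e ≠ 0 := fun h =>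
  e.ne_zero 0 (formTri_nondegenerate e fun y z => by rw [formTri_apply, h]; rfl)

theorem irreducible_phiRep (e : Module.Basis (Fin 7) ℝ V) : Irred (phiRep e) := by
  have : Nontrivial (phiRep e).toSubmodule :=
    ⟨⟨phi e, Submodule.mem_span_singleton_self _⟩, 0, fun h => phi_ne_zero e (congrArg Subtype.val h)⟩
  refine isIrreducible_of_forall fun U x hx hx0 => ?_
  apply Subrepresentation.toSubmodule_injective
  refine Submodule.eq_top_iff'.mpr fun y => ?_
  obtain ⟨s, hs⟩ := Submodule.mem_span_singleton.mp x.2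
  obtain ⟨t, ht⟩ := Submodule.mem_span_singleton.mp y.2
  have hs0 : s ≠ 0 := fun h => hx0 (Subtype.ext (by rw [← hs, h, zero_smul]; rfl))
  have : y = (t / s) • x := Subtype.ext (by
    change y.1 = (t / s) • x.1
    rw [← hs, ← ht, smul_smul, div_mul_cancel₀ _ hs0])
  rw [this]
  exact Submodule.smul_mem _ _ hx

/-- The equivariant map onto the seven-dimensional summand of `Λ³`. -/
def crossDeriv (e : Module.Basis (Fin 7) ℝ V) : Module.Dual ℝ V →ₗ[ℝ] Form V 3 :=
  bilinDeriv e ∘ₗ crossBilin e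

theorem crossDeriv_equivariant (e : Module.Basis (Fin 7) ℝ V) (g : G2 e) (f : Module.Dual ℝ V) :
    crossDeriv e ((stdRep e).dual g f) = formRep e 3 g (crossDeriv e f) := by
  rw [crossDeriv, LinearMap.comp_apply, crossBilin_equivariant, bilinDeriv_equivariant]
  rfl

theorem zero_mem_tracelessSymm (e : Module.Basis (Fin 7) ℝ V) : 0 ∈ tracelessSymm e :=
  (tracelessRep e).toSubmodule.zero_mem

theorem crossDeriv_injective (e : Module.Basis (Fin 7) ℝ V) :
    Function.Injective (crossDeriv e) := by
  rw [← LinearMap.ker_eq_bot, LinearMap.ker_eq_bot']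
  intro f hf
  refine (eq_zero_of_sum_eq_zero (t := 0) (zero_mem_tracelessSymm e) ?_).2.1
  rw [zero_smul, map_zero, zero_add, add_zero]
  exact hf

/-- The equivariant map onto the largest summand of `Λ³`. -/
def symmDeriv (e : Module.Basis (Fin 7) ℝ V) : (tracelessRep e).toSubmodule →ₗ[ℝ] Form V 3 :=
  bilinDeriv e ∘ₗ (tracelessRep e).toSubmodule.subtype

theorem symmDeriv_equivariant (e : Module.Basis (Fin 7) ℝ V) (g : G2 e)
    (b : (tracelessRep e).toSubmodule) :
    symmDeriv e ((tracelessRep e).toRepresentation g b) = formRep e 3 g (symmDeriv e b) :=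
  bilinDeriv_equivariant e g b.1

theorem bilinDeriv_injOn (e : Module.Basis (Fin 7) ℝ V) :
    Set.InjOn (bilinDeriv e) (tracelessSymm e) := by
  intro b hb b' hb' h
  rw [← sub_eq_zero, ← map_sub] at h
  refine sub_eq_zero.mp (eq_zero_of_bilinDeriv_eq_zero ⟨fun x y => ?_, ?_⟩ h)
  · rw [LinearMap.sub_apply, LinearMap.sub_apply, LinearMap.sub_apply, LinearMap.sub_apply,
      hb.1 x y, hb'.1 x y]
  · simp only [LinearMap.sub_apply, Finset.sum_sub_distrib, hb.2, hb'.2, sub_zero]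

theorem symmDeriv_injective (e : Module.Basis (Fin 7) ℝ V) : Function.Injective (symmDeriv e) :=
  fun b b' h => Subtype.ext (bilinDeriv_injOn e b.2 b'.2 h)

theorem isInternal_forms_three (e : Module.Basis (Fin 7) ℝ V) :
    DirectSum.IsInternal ![Submodule.span ℝ {phi e}, LinearMap.range (crossDeriv e),
      LinearMap.range (symmDeriv e)] := by
  refine isInternal_three ?_ fun α => ?_
  · rintro _ ha _ ⟨f, rfl⟩ _ ⟨b, rfl⟩ h
    obtain ⟨t, rfl⟩ := Submodule.mem_span_singleton.mp ha
    -- The metric corresponds to the identity, which acts on `φ` as `3`; hence `t / 3`.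
    obtain ⟨h1, h2, h3⟩ := eq_zero_of_sum_eq_zero (t := t / 3) (f := f) b.2 (by
      rw [← h, map_smul, bilinDeriv_metricBilin, smul_smul, div_mul_cancel₀ _ (by norm_num)]
      rfl)
    refine ⟨?_, ?_, ?_⟩
    · rw [show t = 0 by linarith, zero_smul]
    · rw [h2, map_zero]
    · rw [show b = 0 from Subtype.ext h3, map_zero]
  · obtain ⟨t, f, b, hb, h⟩ := exists_bilinDeriv_eq e α
    refine ⟨_, ?_, _, ⟨f, rfl⟩, _, ⟨⟨b, hb⟩, rfl⟩, h⟩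
    rw [map_smul, bilinDeriv_metricBilin, smul_smul]
    exact Submodule.smul_mem _ _ (Submodule.mem_span_singleton_self _)

theorem mem_range_symmDeriv_iff (e : Module.Basis (Fin 7) ℝ V) (α : Form V 3) :
    α ∈ LinearMap.range (symmDeriv e) ↔ wedge α (phi e) = 0 ∧
      wedge α (hodgeStar e (p := 3) (q := 4) rfl (phi e)) = 0 := by
  rw [star_phi, wedge_phi_eq_zero_iff, wedge_psi_eq_zero_iff]
  constructor
  · rintro ⟨b, rfl⟩
    have h := components_of_eq_bilinDeriv (t := 0) (f := 0) (α := symmDeriv e b) b.2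
      (by rw [zero_smul, map_zero, map_zero, map_zero, zero_add, zero_add]; rfl)
    simpa using And.symm h
  · rintro ⟨h1, h2⟩
    obtain ⟨t, f, b, hb, h⟩ := exists_bilinDeriv_eq e α
    obtain ⟨h3, h4⟩ := components_of_eq_bilinDeriv hb h
    have ht : t = 0 := by linarith
    have hf : f = 0 := e.ext fun l => by
      have := h4 l
      rw [h1] at this
      rw [LinearMap.zero_apply]
      linarith
    rw [ht, hf, zero_smul, map_zero, map_zero, map_zero, zero_add, zero_add] at h
    exact ⟨⟨b, hb⟩, h.symm⟩

theorem mem_range_crossDeriv_iff (e : Module.Basis (Fin 7) ℝ V) (β : Form V 3) :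
    β ∈ LinearMap.range (crossDeriv e) ↔ ∃ α : Form V 1,
      β = hodgeStar e (p := 4) (q := 3) rfl (wedge (phi e) α) := by
  constructor
  · rintro ⟨f, rfl⟩
    let α : Form V 1 := AlternatingMap.ofSubsingleton ℝ V ℝ (0 : Fin 1) f
    -- The derivation along `φ(f^♯, ·, ·)` is three times `⋆(φ ∧ α)`, so the factor is absorbed into
    -- the covector.
    refine ⟨(3 : ℝ) • α, ?_⟩
    have h1 := bilinDeriv_crossBilin e α f fun i => rfl
    have h2 := bilinDeriv_crossBilin e ((3 : ℝ) • α) ((3 : ℝ) • f) fun i => rfl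
    rw [map_smul, map_smul] at h2
    exact smul_right_injective _ (three_ne_zero (α := ℝ)) h2
  · rintro ⟨α, rfl⟩
    let f : Module.Dual ℝ V := (AlternatingMap.ofSubsingleton ℝ V ℝ (0 : Fin 1)).symm α
    have h := bilinDeriv_crossBilin e α f fun i => by
      change α _ = α _
      congr 1
      ext a
      fin_cases a
      rfl
    refine ⟨(3 : ℝ)⁻¹ • f, ?_⟩
    rw [map_smul, crossDeriv, LinearMap.comp_apply, h, smul_smul, inv_mul_cancel₀ (by norm_num),
      one_smul]

theorem finrank_range_crossDeriv (e : Module.Basis (Fin 7) ℝ V) :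
    Module.finrank ℝ (LinearMap.range (crossDeriv e)) = 7 := by
  have := Module.Finite.of_basis e
  rw [LinearMap.finrank_range_of_inj (crossDeriv_injective e), Subspace.dual_finrank_eq,
    Module.finrank_eq_card_basis e, Fintype.card_fin]

theorem finrank_range_symmDeriv (e : Module.Basis (Fin 7) ℝ V) :
    Module.finrank ℝ (LinearMap.range (symmDeriv e)) = 27 := by
  have := finite_form e 3
  have h := finrank_eq_add_of_isInternal (isInternal_forms_three e)
  rw [finrank_range_crossDeriv, finrank_form e 3, finrank_span_singleton (phi_ne_zero e)] at h
  have : Nat.choose 7 3 = 35 := rfl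
  omega

theorem mem_range_insertPhi_iff (e : Module.Basis (Fin 7) ℝ V) (α : Form V 2) :
    α ∈ LinearMap.range (insertPhi e) ↔ ∃ x : V, ∀ y z : V, α ![y, z] = phi e ![x, y, z] := by
  constructor
  · rintro ⟨f, rfl⟩
    exact ⟨sharp e f, fun y z => rfl⟩
  · rintro ⟨x, h⟩
    refine ⟨metricBilin e x, form2_ext (e := e) fun i j => ?_⟩
    rw [insertPhi_apply, sharp_metricBilin, h, formTri_apply]

theorem mem_range_flat_iff_exists (e : Module.Basis (Fin 7) ℝ V) (α : Form V 2) :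
    α ∈ LinearMap.range (flat e) ↔
      ∃ X ∈ lieG2 e, ∀ y z : V, α ![y, z] = metric e (X y) z := by
  rw [lieG2_eq]
  constructor
  · rintro ⟨B, rfl⟩
    exact ⟨B.1, B.2, fun y z => by rw [flat_apply, metricBilin_apply]⟩
  · rintro ⟨X, hX, h⟩
    refine ⟨⟨X, hX⟩, form2_ext (e := e) fun i j => ?_⟩
    rw [flat_apply, metricBilin_apply, h]

end G2Forms

end

theorem mainTheorem6 {V : Type*} [AddCommGroup V] [Module ℝ V] (e : Module.Basis (Fin 7) ℝ V) :
    ∃ (L27 L214 : Subrepresentation (G2Forms.formRep e 2))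
      (L31 L37 L327 : Subrepresentation (G2Forms.formRep e 3))
      (g2 : Subrepresentation (G2Forms.endRep e))
      (S : Subrepresentation (G2Forms.bilinRep e)),
      -- `g2` is the adjoint representation, `S` is `S₀²V*`
      (g2 : Set (V →ₗ[ℝ] V)) = G2Forms.lieG2 e ∧
      (S : Set (V →ₗ[ℝ] Module.Dual ℝ V)) = G2Forms.tracelessSymm e ∧
      -- the direct sum decompositions
      DirectSum.IsInternal ![L27.toSubmodule, L214.toSubmodule] ∧
      DirectSum.IsInternal ![L31.toSubmodule, L37.toSubmodule, L327.toSubmodule] ∧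
      -- the dimensions
      Module.finrank ℝ L27.toSubmodule = 7 ∧
      Module.finrank ℝ L214.toSubmodule = 14 ∧
      Module.finrank ℝ L31.toSubmodule = 1 ∧
      Module.finrank ℝ L37.toSubmodule = 7 ∧
      Module.finrank ℝ L327.toSubmodule = 27 ∧
      -- irreducibility
      G2Forms.Irred L27 ∧
      G2Forms.Irred L214 ∧
      G2Forms.Irred L31 ∧
      G2Forms.Irred L37 ∧
      G2Forms.Irred L327 ∧
      -- the identifications as modules over `G₂`
      Nonempty (L27.toRepresentation.Equiv (G2Forms.stdRep e).dual) ∧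
      Nonempty (L37.toRepresentation.Equiv (G2Forms.stdRep e).dual) ∧
      Nonempty (L214.toRepresentation.Equiv g2.toRepresentation) ∧
      Nonempty (L327.toRepresentation.Equiv S.toRepresentation) ∧
      -- the descriptions of the summands of `Λ²`
      (L27 : Set (G2Forms.Form V 2)) =
        {α | G2Forms.hodgeStar e (p := 5) (q := 2) rfl (G2Forms.wedge (G2Forms.phi e) α) =
          (2 : ℝ) • α} ∧
      (L27 : Set (G2Forms.Form V 2)) =
        {α | ∃ X : V, ∀ y z : V, α ![y, z] = G2Forms.phi e ![X, y, z]} ∧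
      (L214 : Set (G2Forms.Form V 2)) =
        {α | G2Forms.hodgeStar e (p := 5) (q := 2) rfl (G2Forms.wedge (G2Forms.phi e) α) = -α} ∧
      (L214 : Set (G2Forms.Form V 2)) =
        {α | ∃ X ∈ G2Forms.lieG2 e, ∀ y z : V, α ![y, z] = G2Forms.metric e (X y) z} ∧
      -- the descriptions of the summands of `Λ³`
      L31.toSubmodule = Submodule.span ℝ {G2Forms.phi e} ∧
      (L37 : Set (G2Forms.Form V 3)) =
        {β | ∃ α : G2Forms.Form V 1,
          β = G2Forms.hodgeStar e (p := 4) (q := 3) rfl (G2Forms.wedge (G2Forms.phi e) α)} ∧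
      (L327 : Set (G2Forms.Form V 3)) =
        {α | G2Forms.wedge α (G2Forms.phi e) = 0 ∧
          G2Forms.wedge α (G2Forms.hodgeStar e (p := 3) (q := 4) rfl (G2Forms.phi e)) = 0} := by
  have hflat := G2Forms.flat_equivariant e
  have hins := G2Forms.insertPhi_equivariant e
  have hcross := G2Forms.crossDeriv_equivariant e
  have hsymm := G2Forms.symmDeriv_equivariant e
  have e27 := G2Forms.rangeEquiv _ hins (G2Forms.insertPhi_injective e)
  have e37 := G2Forms.rangeEquiv _ hcross (G2Forms.crossDeriv_injective e)
  have e214 := G2Forms.rangeEquiv _ hflat (G2Forms.flat_injective e)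
  have e327 := G2Forms.rangeEquiv _ hsymm (G2Forms.symmDeriv_injective e)
  let : AddCommGroup (G2Forms.tracelessRep e).toSubmodule :=
    Submodule.addCommGroup (M := V →ₗ[ℝ] Module.Dual ℝ V) _
  have hS := G2Forms.irreducible_traceless (G2Forms.tracelessRep e) fun _ => Iff.rfl
  have hdual := G2Forms.isIrreducible_dual e
  refine ⟨G2Forms.rangeRep _ hins, G2Forms.rangeRep _ hflat, G2Forms.phiRep e,
    G2Forms.rangeRep _ hcross, G2Forms.rangeRep _ hsymm, G2Forms.g2Rep e, G2Forms.tracelessRep e,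
    ?_, rfl, G2Forms.isInternal_two (G2Forms.isCompl_two e), G2Forms.isInternal_forms_three e,
    G2Forms.finrank_range_insertPhi e, G2Forms.finrank_range_flat e,
    finrank_span_singleton (G2Forms.phi_ne_zero e), G2Forms.finrank_range_crossDeriv e,
    G2Forms.finrank_range_symmDeriv e, G2Forms.isIrreducible_of_equiv e27.symm hdual,
    G2Forms.irreducible_fourteen _ (G2Forms.mem_range_flat_iff e), G2Forms.irreducible_phiRep e,
    G2Forms.isIrreducible_of_equiv e37.symm hdual,
    G2Forms.isIrreducible_of_equiv e327.symm hS,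
    ⟨e27⟩, ⟨e37⟩, ⟨e214⟩, ⟨e327⟩, ?_, ?_, ?_, ?_, rfl, ?_, ?_⟩
  · rw [G2Forms.lieG2_eq]
    rfl
  · ext α
    exact (G2Forms.star_eq_two_smul_iff e α).symm
  · ext α
    exact G2Forms.mem_range_insertPhi_iff e α
  · ext α
    exact (G2Forms.mem_range_flat_iff e α).trans (G2Forms.star_eq_neg_iff e α).symm
  · ext α
    exact G2Forms.mem_range_flat_iff_exists e α
  · ext β
    exact G2Forms.mem_range_crossDeriv_iff e β
  · ext α
    exact G2Forms.mem_range_symmDeriv_iff e α
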